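/- Let $d\ge 1$. Let $\boldsymbol W,\boldsymbol W'$ be $\mathbb R^d$-valued random vectors and $Y,Y'$ real random variables on one probability space, and write $\Delta \boldsymbol W=\boldsymbol W'-\boldsymbol W$, $\Delta Y=Y'-Y$. Here $|\cdot|$ is the Euclidean norm, $\|\cdot\|_{op}$ the operator norm, $\|C\|_{HS}=\sqrt{\operatorname{tr}(C^TC)}$, and $d_W(\mu,\nu)=\sup_h|\int h\,d\mu-\int h\,d\nu|$, the supremum being over all $1$-Lipschitz $h:\mathbb R^d\to\mathbb R$; $\boldsymbol Z$ is a standard Gaussian vector in $\mathbb R^d$. A statement with $\pm$ stands for two statements. Assume: 1. $\boldsymbol W$ has mean $0$ and invertible covariance matrix $\Sigma$; $Y$ has mean $0$ and finite variance $\sigma_Y^2$; $\boldsymbol W$ and $Y$ are uncorrelated; $((\boldsymbol W,Y),(\boldsymbol W',Y'))$ and $((\boldsymbol W',Y'),(\boldsymbol W,Y))$ have the same law. 2. Almost surely $Y\in\zeta+\mathbb Z$ for some fixed $\zeta\in[0,1)$, and $\Delta Y\in\{-1,0,1\}$. With some $\lambda\in(0,1)$ and $Q=\lambda\sigma_Y^2$,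 $$\mathbb P(\Delta Y=\pm1\mid \boldsymbol W,Y)=Q+R_{0,\pm}.$$ 3. For an invertible $d\times d$ matrix $\Psi$, $$\mathbb E(\Delta \boldsymbol W\,\mathbf 1_{\Delta Y=\pm1}\mid \boldsymbol W,Y)=-\lambda\left(\tfrac12\Psi \boldsymbol W+\boldsymbol R_{1,\pm}\right).$$ 4. $\mathbb E(\Delta \boldsymbol W\Delta \boldsymbol W^T\,\mathbf 1_{\Delta Y=\pm1}\mid \boldsymbol W,Y)=\lambda\left(\Psi\Sigma+\Gamma_{2,\pm}\right).$ (The random variables $R_{0,\pm}$, vectors $\boldsymbol R_{1,\pm}$ and matrices $\Gamma_{2,\pm}$ are defined by these equations.) Let $k\in\mathbb R$ be such that $p_k=\mathbb P(Y=k)>0$ and $p_{k-1}=\mathbb P(Y=k-1)>0$, put $r_k=p_{k-1}/p_k$, and let \begin{align*} \widehat A_k&=\mathbb E(|\Psi^{-1}\boldsymbol R_{1,-}|\mid Y=k)+r_k\,\mathbb E(|\Psi^{-1}\boldsymbol R_{1,+}|\mid Y=k-1),\\ \widehat B_k&=\mathbb E(\|\Psi^{-1}\Gamma_{2,-}\|_{HS}\mid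 Y=k)+r_k\,\mathbb E(\|\Psi^{-1}\Gamma_{2,+}\|_{HS}\mid Y=k-1),\\ \widehat C_k&=\mathbb E\big((|\boldsymbol W|+\sqrt{\operatorname{tr}\Sigma})(|R_{0,+}|+|R_{0,-}|)\mid Y\in\{k-1,k\}\big),\\ \widehat D_k&=\mathbb E(|\Delta \boldsymbol W|\mid Y\in\{k-1,k\}),\\ \widehat E_k&=\mathbb E(|(\lambda\Psi)^{-1}\Delta \boldsymbol W|\,|\Delta \boldsymbol W|^3\mid Y\in\{k-1,k\}),\\ \widehat F_k&=\sqrt{\operatorname{tr}\Sigma+\mathbb E(|\boldsymbol W|^2\mid Y\in\{k-1,k\})},\\ \widehat E_k'&=\mathbb E(|(\lambda\Psi)^{-1}\Delta \boldsymbol W|\,|\Delta \boldsymbol W|^2\mid Y\in\{k-1,k\}),\\ \widehat F_k'&=1+\left|\log\left(c_2\|\Sigma^{-1/2}\|_{op}^2\,\widehat E_k'/\widehat F_k\right)\right|, \end{align*} where $c_2=4/\sqrt{2\pi e}<1$ and $c_3=(2+8e^{-3/2})/\sqrt{2\pi}<2$ (in case $\widehat E'_k=0$, the product $\widehat E_k'\widehat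 F_k'$ is read as $0$). If $\mathbb E|\boldsymbol W|^4<\infty$, then $$d_W\big((\boldsymbol W\mid Y=k),\Sigma^{1/2}\boldsymbol Z\big)\le \widehat A_k+\tfrac12\|\Sigma^{-1/2}\|_{op}\widehat B_k+\frac{1+r_k}{2Q}(\widehat C_k+\widehat D_k)+(1+r_k)\|\Sigma^{-1/2}\|_{op}^{3/2}\sqrt{c_3\,\widehat E_k\widehat F_k}.$$ In particular, if moreover $\Sigma=I_d$, then $$d_W\big((\boldsymbol W\mid Y=k),\boldsymbol Z\big)\le \widehat A_k+\tfrac12\widehat B_k+\frac{1+r_k}{2Q}(\widehat C_k+\widehat D_k)+(1+r_k)\big(d+\mathbb E(|\boldsymbol W|^2\mid Y\in\{k-1,k\})\big)^{1/4}\sqrt{\widehat E_k}.$$ If only $\mathbb E|\boldsymbol W|^3<\infty$ is assumed, then $$d_W\big((\boldsymbol W\mid Y=k),\Sigma^{1/2}\boldsymbol Z\big)\le \widehat A_k+\tfrac12\|\Sigma^{-1/2}\|_{op}\widehat B_k+\frac{1+r_k}{2Q}(\widehat C_k+\widehat D_k)+c_2(1+r_k)\|\Sigma^{-1/2}\|_{op}^2\,\widehat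 E_k'\,\widehat F_k'.$$ -/

import Mathlib

open MeasureTheory ProbabilityTheory
open scoped ENNReal MatrixOrder

noncomputable section

/-- The Wasserstein-1 distance of two laws, as a supremum over 1-Lipschitz test functions, with
values in `[0, ∞]` (it is applied to laws with a finite first moment, so that every `1`-Lipschitz
function is integrable). -/
def dWass {E : Type*} [NormedAddCommGroup E] [MeasurableSpace E] (μ ν : Measure E) : ℝ≥0∞ :=
  ⨆ (h : E → ℝ) (_ : LipschitzWith 1 h), ENNReal.ofReal |∫ x, h x ∂μ - ∫ x, h x ∂ν|

/-- The action `M v` of a matrix on Euclidean space. -/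
def mulV {d : ℕ} (M : Matrix (Fin d) (Fin d) ℝ) (v : EuclideanSpace ℝ (Fin d)) :
    EuclideanSpace ℝ (Fin d) :=
  Matrix.toEuclideanCLM (n := Fin d) (𝕜 := ℝ) M v

/-- The operator norm of a matrix with respect to the Euclidean norm. -/
def opNorm {d : ℕ} (M : Matrix (Fin d) (Fin d) ℝ) : ℝ :=
  ‖Matrix.toEuclideanCLM (n := Fin d) (𝕜 := ℝ) M‖

/-- The Hilbert-Schmidt norm `√(tr (Mᵀ M))`. -/
def hsNorm {d : ℕ} (M : Matrix (Fin d) (Fin d) ℝ) : ℝ :=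
  Real.sqrt (M.transpose * M).trace

/-- `S^{-1/2}`, the inverse of the positive semidefinite square root of `S`. -/
def invSqrt {d : ℕ} (S : Matrix (Fin d) (Fin d) ℝ) : Matrix (Fin d) (Fin d) ℝ :=
  (CFC.sqrt S)⁻¹

section

variable {Ω : Type*} [MeasurableSpace Ω] {d : ℕ}

/-- The σ-algebra generated by `(W, Y)`. -/
abbrev sigmaWY (W : Ω → EuclideanSpace ℝ (Fin d)) (Y : Ω → ℝ) : MeasurableSpace Ω :=
  MeasurableSpace.comap (fun ω => (W ω, Y ω)) inferInstance

/-- The event `{Y' - Y = s}`. -/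
def jump (Y Y' : Ω → ℝ) (s : ℝ) : Set Ω := {ω | Y' ω - Y ω = s}

/-- `M_0 = E(1_{Y' - Y = s} | W, Y)`. -/
def condM0 (P : Measure Ω) (W : Ω → EuclideanSpace ℝ (Fin d)) (Y Y' : Ω → ℝ) (s : ℝ) : Ω → ℝ :=
  P[(jump Y Y' s).indicator (fun _ => (1 : ℝ)) | sigmaWY W Y]

/-- `M_1 = E((W' - W) 1_{Y' - Y = s} | W, Y)`. -/
def condM1 (P : Measure Ω) (W W' : Ω → EuclideanSpace ℝ (Fin d)) (Y Y' : Ω → ℝ) (s : ℝ) :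
    Ω → EuclideanSpace ℝ (Fin d) :=
  P[(jump Y Y' s).indicator (fun ω => W' ω - W ω) | sigmaWY W Y]

/-- The `(i, j)` entry of `E((W' - W)(W' - W)ᵀ 1_{Y' - Y = s} | W, Y)`. -/
def condM2 (P : Measure Ω) (W W' : Ω → EuclideanSpace ℝ (Fin d)) (Y Y' : Ω → ℝ) (s : ℝ)
    (i j : Fin d) : Ω → ℝ :=
  P[(jump Y Y' s).indicator (fun ω => (W' ω - W ω) i * (W' ω - W ω) j) | sigmaWY W Y]

/-- `Q = λ Var(Y)`. -/
def QVal (P : Measure Ω) (Y : Ω → ℝ) (lam : ℝ) : ℝ := lam * Var[Y; P]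

/-- The standing assumptions on `(W, Y)` and its exchangeable copy `(W', Y')`; the suffixes `p`
and `m` of the remainders stand for the signs `+` and `-`, i.e. for `Y' - Y = 1` and
`Y' - Y = -1`. -/
structure CondSteinAssumptions (P : Measure Ω)
    (W W' : Ω → EuclideanSpace ℝ (Fin d)) (Y Y' : Ω → ℝ)
    (S Ψ : Matrix (Fin d) (Fin d) ℝ) (lam ζ : ℝ)
    (R0p R0m : Ω → ℝ) (R1p R1m : Ω → EuclideanSpace ℝ (Fin d))
    (C2p C2m : Ω → Matrix (Fin d) (Fin d) ℝ) : Prop where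
  measurable_W : Measurable W
  measurable_W' : Measurable W'
  measurable_Y : Measurable Y
  measurable_Y' : Measurable Y'
  /-- `W` has mean `0` and invertible covariance matrix `S`. -/
  memLp_W : MemLp W 2 P
  mean_W : ∫ ω, W ω ∂P = 0
  cov_W : ∀ i j, cov[fun ω => W ω i, fun ω => W ω j; P] = S i j
  isUnit_S : IsUnit S
  /-- `Y` has mean `0` and finite variance. -/
  memLp_Y : MemLp Y 2 P
  mean_Y : ∫ ω, Y ω ∂P = 0
  /-- `W` and `Y` are uncorrelated. -/
  uncorr : ∀ i, cov[fun ω => W ω i, Y; P] = 0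
  /-- `(W, Y)` and `(W', Y')` are exchangeable. -/
  exch : P.map (fun ω => ((W ω, Y ω), (W' ω, Y' ω))) =
    P.map (fun ω => ((W' ω, Y' ω), (W ω, Y ω)))
  /-- `Y` takes values in `ζ + ℤ` and moves by at most one. -/
  ζ_mem : ζ ∈ Set.Ico (0 : ℝ) 1
  lattice : ∀ᵐ ω ∂P, ∃ n : ℤ, Y ω = ζ + n
  step : ∀ᵐ ω ∂P, Y' ω - Y ω = -1 ∨ Y' ω - Y ω = 0 ∨ Y' ω - Y ω = 1
  lam_mem : lam ∈ Set.Ioo (0 : ℝ) 1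
  zeroth_p : condM0 P W Y Y' 1 =ᵐ[P] fun ω => QVal P Y lam + R0p ω
  zeroth_m : condM0 P W Y Y' (-1) =ᵐ[P] fun ω => QVal P Y lam + R0m ω
  /-- The linearity condition. -/
  isUnit_Ψ : IsUnit Ψ
  first_p : condM1 P W W' Y Y' 1 =ᵐ[P]
    fun ω => -(lam • ((1 / 2 : ℝ) • mulV Ψ (W ω) + R1p ω))
  first_m : condM1 P W W' Y Y' (-1) =ᵐ[P]
    fun ω => -(lam • ((1 / 2 : ℝ) • mulV Ψ (W ω) + R1m ω))
  /-- The conditional second moments. -/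
  second_p : ∀ i j, condM2 P W W' Y Y' 1 i j =ᵐ[P] fun ω => lam * ((Ψ * S) i j + C2p ω i j)
  second_m : ∀ i j, condM2 P W W' Y Y' (-1) i j =ᵐ[P] fun ω => lam * ((Ψ * S) i j + C2m ω i j)

/-- `E(f | Y = k)`. -/
def condAt (P : Measure Ω) (Y : Ω → ℝ) (k : ℝ) (f : Ω → ℝ) : ℝ :=
  ∫ ω, f ω ∂P[|Y ⁻¹' {k}]

/-- `E(f | Y ∈ {k - 1, k})`. -/
def condPair (P : Measure Ω) (Y : Ω → ℝ) (k : ℝ) (f : Ω → ℝ) : ℝ :=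
  ∫ ω, f ω ∂P[|Y ⁻¹' {k - 1, k}]

/-- The law of `W` given `Y = k`. -/
def condLaw (P : Measure Ω) (W : Ω → EuclideanSpace ℝ (Fin d)) (Y : Ω → ℝ) (k : ℝ) :
    Measure (EuclideanSpace ℝ (Fin d)) :=
  P[|Y ⁻¹' {k}].map W

/-- `r_k = P(Y = k - 1) / P(Y = k)`. -/
def ratio (P : Measure Ω) (Y : Ω → ℝ) (k : ℝ) : ℝ :=
  P.real (Y ⁻¹' {k - 1}) / P.real (Y ⁻¹' {k})

def AHat (P : Measure Ω) (Y : Ω → ℝ) (Ψ : Matrix (Fin d) (Fin d) ℝ)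
    (R1p R1m : Ω → EuclideanSpace ℝ (Fin d)) (k : ℝ) : ℝ :=
  condAt P Y k (fun ω => ‖mulV Ψ⁻¹ (R1m ω)‖)
    + ratio P Y k * condAt P Y (k - 1) (fun ω => ‖mulV Ψ⁻¹ (R1p ω)‖)

def BHat (P : Measure Ω) (Y : Ω → ℝ) (Ψ : Matrix (Fin d) (Fin d) ℝ)
    (C2p C2m : Ω → Matrix (Fin d) (Fin d) ℝ) (k : ℝ) : ℝ :=
  condAt P Y k (fun ω => hsNorm (Ψ⁻¹ * C2m ω))
    + ratio P Y k * condAt P Y (k - 1) (fun ω => hsNorm (Ψ⁻¹ * C2p ω))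

def CHat (P : Measure Ω) (W : Ω → EuclideanSpace ℝ (Fin d)) (Y : Ω → ℝ)
    (S : Matrix (Fin d) (Fin d) ℝ) (R0p R0m : Ω → ℝ) (k : ℝ) : ℝ :=
  condPair P Y k (fun ω => (‖W ω‖ + Real.sqrt S.trace) * (|R0p ω| + |R0m ω|))

def DHat (P : Measure Ω) (W W' : Ω → EuclideanSpace ℝ (Fin d)) (Y : Ω → ℝ) (k : ℝ) : ℝ :=
  condPair P Y k (fun ω => ‖W' ω - W ω‖)

def EHat (P : Measure Ω) (W W' : Ω → EuclideanSpace ℝ (Fin d)) (Y : Ω → ℝ)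
    (Ψ : Matrix (Fin d) (Fin d) ℝ) (lam k : ℝ) : ℝ :=
  condPair P Y k (fun ω => ‖mulV (lam • Ψ)⁻¹ (W' ω - W ω)‖ * ‖W' ω - W ω‖ ^ 3)

def FHat (P : Measure Ω) (W : Ω → EuclideanSpace ℝ (Fin d)) (Y : Ω → ℝ)
    (S : Matrix (Fin d) (Fin d) ℝ) (k : ℝ) : ℝ :=
  Real.sqrt (S.trace + condPair P Y k (fun ω => ‖W ω‖ ^ 2))

/-- `c_2 = 4 / √(2πe)`. -/
def cTwo : ℝ := 4 / Real.sqrt (2 * Real.pi * Real.exp 1)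

/-- `c_3 = (2 + 8 e^{-3/2}) / √(2π)`. -/
def cThree : ℝ := (2 + 8 * Real.exp (-(3 / 2))) / Real.sqrt (2 * Real.pi)

def EHat' (P : Measure Ω) (W W' : Ω → EuclideanSpace ℝ (Fin d)) (Y : Ω → ℝ)
    (Ψ : Matrix (Fin d) (Fin d) ℝ) (lam k : ℝ) : ℝ :=
  condPair P Y k (fun ω => ‖mulV (lam • Ψ)⁻¹ (W' ω - W ω)‖ * ‖W' ω - W ω‖ ^ 2)

def FHat' (P : Measure Ω) (W W' : Ω → EuclideanSpace ℝ (Fin d)) (Y : Ω → ℝ)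
    (S Ψ : Matrix (Fin d) (Fin d) ℝ) (lam k : ℝ) : ℝ :=
  1 + |Real.log (cTwo * opNorm (invSqrt S) ^ 2 * (EHat' P W W' Y Ψ lam k / FHat P W Y S k))|

end

end

/-!
For a continuously differentiable `1`-Lipschitz test function `h` with gradient `G`, put `A = S^{1/2}`
and interpolate between the standard Gaussian vector and `W` on a quarter circle, along
`sin θ • W + cos θ • A Z` with `Z` standard Gaussian and independent of everything else. The
derivative of `E[h(sin θ • W + cos θ • A Z); Y ∈ {k - 1, k}]` in `θ` is, up to the factor `cos θ`,
the Stein functional `E[⟪W, g W⟫ - tr (Hᵀ S); Y ∈ {k - 1, k}]`, where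
`g w = E G(sin θ • w + cos θ • A Z)` is the smoothed gradient (`smoothGrad`) and `H` its derivative
(`smoothHess`), which is expressed through `G` alone by Gaussian integration by parts
(`deriv_gaussInterp_eq`).

The Stein functional is evaluated on the event that `(Y, Y')` crosses between `k - 1` and `k`, an
event that is symmetric under the exchange of `(W, Y)` and `(W', Y')` (`stein_functional_eq`). The
first and second conditional moments of `W' - W` on it produce `AHat` and `BHat`. What is left is
the error of the trapezoidal rule for `g` along the jump from `W` to `W'`: the increment
`g W' - g W` is compared with the mean of `H W (W' - W)` and `H W' (W' - W)`. The trapezoidal rule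
is the point: by symmetry it costs nothing over a one-sided expansion, and its error is of second
and even of third order in the jump. As `g` is a Gaussian average, its derivatives fall on the
Gaussian density (`integral_add_stdGaussian`, the Cameron-Martin formula), so that the error is at
most `‖Ψ⁻¹ (W' - W)‖ * (tan θ * ‖S^{-1/2}‖ * ‖W' - W‖) ^ n` for `n = 2, 3`
(`abs_trapezoidError_le`).

The factor `cos θ * tan θ ^ n` is not integrable up to `π / 2`. Hence the interpolation stops at an
angle `θ₀`, and the remaining stretch costs at most a multiple of `cos θ₀` (`abs_sub_gaussInterp_le`).
This bounds the mean of `h W` over the two levels `Y = k - 1` and `Y = k` together. The two levels are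
separated by the zeroth conditional moments: exchangeability equates the up-jumps from `k - 1` with
the down-jumps from `k`, at the expense of `CHat` and `DHat` (`abs_level_sub_le`). Minimising over
`x = cos θ₀` gives the square root under a fourth moment (`le_sqrt_of_forall_inv`), and the logarithm
under a third (`le_log_of_forall`). Arbitrary Lipschitz functions are reached by convolution with
bump functions (`exists_smooth_lipschitz_approx`). The estimates leave room in the constants: of
`cThree` only `1 ≤ cThree` is used, and of `cTwo`, inside and outside the logarithm, `1 / 2 ≤ cTwo`.
-/

noncomputable section

set_option linter.unusedSectionVars false

/-! ### Translates of the standard Gaussian measure -/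

section GaussianTranslation

variable {d : ℕ}

local notation "E" => EuclideanSpace ℝ (Fin d)

lemma map_inner_stdGaussian (e : E) :
    (stdGaussian E).map (fun z => inner ℝ e z) = gaussianReal 0 (‖e‖₊ ^ 2) := by
  have h := IsGaussian.map_eq_gaussianReal (μ := stdGaussian E) (innerSL ℝ e)
  rw [integral_strongDual_stdGaussian, variance_dual_stdGaussian, innerSL_apply_norm] at h
  have h2 : (‖e‖ ^ 2).toNNReal = ‖e‖₊ ^ 2 := by
    rw [← coe_nnnorm, ← NNReal.coe_pow, Real.toNNReal_coe]
  rw [h2] at h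
  exact h

lemma integrable_exp_inner_stdGaussian (e : E) (t : ℝ) :
    Integrable (fun z : E => Real.exp (t * inner ℝ e z)) (stdGaussian E) := by
  have h := integrable_exp_mul_gaussianReal (μ := 0) (v := ‖e‖₊ ^ 2) t
  rw [← map_inner_stdGaussian] at h
  exact h.comp_measurable (by fun_prop)

lemma integral_exp_inner_stdGaussian (e : E) (t : ℝ) :
    ∫ z : E, Real.exp (t * inner ℝ e z) ∂(stdGaussian E) = Real.exp (‖e‖ ^ 2 * t ^ 2 / 2) := by
  have h := mgf_gaussianReal (map_inner_stdGaussian e) t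
  simpa [mgf] using h

open Complex in
lemma integral_cexp_inner_add_stdGaussian (e t : E) :
    ∫ z : E, cexp (inner ℝ e z + inner ℝ z t * I) ∂(stdGaussian E)
      = cexp ((‖e‖ ^ 2 - ‖t‖ ^ 2) / 2 + inner ℝ e t * I) := by
  rw [← map_pi_eq_stdGaussian, integral_map (by fun_prop) (by fun_prop)]
  have h1 : ∀ x : Fin d → ℝ, cexp (inner ℝ e (WithLp.toLp 2 x) + inner ℝ (WithLp.toLp 2 x) t * I)
      = ∏ i, cexp ((e i + t i * I) * x i) := by
    intro x
    rw [← exp_sum]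
    congr 1
    simp only [PiLp.inner_apply, RCLike.inner_apply, conj_trivial, ofReal_sum, ofReal_mul,
      Finset.sum_mul, ← Finset.sum_add_distrib]
    refine Finset.sum_congr rfl fun i _ => ?_
    ring
  simp_rw [h1]
  rw [integral_fintype_prod_eq_prod (f := fun i (x : ℝ) => cexp ((e i + t i * I) * x))]
  have h2 : ∀ i, ∫ x : ℝ, cexp ((e i + t i * I) * x) ∂(gaussianReal 0 1)
      = cexp ((e i + t i * I) ^ 2 / 2) := by
    intro i
    have h := complexMGF_id_gaussianReal (μ := 0) (v := 1) (e i + t i * I)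
    simpa [complexMGF] using h
  simp_rw [h2]
  rw [← exp_sum]
  congr 1
  have h3 : ∀ v : E, ((‖v‖ : ℂ)) ^ 2 = ∑ i, (v i : ℂ) ^ 2 := by
    intro v
    rw [← ofReal_pow, EuclideanSpace.norm_sq_eq]
    simp
  rw [h3, h3]
  simp only [PiLp.inner_apply, RCLike.inner_apply, conj_trivial, ofReal_sum, ofReal_mul,
      Finset.sum_mul, ← Finset.sum_add_distrib, ← Finset.sum_sub_distrib, Finset.sum_div]
  refine Finset.sum_congr rfl fun i _ => ?_
  have : I ^ 2 = -1 := I_sq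
  linear_combination ((t i : ℂ) ^ 2 / 2) * this

open Complex in
/-- The Cameron-Martin theorem for the standard Gaussian measure: its translate by `e` is its
exponential tilt by `⟪e, ·⟫`. -/
lemma map_add_stdGaussian (e : E) :
    (stdGaussian E).map (fun z => z + e) = (stdGaussian E).tilted (fun z => inner ℝ e z) := by
  have hint := integrable_exp_inner_stdGaussian e 1
  simp only [one_mul] at hint
  have : IsProbabilityMeasure ((stdGaussian E).tilted (fun z => inner ℝ e z)) :=
    isProbabilityMeasure_tilted hint
  have : IsProbabilityMeasure ((stdGaussian E).map (fun z => z + e)) :=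
    Measure.isProbabilityMeasure_map (by fun_prop)
  apply Measure.ext_of_charFun
  ext t
  rw [charFun_apply, charFun_apply, integral_map (by fun_prop) (by fun_prop), integral_tilted]
  have hZ := integral_exp_inner_stdGaussian e 1
  simp only [one_mul, one_pow, mul_one] at hZ
  rw [hZ]
  have h1 : ∀ z : E, (Real.exp (inner ℝ e z) / Real.exp (‖e‖ ^ 2 / 2)) • cexp (inner ℝ z t * I)
      = cexp (inner ℝ e z + inner ℝ z t * I) * cexp (-(‖e‖ ^ 2 / 2)) := by
    intro z
    rw [← Real.exp_sub, real_smul, ofReal_exp, ← exp_add, ← exp_add]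
    congr 1
    push_cast
    ring
  have h2 : ∀ z : E, cexp (inner ℝ (z + e) t * I)
      = cexp (inner ℝ z t * I) * cexp (inner ℝ e t * I) := by
    intro z
    rw [← exp_add, inner_add_left]
    congr 1
    push_cast
    ring
  simp_rw [h1, h2]
  rw [integral_mul_const, integral_mul_const, integral_cexp_inner_add_stdGaussian, ← charFun_apply,
    charFun_stdGaussian, ← exp_add, ← exp_add]
  congr 1
  ring

lemma integral_add_stdGaussian (e : E) (F : E → ℝ) :
    ∫ z, F (z + e) ∂(stdGaussian E)
      = ∫ z, Real.exp (inner ℝ e z - ‖e‖ ^ 2 / 2) * F z ∂(stdGaussian E) := by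
  have h0 : ∫ z, F (z + e) ∂(stdGaussian E)
      = ∫ z, F z ∂((stdGaussian E).map (fun z => z + e)) := by
    rw [(measurableEmbedding_addRight e).integral_map]
  rw [h0, map_add_stdGaussian, integral_tilted]
  have hZ := integral_exp_inner_stdGaussian e 1
  simp only [one_mul, one_pow, mul_one] at hZ
  rw [hZ]
  simp_rw [← Real.exp_sub, smul_eq_mul]

lemma integrable_pow_inner_mul_exp_stdGaussian (e : E) (n : ℕ) (t r : ℝ) (hr : 0 ≤ r) :
    Integrable (fun z : E => |inner ℝ e z| ^ n * Real.exp (t * inner ℝ e z + r * |inner ℝ e z|))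
      (stdGaussian E) :=
  integrable_pow_abs_mul_exp_add_of_integrable_exp_mul (t := r + 1)
    (integrable_exp_inner_stdGaussian e _) (integrable_exp_inner_stdGaussian e _) hr
    (by rw [abs_of_nonneg (by positivity)]; linarith) n

lemma integrable_mul_pow_inner_mul_exp {F : E → ℝ} (hF : Measurable F) {C : ℝ}
    (hC : ∀ z, |F z| ≤ C) (e : E) (n : ℕ) (t : ℝ) :
    Integrable (fun z => F z * (inner ℝ e z ^ n * Real.exp (t * inner ℝ e z)))
      (stdGaussian E) := by
  have h := integrable_pow_inner_mul_exp_stdGaussian e n t 0 le_rfl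
  refine (h.const_mul C).mono' (by fun_prop) (ae_of_all _ fun z => ?_)
  rw [Real.norm_eq_abs, abs_mul, abs_mul, abs_pow, Real.abs_exp]
  simp only [zero_mul, add_zero]
  gcongr
  exact hC z

lemma integrable_mul_pow_inner {F : E → ℝ} (hF : Measurable F) {C : ℝ}
    (hC : ∀ z, |F z| ≤ C) (e : E) (n : ℕ) :
    Integrable (fun z => F z * inner ℝ e z ^ n) (stdGaussian E) := by
  simpa using integrable_mul_pow_inner_mul_exp hF hC e n 0

lemma integrable_pow_inner (e : E) (n : ℕ) :
    Integrable (fun z : E => inner ℝ e z ^ n) (stdGaussian E) := by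
  simpa using integrable_mul_pow_inner (F := fun _ => 1) measurable_const (C := 1) (by simp) e n

/-- Differentiation under the integral sign; the domination on `|s - t| < 1` uses
`exp (s * x) ≤ exp (t * x + |x|)`. -/
lemma hasDerivAt_integral_mul_pow_inner_mul_exp {F : E → ℝ} (hF : Measurable F) {C : ℝ}
    (hC : ∀ z, |F z| ≤ C) (e : E) (n : ℕ) (t : ℝ) :
    HasDerivAt
      (fun t => ∫ z, F z * (inner ℝ e z ^ n * Real.exp (t * inner ℝ e z)) ∂(stdGaussian E))
      (∫ z, F z * (inner ℝ e z ^ (n + 1) * Real.exp (t * inner ℝ e z)) ∂(stdGaussian E)) t := by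
  have hC0 : 0 ≤ C := (abs_nonneg _).trans (hC 0)
  have h := integrable_pow_inner_mul_exp_stdGaussian e (n + 1) t 1 zero_le_one
  refine (hasDerivAt_integral_of_dominated_loc_of_deriv_le (Metric.ball_mem_nhds t one_pos)
    (F' := fun t z => F z * (inner ℝ e z ^ (n + 1) * Real.exp (t * inner ℝ e z)))
    (Filter.Eventually.of_forall fun s => (by fun_prop))
    (integrable_mul_pow_inner_mul_exp hF hC e n t) (by fun_prop)
    (ae_of_all _ fun z s hs => ?_) (h.const_mul C) (ae_of_all _ fun z s _ => ?_)).2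
  · rw [Real.norm_eq_abs, abs_mul, abs_mul, abs_pow, Real.abs_exp]
    rw [Metric.mem_ball, Real.dist_eq] at hs
    have h1 : (s - t) * inner ℝ e z ≤ 1 * |inner ℝ e z| := by
      refine (le_abs_self _).trans ?_
      rw [abs_mul]
      gcongr
    gcongr
    · exact hC z
    · linarith
  · have h1 : HasDerivAt (fun s => Real.exp (s * inner ℝ e z))
        (Real.exp (s * inner ℝ e z) * inner ℝ e z) s := by
      simpa using ((hasDerivAt_id s).mul_const (inner ℝ e z)).exp
    exact ((h1.const_mul (inner ℝ e z ^ n)).const_mul (F z)).congr_deriv (by ring)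

end GaussianTranslation

/-! ### The trapezoidal rule for Gaussian averages -/

section GaussianTrapezoid

variable {d : ℕ}

local notation "E" => EuclideanSpace ℝ (Fin d)

/-- The translate of a Gaussian average, with the translation moved from `F` to an exponential
weight, so that it can be differentiated in `t` for merely measurable `F`. -/
lemma integral_shift_mul (e : E) (t : ℝ) (F : E → ℝ) (p : ℝ → ℝ) :
    ∫ z, F (z + t • e) * p (inner ℝ e z) ∂(stdGaussian E)
      = Real.exp (-(t ^ 2 * ‖e‖ ^ 2 / 2)) * ∫ z, F z * (p (inner ℝ e z - t * ‖e‖ ^ 2)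
          * Real.exp (t * inner ℝ e z)) ∂(stdGaussian E) := by
  have h := integral_add_stdGaussian (t • e) (fun z => F z * p (inner ℝ e z - t * ‖e‖ ^ 2))
  have h1 : ∀ z : E, inner ℝ e (z + t • e) - t * ‖e‖ ^ 2 = inner ℝ e z := by
    intro z
    rw [inner_add_right, real_inner_smul_right, real_inner_self_eq_norm_sq]
    ring
  simp only [h1] at h
  rw [h, ← integral_const_mul]
  congr 1
  ext z
  rw [norm_smul, Real.norm_eq_abs, mul_pow, sq_abs, real_inner_smul_left, sub_eq_add_neg,
    Real.exp_add]
  ring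

lemma hasDerivAt_exp_neg_sq (b : ℝ) :
    HasDerivAt (fun t : ℝ => Real.exp (-(t ^ 2 * b / 2))) 0 0 := by
  have h : HasDerivAt (fun t : ℝ => -(t ^ 2 * b / 2)) 0 0 := by
    have h1 := ((((hasDerivAt_id (0 : ℝ)).pow 2).mul_const b).div_const 2).neg
    exact h1.congr_deriv (by simp)
  exact h.exp.congr_deriv (by simp)

/-- Differentiability of `s ↦ E[F(Z + s e) p(⟪e, Z⟫)]` at `t` reduces to `t = 0`, applied to the
translated function `F(· + t e)`. -/
lemma hasDerivAt_shift_of_zero {F : E → ℝ} {e : E} {p : ℝ → ℝ} {t D : ℝ}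
    (h : HasDerivAt (fun s : ℝ => ∫ z, F (z + s • e + t • e) * p (inner ℝ e z) ∂(stdGaussian E)) D 0) :
    HasDerivAt (fun s : ℝ => ∫ z, F (z + s • e) * p (inner ℝ e z) ∂(stdGaussian E)) D t := by
  have h2 : HasDerivAt (fun s : ℝ => ∫ z, F (z + (s - t) • e + t • e) * p (inner ℝ e z)
      ∂(stdGaussian E)) D t := by
    have h0 : HasDerivAt (fun s : ℝ => ∫ z, F (z + s • e + t • e) * p (inner ℝ e z) ∂(stdGaussian E))
        D (t - t) := by simpa using h
    exact h0.comp_sub_const t t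
  convert h2 using 6 with s z
  rw [add_assoc, ← add_smul, sub_add_cancel]

/-- Successive derivatives of `s ↦ E F(Z + s e)` are the averages of `F(Z + s e)` against the
Hermite polynomials in `⟪e, Z⟫`; here the first one, then the second and the third. -/
lemma hasDerivAt_shift_zero {F : E → ℝ} (hF : Measurable F) {C : ℝ}
    (hC : ∀ z, |F z| ≤ C) (e : E) (t : ℝ) :
    HasDerivAt (fun s : ℝ => ∫ z, F (z + s • e) ∂(stdGaussian E))
      (∫ z, F (z + t • e) * inner ℝ e z ∂(stdGaussian E)) t := by
  have hF' : Measurable (fun z => F (z + t • e)) := by fun_prop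
  have key := hasDerivAt_shift_of_zero (F := F) (e := e) (p := fun _ => 1) (t := t)
    (D := ∫ z, F (z + t • e) * inner ℝ e z ∂(stdGaussian E)) ?_
  · simpa using key
  · simp_rw [integral_shift_mul e _ (fun z => F (z + t • e)) (fun _ => 1)]
    have h0 := hasDerivAt_integral_mul_pow_inner_mul_exp hF' (fun z => hC _) e 0 0
    have h3 := (hasDerivAt_exp_neg_sq (‖e‖ ^ 2)).mul h0
    simp only [pow_zero, one_mul] at h3 ⊢
    exact h3.congr_deriv (by simp)

lemma hasDerivAt_shift_one {F : E → ℝ} (hF : Measurable F) {C : ℝ}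
    (hC : ∀ z, |F z| ≤ C) (e : E) (t : ℝ) :
    HasDerivAt (fun s : ℝ => ∫ z, F (z + s • e) * inner ℝ e z ∂(stdGaussian E))
      (∫ z, F (z + t • e) * (inner ℝ e z ^ 2 - ‖e‖ ^ 2) ∂(stdGaussian E)) t := by
  have hF' : Measurable (fun z => F (z + t • e)) := by fun_prop
  have hC' : ∀ z, |F (z + t • e)| ≤ C := fun z => hC _
  refine hasDerivAt_shift_of_zero (F := F) (e := e) (p := fun x => x) (t := t) ?_
  simp_rw [integral_shift_mul e _ (fun z => F (z + t • e)) (fun x => x)]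
  set b := ‖e‖ ^ 2
  have h0 := hasDerivAt_integral_mul_pow_inner_mul_exp hF' hC' e 0 0
  have h1 := hasDerivAt_integral_mul_pow_inner_mul_exp hF' hC' e 1 0
  have hs : ∀ s : ℝ, ∫ z, F (z + t • e) * ((inner ℝ e z - s * b) * Real.exp (s * inner ℝ e z))
        ∂(stdGaussian E)
      = (∫ z, F (z + t • e) * (inner ℝ e z ^ 1 * Real.exp (s * inner ℝ e z)) ∂(stdGaussian E))
        - s * b * ∫ z, F (z + t • e) * (inner ℝ e z ^ 0 * Real.exp (s * inner ℝ e z))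
          ∂(stdGaussian E) := by
    intro s
    rw [← integral_const_mul, ← integral_sub
      (integrable_mul_pow_inner_mul_exp hF' hC' e 1 s)
      ((integrable_mul_pow_inner_mul_exp hF' hC' e 0 s).const_mul _)]
    congr 1
    ext z
    ring
  simp_rw [hs]
  refine ((hasDerivAt_exp_neg_sq b).mul
    (h1.sub (((hasDerivAt_id (0 : ℝ)).mul_const b).mul h0))).congr_deriv ?_
  have i2 := integrable_mul_pow_inner hF' hC' e 2
  have i0 := integrable_mul_pow_inner hF' hC' e 0
  simp only [pow_zero, mul_one] at i0
  simp_rw [mul_sub]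
  rw [integral_sub i2 (i0.mul_const b), integral_mul_const]
  simp
  ring

lemma hasDerivAt_shift_two {F : E → ℝ} (hF : Measurable F) {C : ℝ}
    (hC : ∀ z, |F z| ≤ C) (e : E) (t : ℝ) :
    HasDerivAt (fun s : ℝ => ∫ z, F (z + s • e) * (inner ℝ e z ^ 2 - ‖e‖ ^ 2) ∂(stdGaussian E))
      (∫ z, F (z + t • e) * (inner ℝ e z ^ 3 - 3 * ‖e‖ ^ 2 * inner ℝ e z) ∂(stdGaussian E)) t := by
  have hF' : Measurable (fun z => F (z + t • e)) := by fun_prop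
  have hC' : ∀ z, |F (z + t • e)| ≤ C := fun z => hC _
  refine hasDerivAt_shift_of_zero (F := F) (e := e) (p := fun x => x ^ 2 - ‖e‖ ^ 2) (t := t) ?_
  simp_rw [integral_shift_mul e _ (fun z => F (z + t • e)) (fun x => x ^ 2 - ‖e‖ ^ 2)]
  set b := ‖e‖ ^ 2
  have h0 := hasDerivAt_integral_mul_pow_inner_mul_exp hF' hC' e 0 0
  have h1 := hasDerivAt_integral_mul_pow_inner_mul_exp hF' hC' e 1 0
  have h2 := hasDerivAt_integral_mul_pow_inner_mul_exp hF' hC' e 2 0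
  have hs : ∀ s : ℝ, ∫ z, F (z + t • e) * (((inner ℝ e z - s * b) ^ 2 - b)
        * Real.exp (s * inner ℝ e z)) ∂(stdGaussian E)
      = (∫ z, F (z + t • e) * (inner ℝ e z ^ 2 * Real.exp (s * inner ℝ e z)) ∂(stdGaussian E))
        - s * (2 * b) * (∫ z, F (z + t • e) * (inner ℝ e z ^ 1 * Real.exp (s * inner ℝ e z))
          ∂(stdGaussian E))
        + (s * (s * b ^ 2) - b) * (∫ z, F (z + t • e)
          * (inner ℝ e z ^ 0 * Real.exp (s * inner ℝ e z)) ∂(stdGaussian E)) := by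
    intro s
    have j2 := integrable_mul_pow_inner_mul_exp hF' hC' e 2 s
    have j1 := (integrable_mul_pow_inner_mul_exp hF' hC' e 1 s).const_mul (s * (2 * b))
    have j0 := (integrable_mul_pow_inner_mul_exp hF' hC' e 0 s).const_mul (s * (s * b ^ 2) - b)
    have hadd := integral_add (j2.sub j1) j0
    simp only [Pi.sub_apply] at hadd
    rw [← integral_const_mul, ← integral_const_mul, ← integral_sub j2 j1, ← hadd]
    congr 1
    ext z
    ring
  simp_rw [hs]
  have hid := hasDerivAt_id (0 : ℝ)
  refine ((hasDerivAt_exp_neg_sq b).mul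
    ((h2.sub ((hid.mul_const (2 * b)).mul h1)).add
      (((hid.mul (hid.mul_const (b ^ 2))).sub_const b).mul h0))).congr_deriv ?_
  have i3 := integrable_mul_pow_inner hF' hC' e 3
  have i1 := integrable_mul_pow_inner hF' hC' e 1
  simp only [pow_one] at i1
  have hl : ∀ z : E, F (z + t • e) * (inner ℝ e z ^ 3 - 3 * b * inner ℝ e z)
      = F (z + t • e) * inner ℝ e z ^ 3 - 3 * b * (F (z + t • e) * inner ℝ e z) := by
    intro z; ring
  simp_rw [hl]
  rw [integral_sub i3 (i1.const_mul _), integral_const_mul]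
  simp
  ring

lemma integral_inner_sq (e : E) : ∫ z : E, inner ℝ e z ^ 2 ∂(stdGaussian E) = ‖e‖ ^ 2 := by
  have h := hasDerivAt_shift_one (F := fun _ => 1) measurable_const (C := 1) (by simp) e 0
  have h1 : ∫ z : E, inner ℝ e z ∂(stdGaussian E) = 0 :=
    integral_strongDual_stdGaussian (innerSL ℝ e)
  simp only [one_mul, h1] at h
  have h2 := h.unique (hasDerivAt_const _ _)
  rw [integral_sub (integrable_pow_inner e 2) (integrable_const _)] at h2
  simp at h2
  linarith

lemma integral_inner_pow_four (e : E) :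
    ∫ z : E, inner ℝ e z ^ 4 ∂(stdGaussian E) = 3 * (‖e‖ ^ 2) ^ 2 := by
  set b := ‖e‖ ^ 2 with hb
  have H := fun n t => hasDerivAt_integral_mul_pow_inner_mul_exp (F := fun _ => 1)
    measurable_const (C := 1) (by simp) e n t
  simp only [one_mul] at H
  have hE : ∀ t : ℝ, HasDerivAt (fun t => Real.exp (b * t ^ 2 / 2))
      (Real.exp (b * t ^ 2 / 2) * (b * t)) t := by
    intro t
    have h1 := ((((hasDerivAt_id t).pow 2).const_mul b).div_const 2).exp
    exact h1.congr_deriv (by simp; ring)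
  have step : ∀ (n : ℕ) (p p' : ℝ → ℝ), (∀ t, HasDerivAt p (p' t) t) →
      (∀ t, ∫ z : E, inner ℝ e z ^ n * Real.exp (t * inner ℝ e z) ∂(stdGaussian E)
        = p t * Real.exp (b * t ^ 2 / 2)) →
      ∀ t, ∫ z : E, inner ℝ e z ^ (n + 1) * Real.exp (t * inner ℝ e z) ∂(stdGaussian E)
        = (p' t + p t * (b * t)) * Real.exp (b * t ^ 2 / 2) := by
    intro n p p' hp hn t
    have h1 := H n t
    simp_rw [hn] at h1
    rw [h1.unique ((hp t).mul (hE t))]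
    ring
  have e0 : ∀ t, ∫ z : E, inner ℝ e z ^ 0 * Real.exp (t * inner ℝ e z) ∂(stdGaussian E)
        = 1 * Real.exp (b * t ^ 2 / 2) := by
    intro t
    simpa using integral_exp_inner_stdGaussian e t
  have e1 := step 0 _ _ (fun t => hasDerivAt_const t (1 : ℝ)) e0
  simp only [zero_add, one_mul] at e1
  have hid : ∀ t : ℝ, HasDerivAt (fun t => b * t) b t := fun t => by
    simpa using (hasDerivAt_id t).const_mul b
  have e2 := step 1 _ _ hid e1
  have e3 := step 2 _ _ (fun t => ((hid t).mul (hid t)).const_add b) e2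
  have e4 := step 3 (fun t => 3 * b * (b * t) + b * t * (b * t) * (b * t))
    (fun t => 3 * b * b + ((b * (b * t) + b * t * b) * (b * t) + b * t * (b * t) * b))
    (fun t => ((hid t).const_mul (3 * b)).add (((hid t).mul (hid t)).mul (hid t)))
    (fun t => by rw [e3 t, Pi.mul_apply]; ring) 0
  simp at e4
  rw [e4]
  ring

lemma integral_abs_inner_le (e : E) : ∫ z : E, |inner ℝ e z| ∂(stdGaussian E) ≤ ‖e‖ := by
  have h1 : (∫ z : E, |inner ℝ e z| ∂(stdGaussian E)) ^ 2
      ≤ ∫ z : E, |inner ℝ e z| ^ 2 ∂(stdGaussian E) := by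
    refine ConvexOn.map_integral_le (g := fun x : ℝ => x ^ 2) (even_two.convexOn_pow)
      (by fun_prop) isClosed_univ (by simp) ?_ ?_
    · simpa using (integrable_pow_inner e 1).abs
    · simpa [Function.comp_def] using integrable_pow_inner e 2
  simp only [sq_abs] at h1
  rw [integral_inner_sq] at h1
  exact (abs_le_of_sq_le_sq' h1 (norm_nonneg _)).2

lemma abs_integral_mul_hermite_two_le {F : E → ℝ} {C : ℝ}
    (hC : ∀ z, |F z| ≤ C) (e : E) :
    |∫ z, F z * (inner ℝ e z ^ 2 - ‖e‖ ^ 2) ∂(stdGaussian E)| ≤ 2 * C * ‖e‖ ^ 2 := by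
  have i2 := integrable_pow_inner e 2
  have h : ∫ z : E, C * (inner ℝ e z ^ 2 + ‖e‖ ^ 2) ∂(stdGaussian E) = 2 * C * ‖e‖ ^ 2 := by
    rw [integral_const_mul, integral_add i2 (integrable_const _), integral_inner_sq]
    simp
    ring
  rw [← h, ← Real.norm_eq_abs]
  refine norm_integral_le_of_norm_le ((i2.add (integrable_const _)).const_mul C)
    (ae_of_all _ fun z => ?_)
  rw [Real.norm_eq_abs, abs_mul]
  have h2 : |inner ℝ e z ^ 2 - ‖e‖ ^ 2| ≤ inner ℝ e z ^ 2 + ‖e‖ ^ 2 := by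
    rw [abs_le]
    constructor <;> nlinarith [sq_nonneg (inner ℝ e z), sq_nonneg ‖e‖]
  exact mul_le_mul (hC z) h2 (abs_nonneg _) ((abs_nonneg _).trans (hC z))

/-- The absolute third moment is bounded through `|x| ^ 3 ≤ (‖e‖ x ^ 2 + ‖e‖⁻¹ x ^ 4) / 2`. -/
lemma abs_integral_mul_hermite_three_le {F : E → ℝ} {C : ℝ}
    (hC : ∀ z, |F z| ≤ C) (e : E) :
    |∫ z, F z * (inner ℝ e z ^ 3 - 3 * ‖e‖ ^ 2 * inner ℝ e z) ∂(stdGaussian E)|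
      ≤ 5 * C * ‖e‖ ^ 3 := by
  have hC0 : 0 ≤ C := (abs_nonneg _).trans (hC 0)
  rcases eq_or_ne e 0 with rfl | he
  · simp
  have hpos : 0 < ‖e‖ := norm_pos_iff.2 he
  have i2 := integrable_pow_inner e 2
  have i4 := integrable_pow_inner e 4
  have i1 : Integrable (fun z : E => |inner ℝ e z|) (stdGaussian E) := by
    simpa using (integrable_pow_inner e 1).abs
  have j : Integrable (fun z : E => C * ((‖e‖ * inner ℝ e z ^ 2 + ‖e‖⁻¹ * inner ℝ e z ^ 4) / 2
      + 3 * ‖e‖ ^ 2 * |inner ℝ e z|)) (stdGaussian E) :=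
    ((((i2.const_mul _).add (i4.const_mul _)).div_const 2).add (i1.const_mul _)).const_mul C
  have h : ∫ z : E, C * ((‖e‖ * inner ℝ e z ^ 2 + ‖e‖⁻¹ * inner ℝ e z ^ 4) / 2
      + 3 * ‖e‖ ^ 2 * |inner ℝ e z|) ∂(stdGaussian E) ≤ 5 * C * ‖e‖ ^ 3 := by
    have j24 : Integrable (fun z : E => (‖e‖ * inner ℝ e z ^ 2 + ‖e‖⁻¹ * inner ℝ e z ^ 4) / 2)
        (stdGaussian E) := ((i2.const_mul _).add (i4.const_mul _)).div_const 2
    rw [integral_const_mul, integral_add j24 (i1.const_mul _), integral_div, integral_add (i2.const_mul _) (i4.const_mul _),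
      integral_const_mul, integral_const_mul, integral_const_mul, integral_inner_sq,
      integral_inner_pow_four]
    have h1 : ‖e‖⁻¹ * (3 * (‖e‖ ^ 2) ^ 2) = 3 * ‖e‖ ^ 3 := by field_simp
    rw [h1]
    have h2 := mul_le_mul_of_nonneg_left (integral_abs_inner_le e)
      (show 0 ≤ 3 * ‖e‖ ^ 2 by positivity)
    nlinarith [mul_le_mul_of_nonneg_left h2 hC0]
  refine le_trans ?_ h
  rw [← Real.norm_eq_abs]
  refine norm_integral_le_of_norm_le j (ae_of_all _ fun z => ?_)
  rw [Real.norm_eq_abs, abs_mul]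
  set x := inner ℝ e z
  have h3 : |x| ^ 3 ≤ (‖e‖ * x ^ 2 + ‖e‖⁻¹ * x ^ 4) / 2 := by
    have h4 : 0 ≤ ‖e‖⁻¹ * |x| ^ 2 * (‖e‖ - |x|) ^ 2 := by positivity
    have h5 : ‖e‖⁻¹ * |x| ^ 2 * (‖e‖ - |x|) ^ 2
        = ‖e‖ * x ^ 2 + ‖e‖⁻¹ * x ^ 4 - 2 * |x| ^ 3 := by
      rw [← sq_abs x, show x ^ 4 = |x| ^ 4 by rw [← abs_pow]; exact (abs_of_nonneg (by positivity)).symm]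
      field_simp
      ring
    linarith
  have h2 : |x ^ 3 - 3 * ‖e‖ ^ 2 * x| ≤ (‖e‖ * x ^ 2 + ‖e‖⁻¹ * x ^ 4) / 2 + 3 * ‖e‖ ^ 2 * |x| := by
    refine (abs_sub _ _).trans ?_
    rw [abs_pow, abs_mul, abs_of_nonneg (show 0 ≤ 3 * ‖e‖ ^ 2 by positivity)]
    linarith
  exact mul_le_mul (hC z) h2 (abs_nonneg _) hC0

/-- Error of the trapezoidal rule under a bound on the second derivative of the primitive `q`. -/
lemma abs_trapezoid_le_of_second {q q1 q2 : ℝ → ℝ} {M : ℝ}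
    (h0 : ∀ t, HasDerivAt q (q1 t) t) (h1 : ∀ t, HasDerivAt q1 (q2 t) t)
    (hM : ∀ t, |q2 t| ≤ M) : |q 1 - q 0 - (q1 0 + q1 1) / 2| ≤ M / 2 := by
  have hr : ∀ t, HasDerivAt (fun t => q t - q 0 - t * (q1 0 + q1 t) / 2)
      ((q1 t - q1 0) / 2 - t * q2 t / 2) t := by
    intro t
    refine (((h0 t).sub_const _).sub
      (((hasDerivAt_id t).mul ((h1 t).const_add (q1 0))).div_const 2)).congr_deriv ?_
    simp
    ring
  have hq1 : ∀ t, 0 ≤ t → |q1 t - q1 0| ≤ M * t := by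
    intro t ht
    have := Convex.norm_image_sub_le_of_norm_hasDerivWithin_le (f := q1) (f' := q2) (C := M)
      (s := Set.univ) (x := 0) (y := t) (fun x _ => (h1 x).hasDerivWithinAt) (fun x _ => hM x)
      convex_univ (Set.mem_univ _) (Set.mem_univ _)
    simpa [Real.norm_eq_abs, abs_of_nonneg ht] using this
  have key := image_norm_le_of_norm_deriv_right_le_deriv_boundary (a := 0) (b := 1)
    (f := fun t => q t - q 0 - t * (q1 0 + q1 t) / 2)
    (f' := fun t => (q1 t - q1 0) / 2 - t * q2 t / 2) (B := fun t => M * t ^ 2 / 2)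
    (B' := fun t => M * t)
    (fun t _ => (hr t).continuousAt.continuousWithinAt) (fun t _ => (hr t).hasDerivWithinAt)
    (by simp) (fun t => ?_) (fun t ht => ?_) (x := 1) (by simp)
  · simpa using key
  · exact ((((hasDerivAt_id t).pow 2).const_mul M).div_const 2).congr_deriv (by simp; ring)
  · rw [Real.norm_eq_abs]
    refine (abs_sub _ _).trans ?_
    rw [abs_div, abs_div, abs_mul, abs_of_nonneg ht.1, abs_two]
    have h2 := hq1 t ht.1
    have h3 := mul_le_mul_of_nonneg_left (hM t) ht.1
    linarith

/-- Error of the trapezoidal rule under a bound on the third derivative of the primitive `q`. -/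
lemma abs_trapezoid_le_of_third {q q1 q2 q3 : ℝ → ℝ} {M : ℝ}
    (h0 : ∀ t, HasDerivAt q (q1 t) t) (h1 : ∀ t, HasDerivAt q1 (q2 t) t)
    (h2 : ∀ t, HasDerivAt q2 (q3 t) t)
    (hM : ∀ t, |q3 t| ≤ M) : |q 1 - q 0 - (q1 0 + q1 1) / 2| ≤ M / 6 := by
  have hr : ∀ t, HasDerivAt (fun t => q t - q 0 - t * (q1 0 + q1 t) / 2)
      ((q1 t - q1 0) / 2 - t * q2 t / 2) t := by
    intro t
    refine (((h0 t).sub_const _).sub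
      (((hasDerivAt_id t).mul ((h1 t).const_add (q1 0))).div_const 2)).congr_deriv ?_
    simp
    ring
  have hr1 : ∀ t, HasDerivAt (fun t => (q1 t - q1 0) / 2 - t * q2 t / 2) (-(t * q3 t / 2)) t := by
    intro t
    refine ((((h1 t).sub_const _).div_const 2).sub
      (((hasDerivAt_id t).mul (h2 t)).div_const 2)).congr_deriv ?_
    simp
    ring
  have hb : ∀ t, 0 ≤ t → |(q1 t - q1 0) / 2 - t * q2 t / 2| ≤ M * t ^ 2 / 2 := by
    intro t ht
    have := Convex.norm_image_sub_le_of_norm_hasDerivWithin_le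
      (f := fun t => (q1 t - q1 0) / 2 - t * q2 t / 2) (f' := fun t => -(t * q3 t / 2))
      (C := M * t / 2) (s := Set.Icc 0 t) (x := 0) (y := t)
      (fun x _ => (hr1 x).hasDerivWithinAt) (fun x hx => ?_)
      (convex_Icc _ _) (by simp [ht]) (by simp [ht])
    · simp only [sub_self, zero_div, zero_mul, sub_zero, Real.norm_eq_abs, abs_of_nonneg ht] at this
      linarith
    · rw [norm_neg, Real.norm_eq_abs, abs_div, abs_mul, abs_of_nonneg hx.1, abs_two]
      have h3 := mul_le_mul hx.2 (hM x) (abs_nonneg _) ht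
      linarith
  have key := image_norm_le_of_norm_deriv_right_le_deriv_boundary (a := 0) (b := 1)
    (f := fun t => q t - q 0 - t * (q1 0 + q1 t) / 2)
    (f' := fun t => (q1 t - q1 0) / 2 - t * q2 t / 2) (B := fun t => M * t ^ 3 / 6)
    (B' := fun t => M * t ^ 2 / 2)
    (fun t _ => (hr t).continuousAt.continuousWithinAt) (fun t _ => (hr t).hasDerivWithinAt)
    (by simp) (fun t => ?_) (fun t ht => hb t ht.1) (x := 1) (by simp)
  · simpa using key
  · exact ((((hasDerivAt_id t).pow 3).const_mul M).div_const 6).congr_deriv (by simp; ring)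

/-- The trapezoidal rule along the segment from `0` to `e`, for the function `t ↦ E F(Z + t e)`
and its derivative `E[F(Z + t e) ⟪e, Z⟫]`. No regularity of `F` is needed. -/
lemma gaussian_trapezoid_sq {F : E → ℝ} (hF : Measurable F) {C : ℝ} (hC : ∀ z, |F z| ≤ C)
    (e : E) :
    |∫ z, F (z + e) ∂(stdGaussian E) - ∫ z, F z ∂(stdGaussian E)
      - (∫ z, F z * inner ℝ e z ∂(stdGaussian E)
        + ∫ z, F (z + e) * inner ℝ e z ∂(stdGaussian E)) / 2| ≤ C * ‖e‖ ^ 2 := by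
  have h := abs_trapezoid_le_of_second (hasDerivAt_shift_zero hF hC e)
    (hasDerivAt_shift_one hF hC e)
    (fun t => abs_integral_mul_hermite_two_le (fun z => hC (z + t • e)) e)
  simp only [one_smul, zero_smul, add_zero] at h
  linarith

/-- The trapezoidal rule is exact to one order more than `gaussian_trapezoid_sq` states. -/
lemma gaussian_trapezoid_cube {F : E → ℝ} (hF : Measurable F) {C : ℝ} (hC : ∀ z, |F z| ≤ C)
    (e : E) :
    |∫ z, F (z + e) ∂(stdGaussian E) - ∫ z, F z ∂(stdGaussian E)
      - (∫ z, F z * inner ℝ e z ∂(stdGaussian E)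
        + ∫ z, F (z + e) * inner ℝ e z ∂(stdGaussian E)) / 2| ≤ C * ‖e‖ ^ 3 := by
  have h := abs_trapezoid_le_of_third (hasDerivAt_shift_zero hF hC e)
    (hasDerivAt_shift_one hF hC e) (hasDerivAt_shift_two hF hC e)
    (fun t => abs_integral_mul_hermite_three_le (fun z => hC (z + t • e)) e)
  simp only [one_smul, zero_smul, add_zero] at h
  have hC0 : 0 ≤ C := (abs_nonneg _).trans (hC 0)
  have : 0 ≤ C * ‖e‖ ^ 3 := by positivity
  linarith

end GaussianTrapezoid

/-! ### Matrices acting on Euclidean space -/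

section MatrixFacts

variable {d : ℕ}

local notation "E" => EuclideanSpace ℝ (Fin d)

lemma mulV_apply (M : Matrix (Fin d) (Fin d) ℝ) (v : E) (i : Fin d) :
    mulV M v i = ∑ j, M i j * v j := by
  simp [mulV, Matrix.ofLp_toEuclideanCLM, Matrix.mulVec, dotProduct]

@[fun_prop]
lemma continuous_mulV (M : Matrix (Fin d) (Fin d) ℝ) : Continuous (fun v : E => mulV M v) :=
  (Matrix.toEuclideanCLM (n := Fin d) (𝕜 := ℝ) M).continuous

@[fun_prop]
lemma measurable_mulV (M : Matrix (Fin d) (Fin d) ℝ) : Measurable (fun v : E => mulV M v) :=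
  (continuous_mulV M).measurable

lemma norm_mulV_le (M : Matrix (Fin d) (Fin d) ℝ) (v : E) : ‖mulV M v‖ ≤ opNorm M * ‖v‖ :=
  (Matrix.toEuclideanCLM (n := Fin d) (𝕜 := ℝ) M).le_opNorm v

lemma opNorm_nonneg (M : Matrix (Fin d) (Fin d) ℝ) : 0 ≤ opNorm M := norm_nonneg _

lemma mulV_mul (M N : Matrix (Fin d) (Fin d) ℝ) (v : E) : mulV (M * N) v = mulV M (mulV N v) := by
  simp [mulV]

lemma mulV_one (v : E) : mulV (1 : Matrix (Fin d) (Fin d) ℝ) v = v := by simp [mulV]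

lemma mulV_smul_matrix (c : ℝ) (M : Matrix (Fin d) (Fin d) ℝ) (v : E) :
    mulV (c • M) v = c • mulV M v := by simp [mulV]

lemma mulV_smul (c : ℝ) (M : Matrix (Fin d) (Fin d) ℝ) (v : E) :
    mulV M (c • v) = c • mulV M v := by simp [mulV]

lemma mulV_add (M : Matrix (Fin d) (Fin d) ℝ) (v w : E) :
    mulV M (v + w) = mulV M v + mulV M w := by simp [mulV]

lemma mulV_neg (M : Matrix (Fin d) (Fin d) ℝ) (v : E) :
    mulV M (-v) = -mulV M v := by simp [mulV]

lemma inner_eq_sum (v w : E) : inner ℝ v w = ∑ i, v i * w i := by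
  simp only [PiLp.inner_apply, RCLike.inner_apply, conj_trivial]
  exact Finset.sum_congr rfl fun i _ => mul_comm _ _

lemma inner_mulV_left (M : Matrix (Fin d) (Fin d) ℝ) (v w : E) :
    inner ℝ (mulV M v) w = inner ℝ v (mulV M.transpose w) := by
  simp only [inner_eq_sum, mulV_apply, Finset.sum_mul, Finset.mul_sum, Matrix.transpose_apply]
  rw [Finset.sum_comm]
  exact Finset.sum_congr rfl fun i _ => Finset.sum_congr rfl fun j _ => by ring

lemma inner_mulV_right (M : Matrix (Fin d) (Fin d) ℝ) (v w : E) :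
    inner ℝ v (mulV M w) = inner ℝ (mulV M.transpose v) w := by
  rw [inner_mulV_left, Matrix.transpose_transpose]

lemma hsNorm_nonneg (M : Matrix (Fin d) (Fin d) ℝ) : 0 ≤ hsNorm M := Real.sqrt_nonneg _

lemma trace_transpose_mul (M N : Matrix (Fin d) (Fin d) ℝ) :
    (M.transpose * N).trace = ∑ i, ∑ j, M i j * N i j := by
  simp only [Matrix.trace, Matrix.diag, Matrix.mul_apply, Matrix.transpose_apply]
  exact Finset.sum_comm

lemma inner_mulV_eq_trace (M : Matrix (Fin d) (Fin d) ℝ) (a v : E) :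
    inner ℝ a (mulV M v) = (M.transpose * Matrix.vecMulVec a v).trace := by
  rw [trace_transpose_mul, inner_eq_sum]
  refine Finset.sum_congr rfl fun i _ => ?_
  rw [mulV_apply, Finset.mul_sum]
  exact Finset.sum_congr rfl fun j _ => by rw [Matrix.vecMulVec_apply]; ring

lemma hsNorm_sq (M : Matrix (Fin d) (Fin d) ℝ) : hsNorm M ^ 2 = ∑ i, ∑ j, M i j ^ 2 := by
  rw [hsNorm, trace_transpose_mul, Real.sq_sqrt]
  · simp_rw [sq]
  · exact Finset.sum_nonneg fun i _ => Finset.sum_nonneg fun j _ => mul_self_nonneg _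

/-- The `i`-th row of a matrix as a vector of Euclidean space. -/
def rowV (M : Matrix (Fin d) (Fin d) ℝ) (i : Fin d) : E := WithLp.toLp 2 (M i)

lemma rowV_apply (M : Matrix (Fin d) (Fin d) ℝ) (i j : Fin d) : rowV M i j = M i j := rfl

lemma mulV_apply_eq_inner (M : Matrix (Fin d) (Fin d) ℝ) (v : E) (i : Fin d) :
    mulV M v i = inner ℝ (rowV M i) v := by
  rw [mulV_apply, inner_eq_sum]
  rfl

lemma hsNorm_sq_eq_rows (M : Matrix (Fin d) (Fin d) ℝ) : hsNorm M ^ 2 = ∑ i, ‖rowV M i‖ ^ 2 := by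
  rw [hsNorm_sq]
  exact Finset.sum_congr rfl fun i _ => by simp [EuclideanSpace.norm_sq_eq, rowV_apply]

/-- The rows of `M * B` are the images under `B` of the rows of `M`. -/
lemma hsNorm_mul_le (M B : Matrix (Fin d) (Fin d) ℝ) (hB : B.transpose = B) :
    hsNorm (M * B) ≤ hsNorm M * opNorm B := by
  refine abs_le_of_sq_le_sq' ?_ (mul_nonneg (hsNorm_nonneg _) (opNorm_nonneg _)) |>.2
  rw [mul_pow, hsNorm_sq_eq_rows, hsNorm_sq_eq_rows, Finset.sum_mul]
  refine Finset.sum_le_sum fun i _ => ?_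
  have h : rowV (M * B) i = mulV B (rowV M i) := by
    ext j
    rw [mulV_apply, rowV_apply, Matrix.mul_apply]
    refine Finset.sum_congr rfl fun l _ => ?_
    have : B l j = B j l := by rw [← Matrix.transpose_apply B l j, hB]
    rw [this, rowV_apply, mul_comm]
  rw [h, mul_comm, ← mul_pow]
  exact pow_le_pow_left₀ (norm_nonneg _) (norm_mulV_le _ _) 2

lemma integrable_norm_mulV_sq (C : Matrix (Fin d) (Fin d) ℝ) :
    Integrable (fun z : E => ‖mulV C z‖ ^ 2) (stdGaussian E) := by
  simp_rw [EuclideanSpace.norm_sq_eq, Real.norm_eq_abs, sq_abs, mulV_apply_eq_inner]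
  exact integrable_finsetSum _ fun i _ => integrable_pow_inner _ 2

lemma integrable_norm_mulV (C : Matrix (Fin d) (Fin d) ℝ) :
    Integrable (fun z : E => ‖mulV C z‖) (stdGaussian E) := by
  refine ((integrable_const (1 : ℝ)).add (integrable_norm_mulV_sq C)).mono' (by fun_prop)
    (ae_of_all _ fun z => ?_)
  rw [norm_norm, Pi.add_apply]
  nlinarith [sq_nonneg (‖mulV C z‖ - 1), norm_nonneg (mulV C z)]

lemma integral_norm_mulV_sq (C : Matrix (Fin d) (Fin d) ℝ) :
    ∫ z : E, ‖mulV C z‖ ^ 2 ∂(stdGaussian E) = hsNorm C ^ 2 := by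
  simp_rw [EuclideanSpace.norm_sq_eq, Real.norm_eq_abs, sq_abs, mulV_apply_eq_inner]
  rw [integral_finsetSum _ fun i _ => integrable_pow_inner _ 2, hsNorm_sq_eq_rows]
  exact Finset.sum_congr rfl fun i _ => integral_inner_sq _

lemma sq_integral_le {Ω : Type*} [MeasurableSpace Ω] {P : Measure Ω} [IsProbabilityMeasure P]
    {X : Ω → ℝ} (h1 : Integrable X P) (h2 : Integrable (fun ω => X ω ^ 2) P) :
    (∫ ω, X ω ∂P) ^ 2 ≤ ∫ ω, X ω ^ 2 ∂P :=
  ConvexOn.map_integral_le (g := fun x : ℝ => x ^ 2) (even_two.convexOn_pow)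
      (by fun_prop) isClosed_univ (by simp) h1 h2

lemma integral_norm_mulV_le (C : Matrix (Fin d) (Fin d) ℝ) :
    ∫ z : E, ‖mulV C z‖ ∂(stdGaussian E) ≤ hsNorm C := by
  have h := sq_integral_le (integrable_norm_mulV C) (integrable_norm_mulV_sq C)
  rw [integral_norm_mulV_sq] at h
  exact (abs_le_of_sq_le_sq' h (hsNorm_nonneg _)).2

end MatrixFacts

/-! ### The smoothed gradient and its derivative -/

section SmoothedGradient

variable {d : ℕ}

local notation "E" => EuclideanSpace ℝ (Fin d)

/-- `E G(sin θ w + cos θ A Z)`, for a standard Gaussian vector `Z`. When `G` is the gradient of `h`,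
this is, up to the factor `sin θ`, the gradient at `w` of `E h(sin θ w + cos θ A Z)`. -/
def smoothGrad (G : E → E) (A : Matrix (Fin d) (Fin d) ℝ) (θ : ℝ) (w : E) : E :=
  ∫ z, G (Real.sin θ • w + Real.cos θ • mulV A z) ∂(stdGaussian E)

/-- The derivative of `smoothGrad G A θ` with respect to `w`, in the form that Gaussian integration
by parts gives it; `B` stands for the inverse of the symmetric matrix `A`. It does not
involve the derivative of `G`. -/
def smoothHess (G : E → E) (A B : Matrix (Fin d) (Fin d) ℝ) (θ : ℝ) (w : E) :
    Matrix (Fin d) (Fin d) ℝ :=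
  Matrix.of fun i j => Real.tan θ *
    ∫ z, G (Real.sin θ • w + Real.cos θ • mulV A z) i * mulV B z j ∂(stdGaussian E)

lemma integrable_of_bounded_by_one {G : E → E} (A : Matrix (Fin d) (Fin d) ℝ) (θ : ℝ)
    (hG : Continuous G) (hG1 : ∀ x, ‖G x‖ ≤ 1) (w : E) :
    Integrable (fun z => G (Real.sin θ • w + Real.cos θ • mulV A z)) (stdGaussian E) :=
  (integrable_const (1 : ℝ)).mono' (by fun_prop) (ae_of_all _ fun _ => hG1 _)

lemma norm_smoothGrad_le {G : E → E} (A : Matrix (Fin d) (Fin d) ℝ) (θ : ℝ)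
    (hG1 : ∀ x, ‖G x‖ ≤ 1) (w : E) : ‖smoothGrad G A θ w‖ ≤ 1 := by
  have h := norm_integral_le_of_norm_le_const (μ := stdGaussian E) (ae_of_all _ fun z =>
    hG1 (Real.sin θ • w + Real.cos θ • mulV A z))
  rwa [probReal_univ, mul_one] at h

lemma measurable_smoothGrad {G : E → E} (A : Matrix (Fin d) (Fin d) ℝ) (θ : ℝ)
    (hG : Continuous G) : Measurable (smoothGrad G A θ) := by
  have h : StronglyMeasurable (Function.uncurry fun (w z : E) =>
      G (Real.sin θ • w + Real.cos θ • mulV A z)) := by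
    apply Continuous.stronglyMeasurable
    unfold Function.uncurry
    fun_prop
  exact h.integral_prod_right.measurable

lemma measurable_smoothHess {G : E → E} (A B : Matrix (Fin d) (Fin d) ℝ) (θ : ℝ)
    (hG : Continuous G) (i j : Fin d) :
    Measurable (fun w => smoothHess G A B θ w i j) := by
  have h : StronglyMeasurable (Function.uncurry fun (w z : E) =>
      G (Real.sin θ • w + Real.cos θ • mulV A z) i * mulV B z j) := by
    apply Continuous.stronglyMeasurable
    unfold Function.uncurry
    fun_prop
  exact h.integral_prod_right.measurable.const_mul _

lemma integrable_coord_mul {G : E → E} (A B : Matrix (Fin d) (Fin d) ℝ) (θ : ℝ)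
    (hG : Continuous G) (hG1 : ∀ x, ‖G x‖ ≤ 1) (w : E) (i j : Fin d) :
    Integrable (fun z => G (Real.sin θ • w + Real.cos θ • mulV A z) i * mulV B z j)
      (stdGaussian E) := by
  refine (integrable_norm_mulV B).mono' (by fun_prop) (ae_of_all _ fun z => ?_)
  rw [norm_mul]
  have h1 : ‖G (Real.sin θ • w + Real.cos θ • mulV A z) i‖ ≤ 1 :=
    (PiLp.norm_apply_le _ i).trans (hG1 _)
  have h2 : ‖mulV B z j‖ ≤ ‖mulV B z‖ := PiLp.norm_apply_le _ j
  nlinarith [norm_nonneg (mulV B z j)]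

/-- The pairing of `smoothHess` with a matrix as a single Gaussian average. -/
lemma trace_smoothHess {G : E → E} (A B : Matrix (Fin d) (Fin d) ℝ) (θ : ℝ)
    (hG : Continuous G) (hG1 : ∀ x, ‖G x‖ ≤ 1) (w : E)
    (M : Matrix (Fin d) (Fin d) ℝ) :
    ((smoothHess G A B θ w).transpose * M).trace = Real.tan θ *
      ∫ z, inner ℝ (G (Real.sin θ • w + Real.cos θ • mulV A z)) (mulV (M * B) z)
        ∂(stdGaussian E) := by
  have hint := fun i j => integrable_coord_mul A B θ hG hG1 w i j
  rw [trace_transpose_mul]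
  have h1 : ∀ z : E, inner ℝ (G (Real.sin θ • w + Real.cos θ • mulV A z)) (mulV (M * B) z)
      = ∑ i, ∑ j, M i j * (G (Real.sin θ • w + Real.cos θ • mulV A z) i * mulV B z j) := by
    intro z
    rw [mulV_mul, inner_eq_sum]
    refine Finset.sum_congr rfl fun i _ => ?_
    rw [mulV_apply, Finset.mul_sum]
    exact Finset.sum_congr rfl fun j _ => by ring
  have h2 : ∫ z, inner ℝ (G (Real.sin θ • w + Real.cos θ • mulV A z)) (mulV (M * B) z)
        ∂(stdGaussian E)
      = ∑ i, ∑ j, M i j * ∫ z, G (Real.sin θ • w + Real.cos θ • mulV A z) i * mulV B z j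
        ∂(stdGaussian E) := by
    simp_rw [h1]
    refine (integral_finsetSum _ fun i _ => integrable_finsetSum _ fun j _ =>
      (hint i j).const_mul (M i j)).trans (Finset.sum_congr rfl fun i _ => ?_)
    rw [integral_finsetSum _ fun j _ => (hint i j).const_mul (M i j)]
    exact Finset.sum_congr rfl fun j _ => integral_const_mul _ _
  rw [h2, Finset.mul_sum]
  refine Finset.sum_congr rfl fun i _ => ?_
  rw [Finset.mul_sum]
  refine Finset.sum_congr rfl fun j _ => ?_
  rw [smoothHess, Matrix.of_apply]
  ring

lemma abs_trace_smoothHess_le {G : E → E} (A B : Matrix (Fin d) (Fin d) ℝ) (θ : ℝ)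
    (hG : Continuous G) (hG1 : ∀ x, ‖G x‖ ≤ 1) (hB : B.transpose = B)
    (hθ : 0 ≤ Real.tan θ) (w : E) (M : Matrix (Fin d) (Fin d) ℝ) :
    |((smoothHess G A B θ w).transpose * M).trace| ≤ Real.tan θ * opNorm B * hsNorm M := by
  rw [trace_smoothHess A B θ hG hG1, abs_mul, abs_of_nonneg hθ, mul_assoc]
  refine mul_le_mul_of_nonneg_left ?_ hθ
  rw [mul_comm]
  refine le_trans ?_ ((integral_norm_mulV_le (M * B)).trans (hsNorm_mul_le M B hB))
  rw [← Real.norm_eq_abs]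
  refine norm_integral_le_of_norm_le (integrable_norm_mulV _) (ae_of_all _ fun z => ?_)
  refine (norm_inner_le_norm _ _).trans ?_
  exact mul_le_of_le_one_left (norm_nonneg _) (hG1 _)

/-- The case of a matrix of rank one in `trace_smoothHess`. -/
lemma inner_mulV_smoothHess {G : E → E} (A B : Matrix (Fin d) (Fin d) ℝ) (θ : ℝ)
    (hG : Continuous G) (hG1 : ∀ x, ‖G x‖ ≤ 1) (hB : B.transpose = B)
    (w a v : E) :
    inner ℝ a (mulV (smoothHess G A B θ w) v) = Real.tan θ *
      ∫ z, inner ℝ a (G (Real.sin θ • w + Real.cos θ • mulV A z)) * inner ℝ (mulV B v) z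
        ∂(stdGaussian E) := by
  have h := trace_smoothHess A B θ hG hG1 w (Matrix.vecMulVec a v)
  rw [inner_mulV_eq_trace, h]
  congr 2
  ext z
  have h2 : mulV (Matrix.vecMulVec a v * B) z = inner ℝ (mulV B v) z • a := by
    ext i
    rw [mulV_mul, mulV_apply, inner_mulV_left, hB, inner_eq_sum, PiLp.smul_apply, smul_eq_mul,
      Finset.sum_mul]
    exact Finset.sum_congr rfl fun j _ => by rw [Matrix.vecMulVec_apply]; ring
  rw [h2, real_inner_smul_right, real_inner_comm a, mul_comm]

/-- Moving from `w` to `w'` amounts to translating the Gaussian variable. -/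
lemma smooth_shift (A B : Matrix (Fin d) (Fin d) ℝ) (θ : ℝ)
    (hAB : A * B = 1) (hc : Real.cos θ ≠ 0) (w w' z : E) :
    Real.sin θ • w + Real.cos θ • mulV A (z + mulV B (Real.tan θ • (w' - w)))
      = Real.sin θ • w' + Real.cos θ • mulV A z := by
  rw [mulV_add, ← mulV_mul, hAB, mulV_one, smul_add, smul_smul, mul_comm (Real.cos θ),
    Real.tan_mul_cos hc, smul_sub]
  abel

lemma inner_smoothGrad {G : E → E} (A : Matrix (Fin d) (Fin d) ℝ) (θ : ℝ)
    (hG : Continuous G) (hG1 : ∀ x, ‖G x‖ ≤ 1) (a w : E) :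
    inner ℝ a (smoothGrad G A θ w)
      = ∫ z, inner ℝ a (G (Real.sin θ • w + Real.cos θ • mulV A z)) ∂(stdGaussian E) :=
  (integral_inner (integrable_of_bounded_by_one A θ hG hG1 w) a).symm

/-- The error of the trapezoidal rule for the increments of the smoothed gradient. -/
def trapezoidError (G : E → E) (A B : Matrix (Fin d) (Fin d) ℝ) (θ : ℝ) (a w w' : E) : ℝ :=
  inner ℝ a (smoothGrad G A θ w' - smoothGrad G A θ w)
    - (inner ℝ a (mulV (smoothHess G A B θ w) (w' - w))
      + inner ℝ a (mulV (smoothHess G A B θ w') (w' - w))) / 2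

/-- By `smooth_shift`, the error is that of the trapezoidal rule for a Gaussian average between `0`
and `e = tan θ • S^{-1/2} (w' - w)`. -/
lemma trapezoidError_eq {G : E → E} (A B : Matrix (Fin d) (Fin d) ℝ) (θ : ℝ)
    (hG : Continuous G) (hG1 : ∀ x, ‖G x‖ ≤ 1) (hB : B.transpose = B)
    (hAB : A * B = 1) (hc : Real.cos θ ≠ 0) (a w w' e : E)
    (he : e = mulV B (Real.tan θ • (w' - w))) (F : E → ℝ)
    (hF : F = fun z => inner ℝ a (G (Real.sin θ • w + Real.cos θ • mulV A z))) :
    trapezoidError G A B θ a w w' = ∫ z, F (z + e) ∂(stdGaussian E) - ∫ z, F z ∂(stdGaussian E)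
      - (∫ z, F z * inner ℝ e z ∂(stdGaussian E)
        + ∫ z, F (z + e) * inner ℝ e z ∂(stdGaussian E)) / 2 := by
  have hFe : ∀ z, F (z + e) = inner ℝ a (G (Real.sin θ • w' + Real.cos θ • mulV A z)) := by
    intro z
    rw [hF, he]
    simp only
    rw [smooth_shift A B θ hAB hc]
  have hez : ∀ z : E, inner ℝ e z = Real.tan θ * inner ℝ (mulV B (w' - w)) z := by
    intro z
    rw [he, mulV_smul, real_inner_smul_left]
  rw [trapezoidError, inner_sub_right, inner_smoothGrad A θ hG hG1, inner_smoothGrad A θ hG hG1,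
    inner_mulV_smoothHess A B θ hG hG1 hB, inner_mulV_smoothHess A B θ hG hG1 hB]
  simp_rw [hFe, hez, hF]
  rw [← integral_const_mul, ← integral_const_mul]
  congr 3
  · congr 1
    ext z
    ring
  · congr 1
    ext z
    ring

lemma abs_trapezoidError_le {G : E → E} (A B : Matrix (Fin d) (Fin d) ℝ) (θ : ℝ)
    (hG : Continuous G) (hG1 : ∀ x, ‖G x‖ ≤ 1) (hB : B.transpose = B)
    (hAB : A * B = 1) (hc : Real.cos θ ≠ 0) (hθ : 0 ≤ Real.tan θ) (a w w' : E) {n : ℕ}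
    (hn : n = 2 ∨ n = 3) :
    |trapezoidError G A B θ a w w'|
      ≤ Real.tan θ ^ n * opNorm B ^ n * (‖a‖ * ‖w' - w‖ ^ n) := by
  rw [trapezoidError_eq A B θ hG hG1 hB hAB hc a w w' _ rfl _ rfl]
  set e := mulV B (Real.tan θ • (w' - w)) with he
  set F : E → ℝ := fun z => inner ℝ a (G (Real.sin θ • w + Real.cos θ • mulV A z)) with hF
  have hFm : Measurable F := by
    apply Continuous.measurable
    fun_prop
  have hFb : ∀ z, |F z| ≤ ‖a‖ := fun z =>
    (abs_real_inner_le_norm _ _).trans (mul_le_of_le_one_right (norm_nonneg _) (hG1 _))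
  have hen : ‖e‖ ^ n ≤ Real.tan θ ^ n * opNorm B ^ n * ‖w' - w‖ ^ n := by
    rw [← mul_pow, ← mul_pow]
    refine pow_le_pow_left₀ (norm_nonneg _) ?_ n
    refine (norm_mulV_le _ _).trans_eq ?_
    rw [norm_smul, Real.norm_of_nonneg hθ]
    ring
  have hmain : ‖a‖ * ‖e‖ ^ n ≤ Real.tan θ ^ n * opNorm B ^ n * (‖a‖ * ‖w' - w‖ ^ n) := by
    nlinarith [mul_le_mul_of_nonneg_left hen (norm_nonneg a)]
  refine le_trans ?_ hmain
  rcases hn with rfl | rfl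
  · exact gaussian_trapezoid_sq hFm hFb e
  · exact gaussian_trapezoid_cube hFm hFb e

end SmoothedGradient

/-! ### Exchangeability and conditional moments -/

section ExchangeablePair

variable {Ω : Type*} [MeasurableSpace Ω] {P : Measure Ω} [IsProbabilityMeasure P] {d : ℕ}
  {W W' : Ω → EuclideanSpace ℝ (Fin d)} {Y Y' : Ω → ℝ} {S Ψ : Matrix (Fin d) (Fin d) ℝ}
  {lam ζ : ℝ} {R0p R0m : Ω → ℝ} {R1p R1m : Ω → EuclideanSpace ℝ (Fin d)}
  {C2p C2m : Ω → Matrix (Fin d) (Fin d) ℝ}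

lemma measurable_jump (hY : Measurable Y) (hY' : Measurable Y') (s : ℝ) :
    MeasurableSet (jump Y Y' s) :=
  (hY'.sub hY) (measurableSet_singleton s)

lemma measurableSet_level (hY : Measurable Y) (y : ℝ) : MeasurableSet (Y ⁻¹' {y}) :=
  hY (measurableSet_singleton y)

lemma sigmaWY_le (hW : Measurable W) (hY : Measurable Y) :
    sigmaWY W Y ≤ ‹MeasurableSpace Ω› :=
  (hW.prodMk hY).comap_le

/-- Pulling a function of `W` out of a conditional expectation given `(W, Y)`, integrated over a
level set of `Y`. -/
lemma setIntegral_bilin_condExp {F H : Type*} [NormedAddCommGroup F] [NormedSpace ℝ F]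
    [MeasurableSpace F] [BorelSpace F] [SecondCountableTopology F]
    [NormedAddCommGroup H] [NormedSpace ℝ H] [CompleteSpace H]
    (B : F →L[ℝ] H →L[ℝ] ℝ) (hW : Measurable W) (hY : Measurable Y)
    {η : EuclideanSpace ℝ (Fin d) → F} (hη : Measurable η) {f : Ω → H} (hf : Integrable f P)
    (hηf : Integrable (fun ω => B (η (W ω)) (f ω)) P) (y : ℝ) :
    ∫ ω in Y ⁻¹' {y}, B (η (W ω)) (f ω) ∂P
      = ∫ ω in Y ⁻¹' {y}, B (η (W ω)) ((P[f | sigmaWY W Y]) ω) ∂P := by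
  have hm := sigmaWY_le hW hY
  have hWm : @Measurable _ _ (sigmaWY W Y) _ W :=
    measurable_fst.comp (comap_measurable (fun ω => (W ω, Y ω)))
  have hYm : @Measurable _ _ (sigmaWY W Y) _ Y :=
    measurable_snd.comp (comap_measurable (fun ω => (W ω, Y ω)))
  have hηm : StronglyMeasurable[sigmaWY W Y] (fun ω => η (W ω)) :=
    (hη.comp hWm).stronglyMeasurable
  have h1 := condExp_bilin_of_stronglyMeasurable_left B hηm hηf hf
  have h2 := setIntegral_condExp hm hηf (hYm (measurableSet_singleton y))
  rw [← h2]
  exact integral_congr_ae (ae_restrict_of_ae h1)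

lemma setIntegral_inner_condM1 (hW : Measurable W) (hY : Measurable Y) (hY' : Measurable Y')
    (hΔ : Integrable (fun ω => W' ω - W ω) P) (hW' : Measurable W')
    {η : EuclideanSpace ℝ (Fin d) → EuclideanSpace ℝ (Fin d)} (hη : Measurable η)
    {C : ℝ} (hC : ∀ w, ‖η w‖ ≤ C) (s y : ℝ) :
    ∫ ω in Y ⁻¹' {y} ∩ jump Y Y' s, inner ℝ (η (W ω)) (W' ω - W ω) ∂P
      = ∫ ω in Y ⁻¹' {y}, inner ℝ (η (W ω)) (condM1 P W W' Y Y' s ω) ∂P := by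
  have hj := measurable_jump hY hY' s
  have hi : Integrable ((jump Y Y' s).indicator (fun ω => W' ω - W ω)) P := hΔ.indicator hj
  have h := setIntegral_bilin_condExp (P := P) (innerSL ℝ) hW hY hη hi (by
    refine (hi.norm.const_mul C).mono' ?_ (ae_of_all _ fun ω => ?_)
    · refine Measurable.aestronglyMeasurable ?_
      have : Measurable ((jump Y Y' s).indicator (fun ω => W' ω - W ω)) :=
        (hW'.sub hW).indicator hj
      exact (hη.comp hW).inner this
    · exact (norm_inner_le_norm _ _).trans
        (mul_le_mul_of_nonneg_right (hC _) (norm_nonneg _))) y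
  refine Eq.trans ?_ h
  rw [← setIntegral_indicator hj]
  refine integral_congr_ae (ae_of_all _ fun ω => ?_)
  by_cases hω : ω ∈ jump Y Y' s
  · simp only [hω, Set.indicator_of_mem]
    rfl
  · simp only [hω, not_false_eq_true, Set.indicator_of_notMem, map_zero]

lemma setIntegral_mul_condM2 (hW : Measurable W) (hY : Measurable Y) (hY' : Measurable Y')
    (i j : Fin d) (hΔ : Integrable (fun ω => (W' ω - W ω) i * (W' ω - W ω) j) P)
    {η : EuclideanSpace ℝ (Fin d) → ℝ} (hη : Measurable η)
    {C : ℝ} (hC : ∀ w, |η w| ≤ C) (s y : ℝ) :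
    ∫ ω in Y ⁻¹' {y} ∩ jump Y Y' s, η (W ω) * ((W' ω - W ω) i * (W' ω - W ω) j) ∂P
      = ∫ ω in Y ⁻¹' {y}, η (W ω) * condM2 P W W' Y Y' s i j ω ∂P := by
  have hj := measurable_jump hY hY' s
  have hi : Integrable ((jump Y Y' s).indicator
    (fun ω => (W' ω - W ω) i * (W' ω - W ω) j)) P := hΔ.indicator hj
  have h := setIntegral_bilin_condExp (P := P) (ContinuousLinearMap.mul ℝ ℝ) hW hY hη hi (by
    exact hi.bdd_mul (c := C) (hη.comp hW).aestronglyMeasurable (ae_of_all _ fun ω => hC _)) y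
  refine Eq.trans ?_ h
  rw [← setIntegral_indicator hj]
  refine integral_congr_ae (ae_of_all _ fun ω => ?_)
  by_cases hω : ω ∈ jump Y Y' s <;> simp [hω]

lemma setIntegral_mul_condM0 (hW : Measurable W) (hY : Measurable Y) (hY' : Measurable Y')
    {η : EuclideanSpace ℝ (Fin d) → ℝ} (hη : Measurable η)
    (hi : Integrable (fun ω => η (W ω)) P) (s y : ℝ) :
    ∫ ω in Y ⁻¹' {y} ∩ jump Y Y' s, η (W ω) ∂P
      = ∫ ω in Y ⁻¹' {y}, η (W ω) * condM0 P W Y Y' s ω ∂P := by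
  have hj := measurable_jump hY hY' s
  have h := setIntegral_bilin_condExp (P := P) (ContinuousLinearMap.mul ℝ ℝ) hW hY hη
    ((integrable_const (1 : ℝ)).indicator hj) (by
      refine (hi.indicator hj).congr (ae_of_all _ fun ω => ?_)
      by_cases hω : ω ∈ jump Y Y' s <;> simp [hω]) y
  refine Eq.trans ?_ h
  rw [← setIntegral_indicator hj]
  refine integral_congr_ae (ae_of_all _ fun ω => ?_)
  by_cases hω : ω ∈ jump Y Y' s <;> simp [hω]

/-- The event that `(Y, Y')` is `(k, k - 1)` or `(k - 1, k)`. -/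
def crossing (Y Y' : Ω → ℝ) (k : ℝ) : Set Ω :=
  Y ⁻¹' {k} ∩ jump Y Y' (-1) ∪ Y ⁻¹' {k - 1} ∩ jump Y Y' 1

lemma crossing_subset_pair (k : ℝ) : crossing Y Y' k ⊆ Y ⁻¹' {k - 1, k} := by
  rintro ω (⟨h, -⟩ | ⟨h, -⟩)
  · exact Or.inr h
  · exact Or.inl h

lemma setIntegral_crossing (hY : Measurable Y) (hY' : Measurable Y') (k : ℝ) {f : Ω → ℝ}
    (hf : Integrable f P) :
    ∫ ω in crossing Y Y' k, f ω ∂P = ∫ ω in Y ⁻¹' {k} ∩ jump Y Y' (-1), f ω ∂P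
      + ∫ ω in Y ⁻¹' {k - 1} ∩ jump Y Y' 1, f ω ∂P := by
  rw [crossing, setIntegral_union _ ((measurableSet_level hY _).inter (measurable_jump hY hY' _))
    hf.integrableOn hf.integrableOn]
  rw [Set.disjoint_left]
  rintro ω ⟨h1, -⟩ ⟨h2, -⟩
  simp only [Set.mem_preimage, Set.mem_singleton_iff] at h1 h2
  linarith

lemma setIntegral_pair (hY : Measurable Y) (k : ℝ) {f : Ω → ℝ} (hf : Integrable f P) :
    ∫ ω in Y ⁻¹' {k - 1, k}, f ω ∂P = ∫ ω in Y ⁻¹' {k}, f ω ∂P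
      + ∫ ω in Y ⁻¹' {k - 1}, f ω ∂P := by
  rw [Set.insert_eq, Set.preimage_union, setIntegral_union _ (measurableSet_level hY _)
    hf.integrableOn hf.integrableOn, add_comm]
  rw [Set.disjoint_left]
  intro ω h1 h2
  simp only [Set.mem_preimage, Set.mem_singleton_iff] at h1 h2
  linarith

lemma integral_swap (hA : CondSteinAssumptions P W W' Y Y' S Ψ lam ζ R0p R0m R1p R1m C2p C2m)
    {F : (EuclideanSpace ℝ (Fin d) × ℝ) × (EuclideanSpace ℝ (Fin d) × ℝ) → ℝ}
    (hF : Measurable F) :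
    ∫ ω, F ((W ω, Y ω), (W' ω, Y' ω)) ∂P = ∫ ω, F ((W' ω, Y' ω), (W ω, Y ω)) ∂P := by
  have hW := hA.measurable_W
  have hW' := hA.measurable_W'
  have hY := hA.measurable_Y
  have hY' := hA.measurable_Y'
  have h1 := integral_map (μ := P) (φ := fun ω => ((W ω, Y ω), (W' ω, Y' ω))) (f := F)
    (by fun_prop) hF.aestronglyMeasurable
  have h2 := integral_map (μ := P) (φ := fun ω => ((W' ω, Y' ω), (W ω, Y ω))) (f := F)
    (by fun_prop) hF.aestronglyMeasurable
  rw [← h1, ← h2, hA.exch]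

/-- Exchangeability on the event `Y = y, Y' = y'`, which the swap carries to `Y = y', Y' = y`. -/
lemma setIntegral_swap (hA : CondSteinAssumptions P W W' Y Y' S Ψ lam ζ R0p R0m R1p R1m C2p C2m)
    {F : EuclideanSpace ℝ (Fin d) → EuclideanSpace ℝ (Fin d) → ℝ}
    (hF : Measurable (Function.uncurry F)) {y y' : ℝ} :
    ∫ ω in Y ⁻¹' {y} ∩ jump Y Y' (y' - y), F (W ω) (W' ω) ∂P
      = ∫ ω in Y ⁻¹' {y'} ∩ jump Y Y' (y - y'), F (W' ω) (W ω) ∂P := by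
  have hY := hA.measurable_Y
  have hY' := hA.measurable_Y'
  obtain ⟨D, hD, hmem⟩ :
      ∃ D : Set ((EuclideanSpace ℝ (Fin d) × ℝ) × (EuclideanSpace ℝ (Fin d) × ℝ)),
        MeasurableSet D ∧ ∀ p, p ∈ D ↔ p.1.2 = y ∧ p.2.2 = y' :=
    ⟨{p | p.1.2 = y ∧ p.2.2 = y'}, (measurableSet_eq_fun (by fun_prop) (by fun_prop)).inter
      (measurableSet_eq_fun (by fun_prop) (by fun_prop)), fun _ => Iff.rfl⟩
  have hF' : Measurable (fun p : (EuclideanSpace ℝ (Fin d) × ℝ) × (EuclideanSpace ℝ (Fin d) × ℝ)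
      => F p.1.1 p.2.1) :=
    hF.comp ((measurable_fst.comp measurable_fst).prodMk (measurable_fst.comp measurable_snd))
  have h := integral_swap hA (hF'.indicator hD)
  rw [← integral_indicator ((measurableSet_level hY _).inter (measurable_jump hY hY' _)),
    ← integral_indicator ((measurableSet_level hY _).inter (measurable_jump hY hY' _))]
  convert h using 2
  · ext ω
    have : (ω ∈ Y ⁻¹' {y} ∩ jump Y Y' (y' - y)) ↔ (Y ω = y ∧ Y' ω = y') := by
      simp only [jump, Set.mem_inter_iff, Set.mem_preimage, Set.mem_singleton_iff,
        Set.mem_ofPred_eq]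
      constructor <;> rintro ⟨h1, h2⟩ <;> constructor <;> linarith
    by_cases hω : Y ω = y ∧ Y' ω = y'
    · rw [Set.indicator_of_mem (this.2 hω),
        Set.indicator_of_mem ((hmem ((W ω, Y ω), (W' ω, Y' ω))).2 hω)]
    · rw [Set.indicator_of_notMem (mt this.1 hω),
        Set.indicator_of_notMem (mt (hmem ((W ω, Y ω), (W' ω, Y' ω))).1 hω)]
  · ext ω
    have : (ω ∈ Y ⁻¹' {y'} ∩ jump Y Y' (y - y')) ↔ (Y' ω = y ∧ Y ω = y') := by
      simp only [jump, Set.mem_inter_iff, Set.mem_preimage, Set.mem_singleton_iff,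
        Set.mem_ofPred_eq]
      constructor <;> rintro ⟨h1, h2⟩ <;> constructor <;> linarith
    by_cases hω : Y' ω = y ∧ Y ω = y'
    · rw [Set.indicator_of_mem (this.2 hω),
        Set.indicator_of_mem ((hmem ((W' ω, Y' ω), (W ω, Y ω))).2 hω)]
    · rw [Set.indicator_of_notMem (mt this.1 hω),
        Set.indicator_of_notMem (mt (hmem ((W' ω, Y' ω), (W ω, Y ω))).1 hω)]

/-- Down-jumps from `k` are the reversals of up-jumps from `k - 1`. -/
lemma setIntegral_swap_down
    (hA : CondSteinAssumptions P W W' Y Y' S Ψ lam ζ R0p R0m R1p R1m C2p C2m)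
    {F : EuclideanSpace ℝ (Fin d) → EuclideanSpace ℝ (Fin d) → ℝ}
    (hF : Measurable (Function.uncurry F)) (k : ℝ) :
    ∫ ω in Y ⁻¹' {k} ∩ jump Y Y' (-1), F (W ω) (W' ω) ∂P
      = ∫ ω in Y ⁻¹' {k - 1} ∩ jump Y Y' 1, F (W' ω) (W ω) ∂P := by
  have h := setIntegral_swap hA hF (y := k) (y' := k - 1)
  rwa [show k - 1 - k = -1 by ring, show k - (k - 1) = 1 by ring] at h

lemma setIntegral_crossing_swap
    (hA : CondSteinAssumptions P W W' Y Y' S Ψ lam ζ R0p R0m R1p R1m C2p C2m)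
    {F : EuclideanSpace ℝ (Fin d) → EuclideanSpace ℝ (Fin d) → ℝ}
    (hF : Measurable (Function.uncurry F)) (hi : Integrable (fun ω => F (W ω) (W' ω)) P)
    (hi' : Integrable (fun ω => F (W' ω) (W ω)) P) (k : ℝ) :
    ∫ ω in crossing Y Y' k, F (W ω) (W' ω) ∂P = ∫ ω in crossing Y Y' k, F (W' ω) (W ω) ∂P := by
  rw [setIntegral_crossing hA.measurable_Y hA.measurable_Y' k hi,
    setIntegral_crossing hA.measurable_Y hA.measurable_Y' k hi', setIntegral_swap_down hA hF k,
    setIntegral_swap_down hA (F := fun x y => F y x) (hF.comp measurable_swap) k, add_comm]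

lemma memLp_W' (hA : CondSteinAssumptions P W W' Y Y' S Ψ lam ζ R0p R0m R1p R1m C2p C2m)
    {p : ℝ≥0∞} (h : MemLp W p P) : MemLp W' p P := by
  have hW := hA.measurable_W
  have hW' := hA.measurable_W'
  have hY := hA.measurable_Y
  have hY' := hA.measurable_Y'
  have h1 : P.map W = P.map W' := by
    have h2 := congrArg (Measure.map (fun p :
      (EuclideanSpace ℝ (Fin d) × ℝ) × (EuclideanSpace ℝ (Fin d) × ℝ) => p.1.1)) hA.exch
    rw [Measure.map_map (by fun_prop) (by fun_prop), Measure.map_map (by fun_prop) (by fun_prop)]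
      at h2
    exact h2
  have h3 : MemLp id p (P.map W) := (memLp_map_measure_iff (by fun_prop) (by fun_prop)).2 h
  rw [h1] at h3
  exact (memLp_map_measure_iff (f := W') (g := id) (by fun_prop) (by fun_prop)).1 h3

lemma memLp_delta (hA : CondSteinAssumptions P W W' Y Y' S Ψ lam ζ R0p R0m R1p R1m C2p C2m)
    {p : ℝ≥0∞} (h : MemLp W p P) : MemLp (fun ω => W' ω - W ω) p P :=
  (memLp_W' hA h).sub h

lemma integrable_W (hA : CondSteinAssumptions P W W' Y Y' S Ψ lam ζ R0p R0m R1p R1m C2p C2m) :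
    Integrable W P := hA.memLp_W.integrable one_le_two

lemma integrable_W' (hA : CondSteinAssumptions P W W' Y Y' S Ψ lam ζ R0p R0m R1p R1m C2p C2m) :
    Integrable W' P := (memLp_W' hA hA.memLp_W).integrable one_le_two

lemma integrable_delta (hA : CondSteinAssumptions P W W' Y Y' S Ψ lam ζ R0p R0m R1p R1m C2p C2m) :
    Integrable (fun ω => W' ω - W ω) P := (integrable_W' hA).sub (integrable_W hA)

lemma memLp_coord {f : Ω → EuclideanSpace ℝ (Fin d)} {p : ℝ≥0∞} (h : MemLp f p P) (i : Fin d) :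
    MemLp (fun ω => f ω i) p P :=
  h.of_le ((EuclideanSpace.proj (𝕜 := ℝ) i).continuous.comp_aestronglyMeasurable h.1)
    (ae_of_all _ fun _ => PiLp.norm_apply_le _ i)

lemma integrable_delta_mul
    (hA : CondSteinAssumptions P W W' Y Y' S Ψ lam ζ R0p R0m R1p R1m C2p C2m) (i j : Fin d) :
    Integrable (fun ω => (W' ω - W ω) i * (W' ω - W ω) j) P :=
  (memLp_coord (memLp_delta hA hA.memLp_W) i).integrable_mul
    (memLp_coord (memLp_delta hA hA.memLp_W) j)

lemma integrable_mulV (M : Matrix (Fin d) (Fin d) ℝ) {f : Ω → EuclideanSpace ℝ (Fin d)}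
    (h : Integrable f P) : Integrable (fun ω => mulV M (f ω)) P :=
  (Matrix.toEuclideanCLM (n := Fin d) (𝕜 := ℝ) M).integrable_comp h

/-- The remainder inherits integrability from the conditional expectation that defines it. -/
lemma integrable_R1 (hlam : lam ≠ 0) {R1 : Ω → EuclideanSpace ℝ (Fin d)} {s : ℝ}
    (hW : Integrable W P)
    (h : condM1 P W W' Y Y' s =ᵐ[P] fun ω => -(lam • ((1 / 2 : ℝ) • mulV Ψ (W ω) + R1 ω))) :
    Integrable R1 P := by
  have h1 : Integrable (fun ω => -(lam⁻¹ • condM1 P W W' Y Y' s ω)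
      - (1 / 2 : ℝ) • mulV Ψ (W ω)) P :=
    (integrable_condExp.smul lam⁻¹).neg.sub ((integrable_mulV Ψ hW).smul (1 / 2 : ℝ))
  refine h1.congr ?_
  filter_upwards [h] with ω hω
  rw [hω, smul_neg, neg_neg, inv_smul_smul₀ hlam]
  abel

lemma integrable_C2 (hlam : lam ≠ 0) {C2 : Ω → Matrix (Fin d) (Fin d) ℝ} {s : ℝ} {i j : Fin d}
    (h : condM2 P W W' Y Y' s i j =ᵐ[P] fun ω => lam * ((Ψ * S) i j + C2 ω i j)) :
    Integrable (fun ω => C2 ω i j) P := by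
  have h1 : Integrable (fun ω => lam⁻¹ * condM2 P W W' Y Y' s i j ω - (Ψ * S) i j) P :=
    (integrable_condExp.const_mul lam⁻¹).sub (integrable_const _)
  refine h1.congr ?_
  filter_upwards [h] with ω hω
  rw [hω]
  field_simp
  ring

lemma integrable_mul_entry {C2 : Ω → Matrix (Fin d) (Fin d) ℝ} (M : Matrix (Fin d) (Fin d) ℝ)
    (h : ∀ i j, Integrable (fun ω => C2 ω i j) P) (i j : Fin d) :
    Integrable (fun ω => (M * C2 ω) i j) P := by
  simp_rw [Matrix.mul_apply]
  exact integrable_finsetSum _ fun l _ => (h l j).const_mul _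

lemma integrable_hsNorm {C2 : Ω → Matrix (Fin d) (Fin d) ℝ}
    (h : ∀ i j, Integrable (fun ω => C2 ω i j) P) : Integrable (fun ω => hsNorm (C2 ω)) P := by
  have hs : ∀ ω, hsNorm (C2 ω) = Real.sqrt (∑ i, ∑ j, C2 ω i j * C2 ω i j) := fun ω => by
    rw [hsNorm, trace_transpose_mul]
  have hint : Integrable (fun ω => ∑ i, ∑ j, |C2 ω i j|) P :=
    integrable_finsetSum _ fun i _ => integrable_finsetSum _ fun j _ => (h i j).abs
  refine hint.mono' ?_ (ae_of_all _ fun ω => ?_)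
  · simp_rw [hs]
    refine Real.continuous_sqrt.comp_aestronglyMeasurable ?_
    exact Finset.aestronglyMeasurable_fun_sum _ fun i _ =>
      Finset.aestronglyMeasurable_fun_sum _ fun j _ => (h i j).1.mul (h i j).1
  · have hnn : 0 ≤ ∑ i, ∑ j, |C2 ω i j| :=
      Finset.sum_nonneg fun i _ => Finset.sum_nonneg fun j _ => abs_nonneg _
    rw [Real.norm_of_nonneg (hsNorm_nonneg _)]
    refine (abs_le_of_sq_le_sq' ?_ hnn).2
    rw [hsNorm_sq]
    simp_rw [← Finset.sum_product']
    refine le_trans (le_of_eq ?_) (Finset.sum_sq_le_sq_sum_of_nonneg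
      (fun p _ => abs_nonneg (C2 ω p.1 p.2)))
    exact Finset.sum_congr rfl fun p _ => (sq_abs _).symm

lemma integral_cond_mul {s : Set Ω} (hs : P s ≠ 0) (f : Ω → ℝ) :
    P.real s * ∫ ω, f ω ∂P[|s] = ∫ ω in s, f ω ∂P := by
  rw [ProbabilityTheory.cond, integral_smul_measure, smul_eq_mul, ENNReal.toReal_inv, ← mul_assoc]
  have : P.real s ≠ 0 := by
    rw [Measure.real, ENNReal.toReal_ne_zero]
    exact ⟨hs, measure_ne_top _ _⟩
  change P.real s * (P.real s)⁻¹ * _ = _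
  rw [mul_inv_cancel₀ this, one_mul]

end ExchangeablePair

/-! ### The Stein functional on the crossing event -/

section SteinIdentity

variable {Ω : Type*} [MeasurableSpace Ω] {P : Measure Ω} [IsProbabilityMeasure P] {d : ℕ}
  {W W' : Ω → EuclideanSpace ℝ (Fin d)} {Y Y' : Ω → ℝ} {S Ψ : Matrix (Fin d) (Fin d) ℝ}
  {lam ζ : ℝ} {R0p R0m : Ω → ℝ} {R1p R1m : Ω → EuclideanSpace ℝ (Fin d)}
  {C2p C2m : Ω → Matrix (Fin d) (Fin d) ℝ}
  {g : EuclideanSpace ℝ (Fin d) → EuclideanSpace ℝ (Fin d)}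
  {H : EuclideanSpace ℝ (Fin d) → Matrix (Fin d) (Fin d) ℝ} {κ : ℝ}

lemma inv_mul_of_isUnit (h : IsUnit Ψ) : Ψ⁻¹ * Ψ = 1 :=
  Matrix.nonsing_inv_mul _ ((Matrix.isUnit_iff_isUnit_det _).1 h)

lemma integrable_inner_bounded (hW : Measurable W) (hg : Measurable g) {C : ℝ}
    (hC : ∀ w, ‖g w‖ ≤ C) {f : Ω → EuclideanSpace ℝ (Fin d)} (hf : Integrable f P) :
    Integrable (fun ω => inner ℝ (f ω) (g (W ω))) P := by
  refine (hf.norm.mul_const C).mono' (hf.1.inner (hg.comp hW).aestronglyMeasurable)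
    (ae_of_all _ fun ω => ?_)
  exact (norm_inner_le_norm _ _).trans (mul_le_mul_of_nonneg_left (hC _) (norm_nonneg _))

lemma hsNorm_vecMulVec (a v : EuclideanSpace ℝ (Fin d)) :
    hsNorm (Matrix.vecMulVec a v) = ‖a‖ * ‖v‖ := by
  have h : hsNorm (Matrix.vecMulVec a v) ^ 2 = (‖a‖ * ‖v‖) ^ 2 := by
    rw [hsNorm_sq, mul_pow, EuclideanSpace.norm_sq_eq, EuclideanSpace.norm_sq_eq,
      Finset.sum_mul_sum]
    refine Finset.sum_congr rfl fun i _ => Finset.sum_congr rfl fun j _ => ?_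
    rw [Matrix.vecMulVec_apply, mul_pow, Real.norm_eq_abs, Real.norm_eq_abs, sq_abs, sq_abs]
  exact (pow_left_inj₀ (hsNorm_nonneg _) (by positivity) two_ne_zero).1 h

lemma abs_inner_mulV_le (hκ : ∀ w M, |((H w).transpose * M).trace| ≤ κ * hsNorm M)
    (w a v : EuclideanSpace ℝ (Fin d)) :
    |inner ℝ a (mulV (H w) v)| ≤ κ * (‖a‖ * ‖v‖) := by
  rw [inner_mulV_eq_trace, ← hsNorm_vecMulVec]
  exact hκ _ _

lemma abs_entry_le (hκ : ∀ w M, |((H w).transpose * M).trace| ≤ κ * hsNorm M)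
    (w : EuclideanSpace ℝ (Fin d)) (i j : Fin d) : |H w i j| ≤ κ := by
  have h := abs_inner_mulV_le hκ w (EuclideanSpace.single i 1) (EuclideanSpace.single j 1)
  have h2 : inner ℝ (EuclideanSpace.single i (1 : ℝ)) (mulV (H w) (EuclideanSpace.single j 1))
      = H w i j := by
    rw [EuclideanSpace.inner_single_left, mulV_apply]
    simp
  rw [h2] at h
  simpa using h

lemma measurable_inner_mulV (hH : ∀ i j, Measurable fun w => H w i j) {α : Type*}
    [MeasurableSpace α] {x a v : α → EuclideanSpace ℝ (Fin d)} (hx : Measurable x)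
    (ha : Measurable a) (hv : Measurable v) :
    Measurable (fun p => inner ℝ (a p) (mulV (H (x p)) (v p))) := by
  simp_rw [inner_eq_sum, mulV_apply]
  refine Finset.measurable_fun_sum _ fun i _ => Measurable.mul (by fun_prop) ?_
  refine Finset.measurable_fun_sum _ fun j _ => Measurable.mul ?_ (by fun_prop)
  exact (hH i j).comp hx

lemma integrable_inner_mulV (hA : CondSteinAssumptions P W W' Y Y' S Ψ lam ζ R0p R0m R1p R1m C2p C2m)
    (hH : ∀ i j, Measurable fun w => H w i j)
    (hκ : ∀ w M, |((H w).transpose * M).trace| ≤ κ * hsNorm M)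
    {x : Ω → EuclideanSpace ℝ (Fin d)} (hx : Measurable x) :
    Integrable (fun ω => inner ℝ (mulV Ψ⁻¹ (W' ω - W ω)) (mulV (H (x ω)) (W' ω - W ω))) P := by
  have hW := hA.measurable_W
  have hW' := hA.measurable_W'
  have hκ0 : ∀ v : EuclideanSpace ℝ (Fin d), 0 ≤ κ * ‖v‖ ^ 2 := by
    intro v
    have := (abs_nonneg _).trans (abs_inner_mulV_le hκ 0 v v)
    rwa [← sq] at this
  have hD2 : Integrable (fun ω => ‖W' ω - W ω‖ ^ 2) P :=
    (memLp_delta hA hA.memLp_W).integrable_norm_pow two_ne_zero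
  refine (hD2.const_mul (κ * opNorm Ψ⁻¹)).mono'
    (measurable_inner_mulV hH hx (by fun_prop) (by fun_prop)).aestronglyMeasurable
    (ae_of_all _ fun ω => ?_)
  set v := W' ω - W ω
  refine (abs_inner_mulV_le hκ _ _ _).trans ?_
  rcases eq_or_ne v 0 with hv | hv
  · simp [hv]
  have hκ1 : 0 ≤ κ := by
    have := hκ0 v
    have h2 : 0 < ‖v‖ ^ 2 := by positivity
    exact nonneg_of_mul_nonneg_left this h2
  calc κ * (‖mulV Ψ⁻¹ v‖ * ‖v‖) ≤ κ * (opNorm Ψ⁻¹ * ‖v‖ * ‖v‖) := by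
        gcongr
        exact norm_mulV_le _ _
    _ = κ * opNorm Ψ⁻¹ * ‖v‖ ^ 2 := by ring

/-- The linearity condition, multiplied by `Ψ⁻¹` and tested against `g W`. -/
lemma setIntegral_first_order {R1 : Ω → EuclideanSpace ℝ (Fin d)} {s : ℝ}
    (hA : CondSteinAssumptions P W W' Y Y' S Ψ lam ζ R0p R0m R1p R1m C2p C2m)
    (h1 : condM1 P W W' Y Y' s =ᵐ[P] fun ω => -(lam • ((1 / 2 : ℝ) • mulV Ψ (W ω) + R1 ω)))
    (hg : Measurable g) (hg1 : ∀ w, ‖g w‖ ≤ 1) (y : ℝ) :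
    ∫ ω in Y ⁻¹' {y} ∩ jump Y Y' s, inner ℝ (mulV Ψ⁻¹ (W' ω - W ω)) (g (W ω)) ∂P
      = -lam * (1 / 2 * ∫ ω in Y ⁻¹' {y}, inner ℝ (W ω) (g (W ω)) ∂P
        + ∫ ω in Y ⁻¹' {y}, inner ℝ (mulV Ψ⁻¹ (R1 ω)) (g (W ω)) ∂P) := by
  have hW := hA.measurable_W
  have hR1 := integrable_R1 hA.lam_mem.1.ne' (integrable_W hA) h1
  have hη : Measurable (fun w => mulV (Ψ⁻¹).transpose (g w)) := (measurable_mulV _).comp hg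
  have h := setIntegral_inner_condM1 hA.measurable_W hA.measurable_Y hA.measurable_Y'
    (integrable_delta hA) hA.measurable_W' hη (C := opNorm (Ψ⁻¹).transpose)
    (fun w => (norm_mulV_le _ _).trans (mul_le_of_le_one_right (opNorm_nonneg _) (hg1 w))) s y
  have hl : ∀ ω, inner ℝ (mulV Ψ⁻¹ (W' ω - W ω)) (g (W ω))
      = inner ℝ (mulV (Ψ⁻¹).transpose (g (W ω))) (W' ω - W ω) := by
    intro ω
    rw [inner_mulV_left, real_inner_comm]
  simp_rw [hl]
  rw [h]
  have i1 := integrable_inner_bounded hW hg hg1 (integrable_W hA)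
  have i2 := integrable_inner_bounded hW hg hg1 (integrable_mulV Ψ⁻¹ hR1)
  rw [← integral_const_mul, ← integral_add (i1.const_mul _).integrableOn i2.integrableOn,
    ← integral_const_mul]
  refine integral_congr_ae (ae_restrict_of_ae ?_)
  filter_upwards [h1] with ω hω
  rw [hω, inner_mulV_left, Matrix.transpose_transpose, mulV_neg, mulV_smul, mulV_add, mulV_smul,
    ← mulV_mul, inv_mul_of_isUnit hA.isUnit_Ψ, mulV_one, inner_neg_right, real_inner_smul_right,
    inner_add_right, real_inner_smul_right, real_inner_comm, real_inner_comm (mulV Ψ⁻¹ (R1 ω))]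
  ring

lemma integrable_trace_mul (hW : Measurable W) (hH : ∀ i j, Measurable fun w => H w i j)
    (hκ : ∀ w M, |((H w).transpose * M).trace| ≤ κ * hsNorm M)
    {C2 : Ω → Matrix (Fin d) (Fin d) ℝ} (hC2 : ∀ i j, Integrable (fun ω => C2 ω i j) P) :
    Integrable (fun ω => ((H (W ω)).transpose * C2 ω).trace) P := by
  simp_rw [trace_transpose_mul]
  refine integrable_finsetSum _ fun i _ => integrable_finsetSum _ fun j _ => ?_
  exact (hC2 i j).bdd_mul (c := κ) ((hH i j).comp hW).aestronglyMeasurable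
    (ae_of_all _ fun ω => abs_entry_le hκ _ _ _)

/-- The condition on second moments, tested against `H W`; `Ψ⁻¹` turns `Ψ * S` into `S`. -/
lemma setIntegral_second_order {C2 : Ω → Matrix (Fin d) (Fin d) ℝ} {s : ℝ}
    (hA : CondSteinAssumptions P W W' Y Y' S Ψ lam ζ R0p R0m R1p R1m C2p C2m)
    (h2 : ∀ i j, condM2 P W W' Y Y' s i j =ᵐ[P] fun ω => lam * ((Ψ * S) i j + C2 ω i j))
    (hH : ∀ i j, Measurable fun w => H w i j)
    (hκ : ∀ w M, |((H w).transpose * M).trace| ≤ κ * hsNorm M) (y : ℝ) :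
    ∫ ω in Y ⁻¹' {y} ∩ jump Y Y' s,
        inner ℝ (mulV Ψ⁻¹ (W' ω - W ω)) (mulV (H (W ω)) (W' ω - W ω)) ∂P
      = lam * (∫ ω in Y ⁻¹' {y}, ((H (W ω)).transpose * S).trace ∂P
        + ∫ ω in Y ⁻¹' {y}, ((H (W ω)).transpose * (Ψ⁻¹ * C2 ω)).trace ∂P) := by
  have hW := hA.measurable_W
  have hC2 : ∀ i j, Integrable (fun ω => C2 ω i j) P := fun i j =>
    integrable_C2 hA.lam_mem.1.ne' (h2 i j)
  obtain ⟨N, hN⟩ : ∃ N : EuclideanSpace ℝ (Fin d) → Fin d → Fin d → ℝ,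
      N = fun w i j => ∑ l, Ψ⁻¹ l i * H w l j := ⟨_, rfl⟩
  have hNe : ∀ w i j, N w i j = ((Ψ⁻¹).transpose * H w) i j := by
    intro w i j
    rw [hN, Matrix.mul_apply]
    rfl
  have hNm : ∀ i j, Measurable (fun w => N w i j) := by
    intro i j
    rw [hN]
    exact Finset.measurable_fun_sum _ fun l _ => (hH l j).const_mul _
  have hNb : ∀ i j w, |N w i j| ≤ ∑ l, |Ψ⁻¹ l i| * κ := by
    intro i j w
    rw [hN]
    refine (Finset.abs_sum_le_sum_abs _ _).trans (Finset.sum_le_sum fun l _ => ?_)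
    rw [abs_mul]
    exact mul_le_mul_of_nonneg_left (abs_entry_le hκ _ _ _) (abs_nonneg _)
  have hD := fun i j => integrable_delta_mul hA i j
  have hND : ∀ i j, Integrable (fun ω => N (W ω) i j * ((W' ω - W ω) i * (W' ω - W ω) j)) P :=
    fun i j => (hD i j).bdd_mul (c := ∑ l, |Ψ⁻¹ l i| * κ)
      ((hNm i j).comp hW).aestronglyMeasurable (ae_of_all _ fun ω => hNb _ _ _)
  have hNM : ∀ i j, Integrable (fun ω => N (W ω) i j * condM2 P W W' Y Y' s i j ω) P :=
    fun i j => integrable_condExp.bdd_mul (c := ∑ l, |Ψ⁻¹ l i| * κ)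
      ((hNm i j).comp hW).aestronglyMeasurable (ae_of_all _ fun ω => hNb _ _ _)
  have hl : ∀ ω, inner ℝ (mulV Ψ⁻¹ (W' ω - W ω)) (mulV (H (W ω)) (W' ω - W ω))
      = ∑ i, ∑ j, N (W ω) i j * ((W' ω - W ω) i * (W' ω - W ω) j) := by
    intro ω
    rw [inner_mulV_left, ← mulV_mul, inner_eq_sum]
    refine Finset.sum_congr rfl fun i _ => ?_
    rw [mulV_apply, Finset.mul_sum]
    refine Finset.sum_congr rfl fun j _ => ?_
    rw [hNe]
    ring
  simp_rw [hl]
  have i1 := integrable_trace_mul hW hH hκ (fun i j => integrable_const (μ := P) (S i j))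
  have i2 := integrable_trace_mul hW hH hκ (integrable_mul_entry Ψ⁻¹ hC2)
  rw [← integral_add i1.integrableOn i2.integrableOn, ← integral_const_mul]
  calc _ = ∑ i, ∑ j, ∫ ω in Y ⁻¹' {y} ∩ jump Y Y' s,
          N (W ω) i j * ((W' ω - W ω) i * (W' ω - W ω) j) ∂P := by
        refine (integral_finsetSum _ fun i _ => integrable_finsetSum _ fun j _ =>
          (hND i j).integrableOn).trans (Finset.sum_congr rfl fun i _ => ?_)
        exact integral_finsetSum _ fun j _ => (hND i j).integrableOn
    _ = ∑ i, ∑ j, ∫ ω in Y ⁻¹' {y}, N (W ω) i j * condM2 P W W' Y Y' s i j ω ∂P := by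
        refine Finset.sum_congr rfl fun i _ => Finset.sum_congr rfl fun j _ => ?_
        exact setIntegral_mul_condM2 hW hA.measurable_Y hA.measurable_Y' i j (hD i j) (hNm i j)
          (hNb i j) s y
    _ = ∫ ω in Y ⁻¹' {y}, ∑ i, ∑ j, N (W ω) i j * condM2 P W W' Y Y' s i j ω ∂P := by
        refine Eq.symm ((integral_finsetSum _ fun i _ => integrable_finsetSum _ fun j _ =>
          (hNM i j).integrableOn).trans (Finset.sum_congr rfl fun i _ => ?_))
        exact integral_finsetSum _ fun j _ => (hNM i j).integrableOn
    _ = _ := by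
        refine integral_congr_ae (ae_restrict_of_ae ?_)
        have h2' : ∀ᵐ ω ∂P, ∀ i j, condM2 P W W' Y Y' s i j ω
            = lam * ((Ψ * S) i j + C2 ω i j) :=
          ae_all_iff.2 fun i => ae_all_iff.2 fun j => h2 i j
        filter_upwards [h2'] with ω hω
        have hS : S = Ψ⁻¹ * (Ψ * S) := by
          rw [← Matrix.mul_assoc, inv_mul_of_isUnit hA.isUnit_Ψ, Matrix.one_mul]
        have ht : ((H (W ω)).transpose * S).trace + ((H (W ω)).transpose * (Ψ⁻¹ * C2 ω)).trace
            = (((Ψ⁻¹).transpose * H (W ω)).transpose * (Ψ * S + C2 ω)).trace := by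
          rw [← Matrix.trace_add, ← Matrix.mul_add, Matrix.transpose_mul,
            Matrix.transpose_transpose, Matrix.mul_assoc, Matrix.mul_add Ψ⁻¹, ← hS]
        rw [ht, trace_transpose_mul, Finset.mul_sum]
        refine Finset.sum_congr rfl fun i _ => ?_
        rw [Finset.mul_sum]
        refine Finset.sum_congr rfl fun j _ => ?_
        rw [hω, hNe, Matrix.add_apply]
        ring

/-- The exchangeable-pair identity on the event that `(Y, Y')` crosses between `k - 1` and `k`:
the functional `⟪W, g W⟫ - tr (Hᵀ S)`, integrated over `Y ∈ {k - 1, k}`, consists of the remainders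
of the conditional moments and of the error of the trapezoidal rule. For a vector field `g` with
derivative `H` this functional is the negative of Stein's operator, up to transposition. -/
lemma stein_functional_eq
    (hA : CondSteinAssumptions P W W' Y Y' S Ψ lam ζ R0p R0m R1p R1m C2p C2m)
    (hg : Measurable g) (hg1 : ∀ w, ‖g w‖ ≤ 1) (hH : ∀ i j, Measurable fun w => H w i j)
    (hκ : ∀ w M, |((H w).transpose * M).trace| ≤ κ * hsNorm M) (k : ℝ) :
    lam * ∫ ω in Y ⁻¹' {k - 1, k}, (inner ℝ (W ω) (g (W ω)) - ((H (W ω)).transpose * S).trace) ∂P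
      = (∫ ω in crossing Y Y' k, (inner ℝ (mulV Ψ⁻¹ (W' ω - W ω)) (g (W' ω) - g (W ω))
          - (inner ℝ (mulV Ψ⁻¹ (W' ω - W ω)) (mulV (H (W ω)) (W' ω - W ω))
            + inner ℝ (mulV Ψ⁻¹ (W' ω - W ω)) (mulV (H (W' ω)) (W' ω - W ω))) / 2) ∂P)
        - 2 * lam * (∫ ω in Y ⁻¹' {k}, inner ℝ (mulV Ψ⁻¹ (R1m ω)) (g (W ω)) ∂P
          + ∫ ω in Y ⁻¹' {k - 1}, inner ℝ (mulV Ψ⁻¹ (R1p ω)) (g (W ω)) ∂P)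
        + lam * (∫ ω in Y ⁻¹' {k}, ((H (W ω)).transpose * (Ψ⁻¹ * C2m ω)).trace ∂P
          + ∫ ω in Y ⁻¹' {k - 1}, ((H (W ω)).transpose * (Ψ⁻¹ * C2p ω)).trace ∂P) := by
  have hW := hA.measurable_W
  have hW' := hA.measurable_W'
  have hY := hA.measurable_Y
  have hY' := hA.measurable_Y'
  have iΔ := integrable_mulV Ψ⁻¹ (integrable_delta hA)
  have ig := integrable_inner_bounded hW hg hg1 iΔ
  have ig' := integrable_inner_bounded hW' hg hg1 iΔ
  have iH := integrable_inner_mulV hA hH hκ hW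
  have iH' := integrable_inner_mulV hA hH hκ hW'
  -- Exchangeability annihilates the antisymmetric function `⟪Ψ⁻¹ (w' - w), g w + g w'⟫`.
  have hanti : ∫ ω in crossing Y Y' k, inner ℝ (mulV Ψ⁻¹ (W' ω - W ω)) (g (W' ω)) ∂P
      = -∫ ω in crossing Y Y' k, inner ℝ (mulV Ψ⁻¹ (W' ω - W ω)) (g (W ω)) ∂P := by
    have hsw : ∀ ω, inner ℝ (mulV Ψ⁻¹ (W ω - W' ω)) (g (W ω))
        = -inner ℝ (mulV Ψ⁻¹ (W' ω - W ω)) (g (W ω)) := by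
      intro ω
      rw [← neg_sub, mulV_neg, inner_neg_left]
    have h := setIntegral_crossing_swap hA
      (F := fun w w' => inner ℝ (mulV Ψ⁻¹ (w' - w)) (g w')) (by
        unfold Function.uncurry
        exact Measurable.inner (by fun_prop) (by fun_prop)) ig'
      (by simp_rw [hsw]; exact ig.neg) k
    rw [h]
    simp_rw [hsw]
    rw [integral_neg]
  have hsym : ∫ ω in crossing Y Y' k,
        inner ℝ (mulV Ψ⁻¹ (W' ω - W ω)) (mulV (H (W' ω)) (W' ω - W ω)) ∂P
      = ∫ ω in crossing Y Y' k,
        inner ℝ (mulV Ψ⁻¹ (W' ω - W ω)) (mulV (H (W ω)) (W' ω - W ω)) ∂P := by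
    have hsw : ∀ ω, inner ℝ (mulV Ψ⁻¹ (W ω - W' ω)) (mulV (H (W ω)) (W ω - W' ω))
        = inner ℝ (mulV Ψ⁻¹ (W' ω - W ω)) (mulV (H (W ω)) (W' ω - W ω)) := by
      intro ω
      rw [← neg_sub, mulV_neg, mulV_neg, inner_neg_neg]
    have h := setIntegral_crossing_swap hA
      (F := fun w w' => inner ℝ (mulV Ψ⁻¹ (w' - w)) (mulV (H w') (w' - w))) (by
        unfold Function.uncurry
        exact measurable_inner_mulV hH (by fun_prop) (by fun_prop) (by fun_prop)) iH'
      (by simp_rw [hsw]; exact iH) k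
    rw [h]
    simp_rw [hsw]
  have htrap : ∫ ω in crossing Y Y' k, (inner ℝ (mulV Ψ⁻¹ (W' ω - W ω)) (g (W' ω) - g (W ω))
          - (inner ℝ (mulV Ψ⁻¹ (W' ω - W ω)) (mulV (H (W ω)) (W' ω - W ω))
            + inner ℝ (mulV Ψ⁻¹ (W' ω - W ω)) (mulV (H (W' ω)) (W' ω - W ω))) / 2) ∂P
      = -2 * (∫ ω in crossing Y Y' k, inner ℝ (mulV Ψ⁻¹ (W' ω - W ω)) (g (W ω)) ∂P)
        - ∫ ω in crossing Y Y' k,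
          inner ℝ (mulV Ψ⁻¹ (W' ω - W ω)) (mulV (H (W ω)) (W' ω - W ω)) ∂P := by
    simp_rw [inner_sub_right]
    have e1 := integral_sub (μ := P.restrict (crossing Y Y' k)) (ig'.sub ig).integrableOn
      ((iH.add iH').div_const 2).integrableOn
    simp only [Pi.sub_apply, Pi.add_apply] at e1
    rw [e1, integral_sub ig'.integrableOn ig.integrableOn, integral_div,
      integral_add iH.integrableOn iH'.integrableOn, hanti, hsym]
    ring
  have iW := integrable_inner_bounded hW hg hg1 (integrable_W hA)
  have iS := integrable_trace_mul hW hH hκ (fun i j => integrable_const (μ := P) (S i j))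
  rw [htrap, setIntegral_crossing hY hY' k ig, setIntegral_crossing hY hY' k iH,
    setIntegral_first_order hA hA.first_m hg hg1, setIntegral_first_order hA hA.first_p hg hg1,
    setIntegral_second_order hA hA.second_m hH hκ, setIntegral_second_order hA hA.second_p hH hκ,
    integral_sub iW.integrableOn iS.integrableOn, setIntegral_pair hY k iW,
    setIntegral_pair hY k iS]
  ring

lemma level_mul_AHat (hk : P (Y ⁻¹' {k}) ≠ 0) (hk1 : P (Y ⁻¹' {k - 1}) ≠ 0) :
    P.real (Y ⁻¹' {k}) * AHat P Y Ψ R1p R1m k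
      = ∫ ω in Y ⁻¹' {k}, ‖mulV Ψ⁻¹ (R1m ω)‖ ∂P
        + ∫ ω in Y ⁻¹' {k - 1}, ‖mulV Ψ⁻¹ (R1p ω)‖ ∂P := by
  have h0 : P.real (Y ⁻¹' {k}) ≠ 0 := by
    rw [Measure.real, ENNReal.toReal_ne_zero]
    exact ⟨hk, measure_ne_top _ _⟩
  rw [← integral_cond_mul hk, ← integral_cond_mul hk1, AHat, ratio, condAt, condAt]
  field_simp

lemma level_mul_BHat (hk : P (Y ⁻¹' {k}) ≠ 0) (hk1 : P (Y ⁻¹' {k - 1}) ≠ 0) :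
    P.real (Y ⁻¹' {k}) * BHat P Y Ψ C2p C2m k
      = ∫ ω in Y ⁻¹' {k}, hsNorm (Ψ⁻¹ * C2m ω) ∂P
        + ∫ ω in Y ⁻¹' {k - 1}, hsNorm (Ψ⁻¹ * C2p ω) ∂P := by
  have h0 : P.real (Y ⁻¹' {k}) ≠ 0 := by
    rw [Measure.real, ENNReal.toReal_ne_zero]
    exact ⟨hk, measure_ne_top _ _⟩
  rw [← integral_cond_mul hk, ← integral_cond_mul hk1, BHat, ratio, condAt, condAt]
  field_simp

/-- The bound on the Stein functional when the trapezoidal error is at most `C * n`. The hypothesis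
`hκ` says that `H` has Hilbert-Schmidt norm at most `κ`. -/
lemma abs_stein_functional_le
    (hA : CondSteinAssumptions P W W' Y Y' S Ψ lam ζ R0p R0m R1p R1m C2p C2m)
    (hg : Measurable g) (hg1 : ∀ w, ‖g w‖ ≤ 1) (hH : ∀ i j, Measurable fun w => H w i j)
    (hκ : ∀ w M, |((H w).transpose * M).trace| ≤ κ * hsNorm M)
    {n : Ω → ℝ} (hn : Integrable n P) (hn0 : ∀ ω, 0 ≤ n ω) {C : ℝ} (hC0 : 0 ≤ C)
    (hC : ∀ ω, |inner ℝ (mulV Ψ⁻¹ (W' ω - W ω)) (g (W' ω) - g (W ω))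
          - (inner ℝ (mulV Ψ⁻¹ (W' ω - W ω)) (mulV (H (W ω)) (W' ω - W ω))
            + inner ℝ (mulV Ψ⁻¹ (W' ω - W ω)) (mulV (H (W' ω)) (W' ω - W ω))) / 2| ≤ C * n ω)
    {k : ℝ} (hk : P (Y ⁻¹' {k}) ≠ 0) (hk1 : P (Y ⁻¹' {k - 1}) ≠ 0) :
    |∫ ω in Y ⁻¹' {k - 1, k}, (inner ℝ (W ω) (g (W ω)) - ((H (W ω)).transpose * S).trace) ∂P|
      ≤ 2 * (P.real (Y ⁻¹' {k}) * AHat P Y Ψ R1p R1m k)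
        + κ * (P.real (Y ⁻¹' {k}) * BHat P Y Ψ C2p C2m k)
        + C * (lam⁻¹ * ∫ ω in Y ⁻¹' {k - 1, k}, n ω ∂P) := by
  have hlam := hA.lam_mem.1
  have hW := hA.measurable_W
  have key := stein_functional_eq hA hg hg1 hH hκ k
  set X := ∫ ω in Y ⁻¹' {k - 1, k},
    (inner ℝ (W ω) (g (W ω)) - ((H (W ω)).transpose * S).trace) ∂P
  have bR : ∀ {R1 : Ω → EuclideanSpace ℝ (Fin d)}, Integrable R1 P → ∀ y : ℝ,
      |∫ ω in Y ⁻¹' {y}, inner ℝ (mulV Ψ⁻¹ (R1 ω)) (g (W ω)) ∂P|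
        ≤ ∫ ω in Y ⁻¹' {y}, ‖mulV Ψ⁻¹ (R1 ω)‖ ∂P := by
    intro R1 hR1 y
    rw [← Real.norm_eq_abs]
    refine norm_integral_le_of_norm_le (integrable_mulV Ψ⁻¹ hR1).norm.integrableOn
      (ae_of_all _ fun ω => ?_)
    exact (norm_inner_le_norm _ _).trans (mul_le_of_le_one_right (norm_nonneg _) (hg1 _))
  have bC : ∀ {C2 : Ω → Matrix (Fin d) (Fin d) ℝ}, (∀ i j, Integrable (fun ω => C2 ω i j) P) →
      ∀ y : ℝ, |∫ ω in Y ⁻¹' {y}, ((H (W ω)).transpose * (Ψ⁻¹ * C2 ω)).trace ∂P|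
        ≤ κ * ∫ ω in Y ⁻¹' {y}, hsNorm (Ψ⁻¹ * C2 ω) ∂P := by
    intro C2 hC2 y
    rw [← Real.norm_eq_abs, ← integral_const_mul]
    exact norm_integral_le_of_norm_le
      ((integrable_hsNorm (integrable_mul_entry Ψ⁻¹ hC2)).const_mul κ).integrableOn
      (ae_of_all _ fun ω => hκ _ _)
  have b1 := bR (integrable_R1 hlam.ne' (integrable_W hA) hA.first_m) k
  have b2 := bR (integrable_R1 hlam.ne' (integrable_W hA) hA.first_p) (k - 1)
  have b3 := bC (fun i j => integrable_C2 hlam.ne' (hA.second_m i j)) k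
  have b4 := bC (fun i j => integrable_C2 hlam.ne' (hA.second_p i j)) (k - 1)
  rw [level_mul_AHat hk hk1, level_mul_BHat hk hk1]
  have b5 : |∫ ω in crossing Y Y' k, (inner ℝ (mulV Ψ⁻¹ (W' ω - W ω)) (g (W' ω) - g (W ω))
          - (inner ℝ (mulV Ψ⁻¹ (W' ω - W ω)) (mulV (H (W ω)) (W' ω - W ω))
            + inner ℝ (mulV Ψ⁻¹ (W' ω - W ω)) (mulV (H (W' ω)) (W' ω - W ω))) / 2) ∂P|
      ≤ C * ∫ ω in Y ⁻¹' {k - 1, k}, n ω ∂P := by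
    rw [← Real.norm_eq_abs]
    refine (norm_integral_le_of_norm_le (hn.const_mul C).integrableOn
      (ae_of_all _ fun ω => hC ω)).trans ?_
    rw [integral_const_mul]
    refine mul_le_mul_of_nonneg_left ?_ hC0
    exact setIntegral_mono_set hn.integrableOn (ae_of_all _ fun ω => hn0 ω)
      (LE.le.eventuallyLE (crossing_subset_pair k))
  set T := ∫ ω in crossing Y Y' k, (inner ℝ (mulV Ψ⁻¹ (W' ω - W ω)) (g (W' ω) - g (W ω))
          - (inner ℝ (mulV Ψ⁻¹ (W' ω - W ω)) (mulV (H (W ω)) (W' ω - W ω))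
            + inner ℝ (mulV Ψ⁻¹ (W' ω - W ω)) (mulV (H (W' ω)) (W' ω - W ω))) / 2) ∂P
  set r1 := ∫ ω in Y ⁻¹' {k}, inner ℝ (mulV Ψ⁻¹ (R1m ω)) (g (W ω)) ∂P
  set r2 := ∫ ω in Y ⁻¹' {k - 1}, inner ℝ (mulV Ψ⁻¹ (R1p ω)) (g (W ω)) ∂P
  set c1 := ∫ ω in Y ⁻¹' {k}, ((H (W ω)).transpose * (Ψ⁻¹ * C2m ω)).trace ∂P
  set c2 := ∫ ω in Y ⁻¹' {k - 1}, ((H (W ω)).transpose * (Ψ⁻¹ * C2p ω)).trace ∂P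
  have hX : X = lam⁻¹ * T - 2 * (r1 + r2) + (c1 + c2) := by
    have : X = lam⁻¹ * (lam * X) := by rw [inv_mul_cancel_left₀ hlam.ne']
    rw [this, key]
    field_simp
  have hT : |lam⁻¹ * T| ≤ C * (lam⁻¹ * ∫ ω in Y ⁻¹' {k - 1, k}, n ω ∂P) := by
    rw [abs_mul, abs_of_pos (inv_pos.2 hlam)]
    calc lam⁻¹ * |T| ≤ lam⁻¹ * (C * ∫ ω in Y ⁻¹' {k - 1, k}, n ω ∂P) :=
          mul_le_mul_of_nonneg_left b5 (inv_pos.2 hlam).le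
      _ = _ := by ring
  rw [hX]
  rw [abs_le] at b1 b2 b3 b4 hT ⊢
  constructor <;> linarith [b1.1, b1.2, b2.1, b2.2, b3.1, b3.2, b4.1, b4.2, hT.1, hT.2]

end SteinIdentity

/-! ### Comparison of neighbouring levels -/

section LevelComparison

variable {Ω : Type*} [MeasurableSpace Ω] {P : Measure Ω} [IsProbabilityMeasure P] {d : ℕ}
  {W W' : Ω → EuclideanSpace ℝ (Fin d)} {Y Y' : Ω → ℝ} {S Ψ : Matrix (Fin d) (Fin d) ℝ}
  {lam ζ : ℝ} {R0p R0m : Ω → ℝ} {R1p R1m : Ω → EuclideanSpace ℝ (Fin d)}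
  {C2p C2m : Ω → Matrix (Fin d) (Fin d) ℝ}

lemma pair_ne_zero {k : ℝ} (hk : P (Y ⁻¹' {k}) ≠ 0) : P (Y ⁻¹' {k - 1, k}) ≠ 0 := fun h =>
  hk (measure_mono_null (fun _ hω => Or.inr hω) h)

lemma abs_R0_le {R0 : Ω → ℝ} {s : ℝ} (h : condM0 P W Y Y' s =ᵐ[P] fun ω => QVal P Y lam + R0 ω) :
    ∀ᵐ ω ∂P, |R0 ω| ≤ 1 + |QVal P Y lam| := by
  have hb : ∀ᵐ ω ∂P, |condM0 P W Y Y' s ω| ≤ 1 := by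
    refine ae_bdd_abs_condExp_of_ae_bdd_abs (R := 1) (ae_of_all _ fun ω => ?_)
    by_cases hω : ω ∈ jump Y Y' s <;> simp [hω]
  filter_upwards [h, hb] with ω h1 h2
  have : R0 ω = condM0 P W Y Y' s ω - QVal P Y lam := by rw [h1]; ring
  rw [this]
  exact (abs_sub _ _).trans (by linarith)

lemma integrable_mul_R0 {R0 : Ω → ℝ} {s : ℝ}
    (h : condM0 P W Y Y' s =ᵐ[P] fun ω => QVal P Y lam + R0 ω) {f : Ω → ℝ} (hf : Integrable f P) :
    Integrable (fun ω => f ω * R0 ω) P := by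
  have hm : AEStronglyMeasurable R0 P := by
    have h1 : Integrable (fun ω => condM0 P W Y Y' s ω - QVal P Y lam) P :=
      integrable_condExp.sub (integrable_const _)
    refine h1.1.congr ?_
    filter_upwards [h] with ω hω
    rw [hω]
    ring
  exact hf.mul_bdd hm (abs_R0_le h)

/-- A variable with two atoms is not almost surely constant. -/
lemma variance_pos_of_levels (hY2 : MemLp Y 2 P) {k : ℝ} (hk : P (Y ⁻¹' {k}) ≠ 0)
    (hk1 : P (Y ⁻¹' {k - 1}) ≠ 0) : 0 < Var[Y; P] := by
  refine lt_of_le_of_ne (variance_nonneg _ _) fun h0 => ?_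
  have h1 : evariance Y P = 0 := by
    rw [← hY2.ofReal_variance_eq, ← h0, ENNReal.ofReal_zero]
  rw [evariance_eq_zero_iff hY2.1.aemeasurable] at h1
  have hz : ∀ y, P (Y ⁻¹' {y}) ≠ 0 → y = ∫ ω, Y ω ∂P := by
    intro y hy
    by_contra hne
    refine hy (measure_mono_null (fun ω hω => ?_) (ae_iff.1 h1))
    intro hc
    have hωy : Y ω = y := hω
    exact hne (hωy ▸ hc)
  have := (hz _ hk).trans (hz _ hk1).symm
  linarith

lemma QVal_pos (hA : CondSteinAssumptions P W W' Y Y' S Ψ lam ζ R0p R0m R1p R1m C2p C2m) {k : ℝ}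
    (hk : P (Y ⁻¹' {k}) ≠ 0) (hk1 : P (Y ⁻¹' {k - 1}) ≠ 0) : 0 < QVal P Y lam :=
  mul_pos hA.lam_mem.1 (variance_pos_of_levels hA.memLp_Y hk hk1)

/-- Exchangeability makes the integrals of a Lipschitz function of `W` over the adjacent levels
`Y = k` and `Y = k - 1` nearly equal. -/
lemma abs_level_sub_le
    (hA : CondSteinAssumptions P W W' Y Y' S Ψ lam ζ R0p R0m R1p R1m C2p C2m) {k : ℝ}
    (hk : P (Y ⁻¹' {k}) ≠ 0) (hk1 : P (Y ⁻¹' {k - 1}) ≠ 0)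
    {η : EuclideanSpace ℝ (Fin d) → ℝ} (hη : LipschitzWith 1 η)
    (hηb : ∀ w, |η w| ≤ ‖w‖ + Real.sqrt S.trace) :
    |∫ ω in Y ⁻¹' {k}, η (W ω) ∂P - ∫ ω in Y ⁻¹' {k - 1}, η (W ω) ∂P|
      ≤ P.real (Y ⁻¹' {k - 1, k}) / QVal P Y lam
        * (CHat P W Y S R0p R0m k + DHat P W W' Y k) := by
  have hQ := QVal_pos hA hk hk1
  set Q := QVal P Y lam with hQdef
  have hW := hA.measurable_W
  have hW' := hA.measurable_W'
  have hY := hA.measurable_Y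
  have hY' := hA.measurable_Y'
  have hηm : Measurable η := hη.continuous.measurable
  have hbint : ∀ {X : Ω → EuclideanSpace ℝ (Fin d)}, Measurable X → Integrable X P →
      Integrable (fun ω => η (X ω)) P := by
    intro X hX hXi
    exact (hXi.norm.add (integrable_const (Real.sqrt S.trace))).mono'
      (hηm.comp hX).aestronglyMeasurable (ae_of_all _ fun ω => hηb _)
  have iη := hbint hW (integrable_W hA)
  have iη' := hbint hW' (integrable_W' hA)
  have iRm := integrable_mul_R0 hA.zeroth_m iη
  have iRp := integrable_mul_R0 hA.zeroth_p iη
  have iWc : Integrable (fun ω => ‖W ω‖ + Real.sqrt S.trace) P :=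
    (integrable_W hA).norm.add (integrable_const _)
  have iC : Integrable (fun ω => (‖W ω‖ + Real.sqrt S.trace) * (|R0p ω| + |R0m ω|)) P := by
    have h1 := (integrable_mul_R0 hA.zeroth_p iWc).abs
    have h2 := (integrable_mul_R0 hA.zeroth_m iWc).abs
    refine (h1.add h2).congr (ae_of_all _ fun ω => ?_)
    have h0 : 0 ≤ ‖W ω‖ + Real.sqrt S.trace := by positivity
    simp only [Pi.add_apply, abs_mul, abs_of_nonneg h0]
    ring
  have hlev : ∀ {R0 : Ω → ℝ} {s : ℝ},
      condM0 P W Y Y' s =ᵐ[P] (fun ω => Q + R0 ω) → Integrable (fun ω => η (W ω) * R0 ω) P →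
      ∀ y, ∫ ω in Y ⁻¹' {y} ∩ jump Y Y' s, η (W ω) ∂P
        = Q * ∫ ω in Y ⁻¹' {y}, η (W ω) ∂P + ∫ ω in Y ⁻¹' {y}, η (W ω) * R0 ω ∂P := by
    intro R0 s h0 hi y
    rw [setIntegral_mul_condM0 hW hY hY' hηm iη, ← integral_const_mul,
      ← integral_add (iη.const_mul Q).integrableOn hi.integrableOn]
    refine integral_congr_ae (ae_restrict_of_ae ?_)
    filter_upwards [h0] with ω hω
    rw [hω]
    ring
  have e1 := hlev hA.zeroth_m iRm k
  have e2 := hlev hA.zeroth_p iRp (k - 1)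
  have e3 := setIntegral_swap_down hA (F := fun w _ => η w) (hηm.comp measurable_fst) k
  have e4 : ∫ ω in Y ⁻¹' {k - 1} ∩ jump Y Y' 1, (η (W' ω) - η (W ω)) ∂P
      = ∫ ω in Y ⁻¹' {k - 1} ∩ jump Y Y' 1, η (W' ω) ∂P
        - ∫ ω in Y ⁻¹' {k - 1} ∩ jump Y Y' 1, η (W ω) ∂P :=
    integral_sub iη'.integrableOn iη.integrableOn
  have bD : |∫ ω in Y ⁻¹' {k - 1} ∩ jump Y Y' 1, (η (W' ω) - η (W ω)) ∂P|
      ≤ ∫ ω in Y ⁻¹' {k - 1, k}, ‖W' ω - W ω‖ ∂P := by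
    rw [← Real.norm_eq_abs]
    have iΔ := (integrable_delta hA).norm
    refine (norm_integral_le_of_norm_le iΔ.integrableOn (ae_of_all _ fun ω => ?_)).trans
      (setIntegral_mono_set iΔ.integrableOn (ae_of_all _ fun ω => norm_nonneg _)
        (LE.le.eventuallyLE fun ω hω => Or.inl hω.1))
    have := hη.dist_le_mul (W' ω) (W ω)
    rwa [NNReal.coe_one, one_mul, dist_eq_norm, dist_eq_norm] at this
  have bR : ∀ (R0 : Ω → ℝ) (y : ℝ), (∀ ω, |R0 ω| ≤ |R0p ω| + |R0m ω|) →
      |∫ ω in Y ⁻¹' {y}, η (W ω) * R0 ω ∂P|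
        ≤ ∫ ω in Y ⁻¹' {y}, (‖W ω‖ + Real.sqrt S.trace) * (|R0p ω| + |R0m ω|) ∂P := by
    intro R0 y hR
    rw [← Real.norm_eq_abs]
    refine norm_integral_le_of_norm_le iC.integrableOn (ae_of_all _ fun ω => ?_)
    rw [norm_mul]
    exact mul_le_mul (hηb _) (hR ω) (abs_nonneg _) (by positivity)
  have b1 := bR R0m k fun ω => le_add_of_nonneg_left (abs_nonneg _)
  have b2 := bR R0p (k - 1) fun ω => le_add_of_nonneg_right (abs_nonneg _)
  have hC : P.real (Y ⁻¹' {k - 1, k}) * CHat P W Y S R0p R0m k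
      = ∫ ω in Y ⁻¹' {k}, (‖W ω‖ + Real.sqrt S.trace) * (|R0p ω| + |R0m ω|) ∂P
        + ∫ ω in Y ⁻¹' {k - 1}, (‖W ω‖ + Real.sqrt S.trace) * (|R0p ω| + |R0m ω|) ∂P := by
    rw [← setIntegral_pair hY k iC]
    exact integral_cond_mul (pair_ne_zero hk) _
  have hD : P.real (Y ⁻¹' {k - 1, k}) * DHat P W W' Y k
      = ∫ ω in Y ⁻¹' {k - 1, k}, ‖W' ω - W ω‖ ∂P := integral_cond_mul (pair_ne_zero hk) _
  rw [div_mul_eq_mul_div, mul_add, hC, hD, le_div_iff₀ hQ,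
    show ∀ a : ℝ, |a| * Q = |a * Q| from fun a => by rw [abs_mul, abs_of_pos hQ]]
  rw [abs_le] at b1 b2 bD ⊢
  constructor <;> linarith [b1.1, b1.2, b2.1, b2.2, bD.1, bD.2]

end LevelComparison

/-! ### Interpolation on a quarter circle -/

section Interpolation

variable {Ω : Type*} [MeasurableSpace Ω] {P : Measure Ω} [IsProbabilityMeasure P] {d : ℕ}
  {W W' : Ω → EuclideanSpace ℝ (Fin d)} {Y Y' : Ω → ℝ} {S Ψ A B : Matrix (Fin d) (Fin d) ℝ}
  {lam ζ : ℝ} {R0p R0m : Ω → ℝ} {R1p R1m : Ω → EuclideanSpace ℝ (Fin d)}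
  {C2p C2m : Ω → Matrix (Fin d) (Fin d) ℝ}
  {h : EuclideanSpace ℝ (Fin d) → ℝ} {G : EuclideanSpace ℝ (Fin d) → EuclideanSpace ℝ (Fin d)}

/-- The Gaussian interpolation `∫ E h(sin θ W + cos θ A Z) dμ`, with `Z` standard Gaussian and
independent of `W`. -/
def gaussInterp (μ : Measure Ω) (W : Ω → EuclideanSpace ℝ (Fin d)) (A : Matrix (Fin d) (Fin d) ℝ)
    (h : EuclideanSpace ℝ (Fin d) → ℝ) (θ : ℝ) : ℝ :=
  ∫ p : Ω × EuclideanSpace ℝ (Fin d), h (Real.sin θ • W p.1 + Real.cos θ • mulV A p.2)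
    ∂(μ.prod (stdGaussian (EuclideanSpace ℝ (Fin d))))

lemma abs_lipschitz_le (hL : LipschitzWith 1 h) (x : EuclideanSpace ℝ (Fin d)) :
    |h x| ≤ |h 0| + ‖x‖ := by
  have h1 := hL.dist_le_mul x 0
  rw [NNReal.coe_one, one_mul, dist_zero_right, Real.dist_eq] at h1
  have h2 := abs_sub_abs_le_abs_sub (h x) (h 0)
  linarith

lemma integrable_lipschitz {α : Type*} [MeasurableSpace α] {ν : Measure α} [IsFiniteMeasure ν]
    (hL : LipschitzWith 1 h) {X : α → EuclideanSpace ℝ (Fin d)} (hX : Integrable X ν) :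
    Integrable (fun a => h (X a)) ν :=
  ((integrable_const |h 0|).add hX.norm).mono'
    (hL.continuous.comp_aestronglyMeasurable hX.1) (ae_of_all _ fun _ => abs_lipschitz_le hL _)

lemma integrable_mulV_stdGaussian (A : Matrix (Fin d) (Fin d) ℝ) :
    Integrable (fun z : EuclideanSpace ℝ (Fin d) => mulV A z)
      (stdGaussian (EuclideanSpace ℝ (Fin d))) :=
  (integrable_norm_iff (continuous_mulV A).aestronglyMeasurable).1 (integrable_norm_mulV A)

lemma integrable_interp_point {μ : Measure Ω} [IsFiniteMeasure μ] (hWi : Integrable W μ) (a b : ℝ) :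
    Integrable (fun p : Ω × EuclideanSpace ℝ (Fin d) => a • W p.1 + b • mulV A p.2)
      (μ.prod (stdGaussian (EuclideanSpace ℝ (Fin d)))) :=
  ((hWi.comp_fst _).smul a).add (((integrable_mulV_stdGaussian A).comp_snd μ).smul b)

lemma gaussInterp_zero (μ : Measure Ω) [IsFiniteMeasure μ] (W : Ω → EuclideanSpace ℝ (Fin d))
    (A : Matrix (Fin d) (Fin d) ℝ) (h : EuclideanSpace ℝ (Fin d) → ℝ) :
    gaussInterp μ W A h 0
      = μ.real Set.univ * ∫ z, h (mulV A z) ∂(stdGaussian (EuclideanSpace ℝ (Fin d))) := by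
  have := integral_prod_mul (μ := μ) (ν := stdGaussian (EuclideanSpace ℝ (Fin d)))
    (fun _ => (1 : ℝ)) (fun z => h (mulV A z))
  simpa [gaussInterp] using this

lemma hasDerivAt_gaussInterp {μ : Measure Ω} [IsFiniteMeasure μ] (hW : Measurable W)
    (hWi : Integrable W μ) (hL : LipschitzWith 1 h) (hG : Continuous G)
    (hG1 : ∀ x, ‖G x‖ ≤ 1) (hhG : ∀ x, HasGradientAt h (G x) x) (θ : ℝ) :
    HasDerivAt (gaussInterp μ W A h)
      (∫ p : Ω × EuclideanSpace ℝ (Fin d),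
        inner ℝ (G (Real.sin θ • W p.1 + Real.cos θ • mulV A p.2))
          (Real.cos θ • W p.1 - Real.sin θ • mulV A p.2)
          ∂(μ.prod (stdGaussian (EuclideanSpace ℝ (Fin d))))) θ := by
  have hi := fun a b => integrable_interp_point (A := A) hWi a b
  have hb : Integrable (fun p : Ω × EuclideanSpace ℝ (Fin d) => ‖W p.1‖ + ‖mulV A p.2‖)
      (μ.prod (stdGaussian (EuclideanSpace ℝ (Fin d)))) :=
    (hWi.norm.comp_fst _).add ((integrable_norm_mulV A).comp_snd μ)
  refine (hasDerivAt_integral_of_dominated_loc_of_deriv_le (s := Set.univ) Filter.univ_mem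
    (F' := fun t p => inner ℝ (G (Real.sin t • W p.1 + Real.cos t • mulV A p.2))
          (Real.cos t • W p.1 - Real.sin t • mulV A p.2))
    (Filter.Eventually.of_forall fun t => (integrable_lipschitz hL (hi _ _)).1)
    (integrable_lipschitz hL (hi _ _)) ?_ (ae_of_all _ fun p t _ => ?_) hb
    (ae_of_all _ fun p t _ => ?_)).2
  · have hGm := hG.measurable
    exact Measurable.aestronglyMeasurable (by fun_prop)
  · refine (norm_inner_le_norm _ _).trans ((mul_le_of_le_one_left (norm_nonneg _) (hG1 _)).trans ?_)
    refine (norm_sub_le _ _).trans ?_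
    rw [norm_smul, norm_smul]
    exact add_le_add (mul_le_of_le_one_left (norm_nonneg _) (Real.abs_cos_le_one _))
      (mul_le_of_le_one_left (norm_nonneg _) (Real.abs_sin_le_one _))
  · have h1 : HasDerivAt (fun t => Real.sin t • W p.1 + Real.cos t • mulV A p.2)
        (Real.cos t • W p.1 - Real.sin t • mulV A p.2) t := by
      refine (((Real.hasDerivAt_sin t).smul_const (W p.1)).add
        ((Real.hasDerivAt_cos t).smul_const (mulV A p.2))).congr_deriv ?_
      rw [neg_smul, sub_eq_add_neg]
    have h2 := (hhG (Real.sin t • W p.1 + Real.cos t • mulV A p.2)).hasFDerivAt.comp_hasDerivAt t h1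
    exact h2.congr_deriv (InnerProductSpace.toDual_apply_apply ..)

/-- The derivative of the interpolation is a Stein functional of the smoothed gradient. -/
lemma deriv_gaussInterp_eq {μ : Measure Ω} [IsFiniteMeasure μ] (hW : Measurable W)
    (hWi : Integrable W μ) (hG : Continuous G) (hG1 : ∀ x, ‖G x‖ ≤ 1) (hSB : S * B = A) {θ : ℝ}
    (hc : Real.cos θ ≠ 0) :
    ∫ p : Ω × EuclideanSpace ℝ (Fin d),
        inner ℝ (G (Real.sin θ • W p.1 + Real.cos θ • mulV A p.2))
          (Real.cos θ • W p.1 - Real.sin θ • mulV A p.2)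
          ∂(μ.prod (stdGaussian (EuclideanSpace ℝ (Fin d))))
      = Real.cos θ * ∫ ω, (inner ℝ (W ω) (smoothGrad G A θ (W ω))
          - ((smoothHess G A B θ (W ω)).transpose * S).trace) ∂μ := by
  have hGm := hG.measurable
  have hb : Integrable (fun p : Ω × EuclideanSpace ℝ (Fin d) => ‖W p.1‖ + ‖mulV A p.2‖)
      (μ.prod (stdGaussian (EuclideanSpace ℝ (Fin d)))) :=
    (hWi.norm.comp_fst _).add ((integrable_norm_mulV A).comp_snd μ)
  rw [integral_prod, ← integral_const_mul]
  · congr 1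
    ext ω
    have i1 : Integrable (fun z => inner ℝ (W ω)
        (G (Real.sin θ • W ω + Real.cos θ • mulV A z)))
        (stdGaussian (EuclideanSpace ℝ (Fin d))) :=
      (integrable_of_bounded_by_one A θ hG hG1 (W ω)).const_inner (W ω)
    have i2 : Integrable (fun z => inner ℝ (G (Real.sin θ • W ω + Real.cos θ • mulV A z))
        (mulV A z)) (stdGaussian (EuclideanSpace ℝ (Fin d))) :=
      (integrable_norm_mulV A).mono' (Measurable.aestronglyMeasurable (by fun_prop))
        (ae_of_all _ fun z => (norm_inner_le_norm _ _).trans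
          (mul_le_of_le_one_left (norm_nonneg _) (hG1 _)))
    have e : ∀ z, inner ℝ (G (Real.sin θ • W ω + Real.cos θ • mulV A z))
          (Real.cos θ • W ω - Real.sin θ • mulV A z)
        = Real.cos θ * inner ℝ (W ω) (G (Real.sin θ • W ω + Real.cos θ • mulV A z))
          - Real.sin θ * inner ℝ (G (Real.sin θ • W ω + Real.cos θ • mulV A z)) (mulV A z) := by
      intro z
      rw [inner_sub_right, real_inner_smul_right, real_inner_smul_right, real_inner_comm (W ω)]
    simp_rw [e]
    rw [integral_sub (i1.const_mul _) (i2.const_mul _), integral_const_mul, integral_const_mul,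
      inner_smoothGrad A θ hG hG1, trace_smoothHess A B θ hG hG1, hSB, mul_sub, ← mul_assoc,
      mul_comm (Real.cos θ) (Real.tan θ), Real.tan_mul_cos hc]
  · refine hb.mono' (Measurable.aestronglyMeasurable (by fun_prop)) (ae_of_all _ fun p => ?_)
    refine (norm_inner_le_norm _ _).trans ((mul_le_of_le_one_left (norm_nonneg _) (hG1 _)).trans ?_)
    refine (norm_sub_le _ _).trans ?_
    rw [norm_smul, norm_smul]
    exact add_le_add (mul_le_of_le_one_left (norm_nonneg _) (Real.abs_cos_le_one _))
      (mul_le_of_le_one_left (norm_nonneg _) (Real.abs_sin_le_one _))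

lemma integral_norm_smul_sub_sq (a b : ℝ) (w : EuclideanSpace ℝ (Fin d)) :
    ∫ z, ‖a • w - b • mulV A z‖ ^ 2 ∂(stdGaussian (EuclideanSpace ℝ (Fin d)))
      = a ^ 2 * ‖w‖ ^ 2 + b ^ 2 * hsNorm A ^ 2 := by
  have e : ∀ z, ‖a • w - b • mulV A z‖ ^ 2
      = a ^ 2 * ‖w‖ ^ 2 - 2 * a * b * inner ℝ w (mulV A z) + b ^ 2 * ‖mulV A z‖ ^ 2 := by
    intro z
    rw [norm_sub_sq_real, norm_smul, norm_smul, mul_pow, mul_pow, real_inner_smul_left,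
      real_inner_smul_right, Real.norm_eq_abs, Real.norm_eq_abs, sq_abs, sq_abs]
    ring
  have h0 : ∫ z, inner ℝ w (mulV A z) ∂(stdGaussian (EuclideanSpace ℝ (Fin d))) = 0 := by
    simp_rw [inner_mulV_right]
    exact integral_strongDual_stdGaussian (innerSL ℝ (mulV A.transpose w))
  have i1 : Integrable (fun z => inner ℝ w (mulV A z))
      (stdGaussian (EuclideanSpace ℝ (Fin d))) := (integrable_mulV_stdGaussian A).const_inner w
  simp_rw [e]
  have hadd := integral_add ((integrable_const (a ^ 2 * ‖w‖ ^ 2)).sub (i1.const_mul (2 * a * b)))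
    ((integrable_norm_mulV_sq A).const_mul (b ^ 2))
  simp only [Pi.sub_apply] at hadd
  rw [hadd, integral_sub (integrable_const _) (i1.const_mul _),
    integral_const_mul (2 * a * b), integral_const_mul (b ^ 2), h0, integral_norm_mulV_sq]
  simp

lemma integrable_norm_smul_sub (a b : ℝ) (w : EuclideanSpace ℝ (Fin d)) :
    Integrable (fun z => a • w - b • mulV A z) (stdGaussian (EuclideanSpace ℝ (Fin d))) :=
  (integrable_const _).sub ((integrable_mulV_stdGaussian A).smul b)

lemma integral_norm_smul_sub_le (a b : ℝ) (w : EuclideanSpace ℝ (Fin d)) :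
    ∫ z, ‖a • w - b • mulV A z‖ ∂(stdGaussian (EuclideanSpace ℝ (Fin d)))
      ≤ Real.sqrt (a ^ 2 * ‖w‖ ^ 2 + b ^ 2 * hsNorm A ^ 2) := by
  refine Real.le_sqrt_of_sq_le ?_
  rw [← integral_norm_smul_sub_sq]
  refine sq_integral_le (integrable_norm_smul_sub a b w).norm ?_
  have : ∀ z, ‖a • w - b • mulV A z‖ ^ 2 ≤ 2 * ‖a • w‖ ^ 2 + 2 * b ^ 2 * ‖mulV A z‖ ^ 2 := by
    intro z
    have h1 := norm_sub_le (a • w) (b • mulV A z)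
    have h2 : ‖b • mulV A z‖ ^ 2 = b ^ 2 * ‖mulV A z‖ ^ 2 := by
      rw [norm_smul, mul_pow, Real.norm_eq_abs, sq_abs]
    nlinarith [norm_nonneg (a • w - b • mulV A z), sq_nonneg (‖a • w‖ - ‖b • mulV A z‖)]
  refine ((integrable_const (2 * ‖a • w‖ ^ 2)).add
    ((integrable_norm_mulV_sq A).const_mul (2 * b ^ 2))).mono' (by fun_prop)
    (ae_of_all _ fun z => ?_)
  rw [Real.norm_of_nonneg (by positivity)]
  exact this z

/-- Close to `θ = π / 2` the interpolation is close to the integral of `h(W)`. -/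
lemma abs_sub_gaussInterp_le {s : Set Ω} (hs : P s ≠ 0) (hW2 : MemLp W 2 P)
    (hL : LipschitzWith 1 h) {θ : ℝ} (hsin : 0 ≤ Real.sin θ) (hcos : 0 ≤ Real.cos θ) :
    |∫ ω in s, h (W ω) ∂P - gaussInterp (P.restrict s) W A h θ|
      ≤ P.real s * (Real.cos θ
        * Real.sqrt (hsNorm A ^ 2 + ∫ ω, ‖W ω‖ ^ 2 ∂P[|s])) := by
  have hWi : Integrable W P := hW2.integrable one_le_two
  have hpt : ∀ ω, |h (W ω) - ∫ z, h (Real.sin θ • W ω + Real.cos θ • mulV A z)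
        ∂(stdGaussian (EuclideanSpace ℝ (Fin d)))|
      ≤ Real.cos θ * Real.sqrt (hsNorm A ^ 2 + ‖W ω‖ ^ 2) := by
    intro ω
    have i1 : Integrable (fun z => h (Real.sin θ • W ω + Real.cos θ • mulV A z))
        (stdGaussian (EuclideanSpace ℝ (Fin d))) :=
      integrable_lipschitz hL
        ((integrable_const _).add ((integrable_mulV_stdGaussian A).smul (Real.cos θ)))
    have e1 : h (W ω) - ∫ z, h (Real.sin θ • W ω + Real.cos θ • mulV A z)
          ∂(stdGaussian (EuclideanSpace ℝ (Fin d)))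
        = ∫ z, (h (W ω) - h (Real.sin θ • W ω + Real.cos θ • mulV A z))
          ∂(stdGaussian (EuclideanSpace ℝ (Fin d))) := by
      rw [integral_sub (integrable_const _) i1]
      simp
    rw [e1, ← Real.norm_eq_abs]
    refine (norm_integral_le_of_norm_le
      (integrable_norm_smul_sub (A := A) (1 - Real.sin θ) (Real.cos θ) (W ω)).norm
      (ae_of_all _ fun z => ?_)).trans ((integral_norm_smul_sub_le _ _ _).trans ?_)
    · have := hL.dist_le_mul (W ω) (Real.sin θ • W ω + Real.cos θ • mulV A z)
      rw [NNReal.coe_one, one_mul, dist_eq_norm, dist_eq_norm] at this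
      refine this.trans_eq ?_
      rw [sub_smul, one_smul, sub_add_eq_sub_sub]
    · rw [← Real.sqrt_sq hcos, ← Real.sqrt_mul (sq_nonneg _), Real.sqrt_sq hcos]
      refine Real.sqrt_le_sqrt ?_
      have h1 : (1 - Real.sin θ) ^ 2 ≤ Real.cos θ ^ 2 := by
        nlinarith [Real.sin_sq_add_cos_sq θ, Real.sin_le_one θ]
      nlinarith [mul_le_mul_of_nonneg_right h1 (sq_nonneg ‖W ω‖)]
  have hWs : Integrable W (P.restrict s) := hWi.integrableOn
  have iprod := integrable_lipschitz hL
    (integrable_interp_point (A := A) hWs (Real.sin θ) (Real.cos θ))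
  have ih : Integrable (fun ω => h (W ω)) (P.restrict s) := integrable_lipschitz hL hWs
  have isq : Integrable (fun ω => ‖W ω‖ ^ 2) P := hW2.integrable_norm_pow two_ne_zero
  have iF2 : Integrable (fun ω => hsNorm A ^ 2 + ‖W ω‖ ^ 2) P := (integrable_const _).add isq
  have iF : Integrable (fun ω => Real.sqrt (hsNorm A ^ 2 + ‖W ω‖ ^ 2)) P := by
    refine ((integrable_const 1).add iF2).mono'
      (Real.continuous_sqrt.comp_aestronglyMeasurable iF2.1) (ae_of_all _ fun ω => ?_)
    rw [Real.norm_of_nonneg (Real.sqrt_nonneg _), Pi.add_apply]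
    have h0 : 0 ≤ hsNorm A ^ 2 + ‖W ω‖ ^ 2 := by positivity
    nlinarith [Real.sq_sqrt h0, sq_nonneg (Real.sqrt (hsNorm A ^ 2 + ‖W ω‖ ^ 2) - 1)]
  have hcond : IsProbabilityMeasure P[|s] := cond_isProbabilityMeasure hs
  have hac : ∀ {f : Ω → ℝ}, Integrable f P → Integrable f P[|s] := by
    intro f hf
    rw [ProbabilityTheory.cond]
    exact hf.integrableOn.smul_measure (ENNReal.inv_ne_top.2 hs)
  rw [gaussInterp, integral_prod _ iprod, ← integral_sub ih iprod.integral_prod_left]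
  rw [← Real.norm_eq_abs]
  refine (norm_integral_le_of_norm_le (iF.const_mul (Real.cos θ)).integrableOn
    (ae_of_all _ fun ω => hpt ω)).trans ?_
  rw [← integral_cond_mul hs, integral_const_mul]
  refine mul_le_mul_of_nonneg_left (mul_le_mul_of_nonneg_left ?_ hcos) measureReal_nonneg
  refine Real.le_sqrt_of_sq_le ((sq_integral_le (hac iF) ?_).trans_eq ?_)
  · exact (hac iF2).congr (ae_of_all _ fun ω => (Real.sq_sqrt (by positivity)).symm)
  · have : ∀ ω, Real.sqrt (hsNorm A ^ 2 + ‖W ω‖ ^ 2) ^ 2 = hsNorm A ^ 2 + ‖W ω‖ ^ 2 :=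
      fun ω => Real.sq_sqrt (by positivity)
    simp_rw [this]
    rw [integral_add (integrable_const _) (hac isq)]
    simp

end Interpolation

/-! ### The bound for differentiable test functions -/

section SmoothTestFunctions

variable {Ω : Type*} [MeasurableSpace Ω] {P : Measure Ω} [IsProbabilityMeasure P] {d : ℕ}
  {W W' : Ω → EuclideanSpace ℝ (Fin d)} {Y Y' : Ω → ℝ} {S Ψ A B : Matrix (Fin d) (Fin d) ℝ}
  {lam ζ : ℝ} {R0p R0m : Ω → ℝ} {R1p R1m : Ω → EuclideanSpace ℝ (Fin d)}
  {C2p C2m : Ω → Matrix (Fin d) (Fin d) ℝ}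
  {h : EuclideanSpace ℝ (Fin d) → ℝ} {G : EuclideanSpace ℝ (Fin d) → EuclideanSpace ℝ (Fin d)}

lemma condAt_nonneg {f : Ω → ℝ} (hf : ∀ ω, 0 ≤ f ω) (k : ℝ) : 0 ≤ condAt P Y k f :=
  integral_nonneg hf

lemma condPair_nonneg {f : Ω → ℝ} (hf : ∀ ω, 0 ≤ f ω) (k : ℝ) : 0 ≤ condPair P Y k f :=
  integral_nonneg hf

lemma ratio_nonneg (k : ℝ) : 0 ≤ ratio P Y k := div_nonneg measureReal_nonneg measureReal_nonneg

lemma AHat_nonneg (k : ℝ) : 0 ≤ AHat P Y Ψ R1p R1m k :=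
  add_nonneg (condAt_nonneg (fun _ => norm_nonneg _) _)
    (mul_nonneg (ratio_nonneg k) (condAt_nonneg (fun _ => norm_nonneg _) _))

lemma BHat_nonneg (k : ℝ) : 0 ≤ BHat P Y Ψ C2p C2m k :=
  add_nonneg (condAt_nonneg (fun _ => hsNorm_nonneg _) _)
    (mul_nonneg (ratio_nonneg k) (condAt_nonneg (fun _ => hsNorm_nonneg _) _))

/-- The conditional moment `E(|(λΨ)⁻¹ ΔW| |ΔW|ⁿ | Y ∈ {k - 1, k})`. -/
def jumpMoment (P : Measure Ω) (W W' : Ω → EuclideanSpace ℝ (Fin d)) (Y : Ω → ℝ)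
    (Ψ : Matrix (Fin d) (Fin d) ℝ) (lam k : ℝ) (n : ℕ) : ℝ :=
  condPair P Y k (fun ω => ‖mulV (lam • Ψ)⁻¹ (W' ω - W ω)‖ * ‖W' ω - W ω‖ ^ n)

lemma jumpMoment_nonneg (k : ℝ) (n : ℕ) : 0 ≤ jumpMoment P W W' Y Ψ lam k n :=
  condPair_nonneg (fun _ => by positivity) k

lemma norm_mulV_smul_inv (hlam : 0 < lam) (hΨ : IsUnit Ψ) (v : EuclideanSpace ℝ (Fin d)) :
    ‖mulV (lam • Ψ)⁻¹ v‖ = lam⁻¹ * ‖mulV Ψ⁻¹ v‖ := by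
  have h1 : (lam • Ψ)⁻¹ = lam⁻¹ • Ψ⁻¹ := by
    refine Matrix.inv_eq_left_inv ?_
    rw [smul_mul_smul_comm, inv_mul_of_isUnit hΨ, inv_mul_cancel₀ hlam.ne', one_smul]
  rw [h1, mulV_smul_matrix, norm_smul, Real.norm_of_nonneg (inv_pos.2 hlam).le]

lemma pair_mul_jumpMoment
    (hA : CondSteinAssumptions P W W' Y Y' S Ψ lam ζ R0p R0m R1p R1m C2p C2m) {k : ℝ}
    (hk : P (Y ⁻¹' {k}) ≠ 0) (n : ℕ) :
    P.real (Y ⁻¹' {k - 1, k}) * jumpMoment P W W' Y Ψ lam k n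
      = lam⁻¹ * ∫ ω in Y ⁻¹' {k - 1, k}, ‖mulV Ψ⁻¹ (W' ω - W ω)‖ * ‖W' ω - W ω‖ ^ n ∂P := by
  rw [jumpMoment, condPair, integral_cond_mul (pair_ne_zero hk), ← integral_const_mul]
  congr 1
  ext ω
  rw [norm_mulV_smul_inv hA.lam_mem.1 hA.isUnit_Ψ]
  ring

lemma integrable_jump_pow
    (hA : CondSteinAssumptions P W W' Y Y' S Ψ lam ζ R0p R0m R1p R1m C2p C2m) (n : ℕ)
    (hp : MemLp W (n + 1 : ℕ) P) :
    Integrable (fun ω => ‖mulV Ψ⁻¹ (W' ω - W ω)‖ * ‖W' ω - W ω‖ ^ n) P := by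
  have hW := hA.measurable_W
  have hW' := hA.measurable_W'
  have h1 := (memLp_delta hA hp).integrable_norm_pow n.succ_ne_zero
  refine (h1.const_mul (opNorm Ψ⁻¹)).mono' (Measurable.aestronglyMeasurable (by fun_prop))
    (ae_of_all _ fun ω => ?_)
  rw [Real.norm_of_nonneg (by positivity), pow_succ']
  nlinarith [mul_le_mul_of_nonneg_right (norm_mulV_le Ψ⁻¹ (W' ω - W ω))
    (pow_nonneg (norm_nonneg (W' ω - W ω)) n)]

/-- The increment of the interpolation over `[0, θ₀]`, for a continuously differentiable test
function. The function `ψ` dominates the integral of `cos θ tanⁿ θ`, which arises from the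
trapezoidal error. -/
lemma abs_gaussInterp_sub_le
    (hA : CondSteinAssumptions P W W' Y Y' S Ψ lam ζ R0p R0m R1p R1m C2p C2m) {k : ℝ}
    (hk : P (Y ⁻¹' {k}) ≠ 0) (hk1 : P (Y ⁻¹' {k - 1}) ≠ 0)
    (hB : B.transpose = B) (hAB : A * B = 1) (hSB : S * B = A)
    (hL : LipschitzWith 1 h) (hG : Continuous G) (hG1 : ∀ x, ‖G x‖ ≤ 1)
    (hhG : ∀ x, HasGradientAt h (G x) x) {n : ℕ} (hn : n = 2 ∨ n = 3)
    (hp : MemLp W (n + 1 : ℕ) P) {θ₀ : ℝ} (hθ₀ : 0 ≤ θ₀) (hθ₀' : θ₀ < Real.pi / 2)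
    {ψ ψ' : ℝ → ℝ} (hψ0 : ψ 0 = 0)
    (hψ : ∀ θ, 0 ≤ θ → θ < Real.pi / 2 → HasDerivAt ψ (ψ' θ) θ)
    (hψ' : ∀ θ, 0 ≤ θ → θ < Real.pi / 2 → Real.cos θ * Real.tan θ ^ n ≤ ψ' θ) :
    |gaussInterp (P.restrict (Y ⁻¹' {k - 1, k})) W A h θ₀
        - gaussInterp (P.restrict (Y ⁻¹' {k - 1, k})) W A h 0|
      ≤ 2 * (P.real (Y ⁻¹' {k}) * AHat P Y Ψ R1p R1m k)
        + opNorm B * (P.real (Y ⁻¹' {k}) * BHat P Y Ψ C2p C2m k)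
        + P.real (Y ⁻¹' {k - 1, k}) * (opNorm B ^ n * jumpMoment P W W' Y Ψ lam k n * ψ θ₀) := by
  set s := Y ⁻¹' {k - 1, k} with hs
  set a := P.real (Y ⁻¹' {k}) * AHat P Y Ψ R1p R1m k with ha
  set b := P.real (Y ⁻¹' {k}) * BHat P Y Ψ C2p C2m k with hb
  set N := P.real s * jumpMoment P W W' Y Ψ lam k n with hN
  have ha0 : 0 ≤ a := mul_nonneg measureReal_nonneg (AHat_nonneg k)
  have hb0 : 0 ≤ b := mul_nonneg measureReal_nonneg (BHat_nonneg k)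
  have hN0 : 0 ≤ N := mul_nonneg measureReal_nonneg (jumpMoment_nonneg k n)
  have hW := hA.measurable_W
  have hWi : Integrable W (P.restrict s) := (integrable_W hA).integrableOn
  have hσ := opNorm_nonneg B
  have hcos : ∀ θ, 0 ≤ θ → θ < Real.pi / 2 → 0 < Real.cos θ := fun θ h1 h2 =>
    Real.cos_pos_of_mem_Ioo ⟨by linarith [Real.pi_pos], h2⟩
  have hder : ∀ θ, 0 ≤ θ → θ < Real.pi / 2 → HasDerivAt (gaussInterp (P.restrict s) W A h)
      (Real.cos θ * ∫ ω in s, (inner ℝ (W ω) (smoothGrad G A θ (W ω))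
          - ((smoothHess G A B θ (W ω)).transpose * S).trace) ∂P) θ := by
    intro θ h1 h2
    rw [← deriv_gaussInterp_eq hW hWi hG hG1 hSB (hcos θ h1 h2).ne']
    exact hasDerivAt_gaussInterp hW hWi hL hG hG1 hhG θ
  have hbd : ∀ θ, 0 ≤ θ → θ < Real.pi / 2 →
      |Real.cos θ * ∫ ω in s, (inner ℝ (W ω) (smoothGrad G A θ (W ω))
          - ((smoothHess G A B θ (W ω)).transpose * S).trace) ∂P|
        ≤ 2 * a * Real.cos θ + opNorm B * b * Real.sin θ + opNorm B ^ n * N * ψ' θ := by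
    intro θ h1 h2
    have hc := hcos θ h1 h2
    have ht : 0 ≤ Real.tan θ := Real.tan_nonneg_of_nonneg_of_le_pi_div_two h1 h2.le
    have hst := abs_stein_functional_le (κ := Real.tan θ * opNorm B) hA
      (measurable_smoothGrad A θ hG) (norm_smoothGrad_le A θ hG1)
      (measurable_smoothHess A B θ hG) (abs_trace_smoothHess_le A B θ hG hG1 hB ht)
      (integrable_jump_pow hA n hp) (fun ω => by positivity)
      (C := Real.tan θ ^ n * opNorm B ^ n) (by positivity)
      (fun ω => abs_trapezoidError_le A B θ hG hG1 hB hAB hc.ne' ht _ _ _ hn) hk hk1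
    rw [← pair_mul_jumpMoment hA hk, ← ha, ← hb, ← hs, ← hN] at hst
    rw [abs_mul, abs_of_pos hc]
    calc _ ≤ Real.cos θ * (2 * a + Real.tan θ * opNorm B * b
            + Real.tan θ ^ n * opNorm B ^ n * N) := mul_le_mul_of_nonneg_left hst hc.le
      _ = 2 * a * Real.cos θ + opNorm B * b * (Real.tan θ * Real.cos θ)
            + opNorm B ^ n * N * (Real.cos θ * Real.tan θ ^ n) := by ring
      _ ≤ _ := by
        rw [Real.tan_mul_cos hc.ne']
        have := mul_le_mul_of_nonneg_left (hψ' θ h1 h2)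
          (mul_nonneg (pow_nonneg hσ n) hN0)
        linarith
  have key := image_norm_le_of_norm_deriv_right_le_deriv_boundary' (a := 0) (b := θ₀)
    (f := fun θ => gaussInterp (P.restrict s) W A h θ - gaussInterp (P.restrict s) W A h 0)
    (f' := fun θ => Real.cos θ * ∫ ω in s, (inner ℝ (W ω) (smoothGrad G A θ (W ω))
          - ((smoothHess G A B θ (W ω)).transpose * S).trace) ∂P)
    (B := fun θ => 2 * a * Real.sin θ + opNorm B * b * (1 - Real.cos θ) + opNorm B ^ n * N * ψ θ)
    (B' := fun θ => 2 * a * Real.cos θ + opNorm B * b * Real.sin θ + opNorm B ^ n * N * ψ' θ)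
    (fun θ hθ => ((hder θ hθ.1 (hθ.2.trans_lt hθ₀')).sub_const _).continuousAt.continuousWithinAt)
    (fun θ hθ => ((hder θ hθ.1 (hθ.2.trans hθ₀')).sub_const _).hasDerivWithinAt)
    (by simp [hψ0])
    (fun θ hθ => ContinuousAt.continuousWithinAt (by
      have := (hψ θ hθ.1 (hθ.2.trans_lt hθ₀')).continuousAt
      fun_prop))
    (fun θ hθ => HasDerivAt.hasDerivWithinAt (by
      have h1 := (((Real.hasDerivAt_sin θ).const_mul (2 * a)).add
        (((Real.hasDerivAt_cos θ).const_sub 1).const_mul (opNorm B * b))).add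
        ((hψ θ hθ.1 (hθ.2.trans hθ₀')).const_mul (opNorm B ^ n * N))
      rw [neg_neg] at h1
      exact h1))
    (fun θ hθ => hbd θ hθ.1 (hθ.2.trans hθ₀')) (x := θ₀) ⟨hθ₀, le_rfl⟩
  rw [Real.norm_eq_abs] at key
  refine key.trans ?_
  have h1 : 2 * a * Real.sin θ₀ ≤ 2 * a :=
    mul_le_of_le_one_right (by positivity) (Real.sin_le_one _)
  have h2 : opNorm B * b * (1 - Real.cos θ₀) ≤ opNorm B * b :=
    mul_le_of_le_one_right (by positivity) (by linarith [hcos θ₀ hθ₀ hθ₀'])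
  have h3 : opNorm B ^ n * N * ψ θ₀
      = P.real s * (opNorm B ^ n * jumpMoment P W W' Y Ψ lam k n * ψ θ₀) := by
    rw [hN]; ring
  linarith

lemma pair_real_eq (hY : Measurable Y) (k : ℝ) :
    P.real (Y ⁻¹' {k - 1, k}) = P.real (Y ⁻¹' {k}) + P.real (Y ⁻¹' {k - 1}) := by
  have := setIntegral_pair (P := P) hY k (integrable_const (1 : ℝ))
  simpa using this

lemma integral_condLaw (hW : Measurable W) (hL : LipschitzWith 1 h) (k : ℝ) :
    ∫ x, h x ∂(condLaw P W Y k) = ∫ ω, h (W ω) ∂P[|Y ⁻¹' {k}] :=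
  integral_map hW.aemeasurable hL.continuous.aestronglyMeasurable

lemma integral_multivariateGaussian (hAS : A = CFC.sqrt S) (hL : LipschitzWith 1 h) :
    ∫ x, h x ∂(multivariateGaussian 0 S)
      = ∫ z, h (mulV A z) ∂(stdGaussian (EuclideanSpace ℝ (Fin d))) := by
  rw [multivariateGaussian, integral_map (by fun_prop) hL.continuous.aestronglyMeasurable, hAS]
  simp only [zero_add]
  rfl

/-- The bound for continuously differentiable Lipschitz test functions, with a free
regularisation parameter `θ₀`. -/
lemma abs_integral_sub_le_of_gradient
    (hA : CondSteinAssumptions P W W' Y Y' S Ψ lam ζ R0p R0m R1p R1m C2p C2m) {k : ℝ}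
    (hk : P (Y ⁻¹' {k}) ≠ 0) (hk1 : P (Y ⁻¹' {k - 1}) ≠ 0)
    (hAS : A = CFC.sqrt S)
    (hB : B.transpose = B) (hAB : A * B = 1) (hSB : S * B = A) (hAtr : hsNorm A ^ 2 = S.trace)
    (hL : LipschitzWith 1 h) (hG : Continuous G) (hG1 : ∀ x, ‖G x‖ ≤ 1)
    (hhG : ∀ x, HasGradientAt h (G x) x) {n : ℕ} (hn : n = 2 ∨ n = 3)
    (hp : MemLp W (n + 1 : ℕ) P) {θ₀ : ℝ} (hθ₀ : 0 ≤ θ₀) (hθ₀' : θ₀ < Real.pi / 2)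
    {ψ ψ' : ℝ → ℝ} (hψ0 : ψ 0 = 0)
    (hψ : ∀ θ, 0 ≤ θ → θ < Real.pi / 2 → HasDerivAt ψ (ψ' θ) θ)
    (hψ' : ∀ θ, 0 ≤ θ → θ < Real.pi / 2 → Real.cos θ * Real.tan θ ^ n ≤ ψ' θ) :
    |∫ x, h x ∂(condLaw P W Y k) - ∫ x, h x ∂(multivariateGaussian 0 S)|
      ≤ AHat P Y Ψ R1p R1m k + 1 / 2 * opNorm B * BHat P Y Ψ C2p C2m k
        + (1 + ratio P Y k) / (2 * QVal P Y lam)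
          * (CHat P W Y S R0p R0m k + DHat P W W' Y k)
        + (1 + ratio P Y k) * (1 / 2 * (Real.cos θ₀ * FHat P W Y S k
          + opNorm B ^ n * jumpMoment P W W' Y Ψ lam k n * ψ θ₀)) := by
  have hW := hA.measurable_W
  have hY := hA.measurable_Y
  have hQ := QVal_pos hA hk hk1
  have hWi := integrable_W hA
  rw [integral_condLaw hW hL, integral_multivariateGaussian hAS hL]
  set m := ∫ z, h (mulV A z) ∂(stdGaussian (EuclideanSpace ℝ (Fin d))) with hm
  have ihA : Integrable (fun z => h (mulV A z)) (stdGaussian (EuclideanSpace ℝ (Fin d))) :=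
    integrable_lipschitz hL (integrable_mulV_stdGaussian A)
  have ihW : Integrable (fun ω => h (W ω)) P := integrable_lipschitz hL hWi
  have hp0 : P.real (Y ⁻¹' {k}) ≠ 0 := by
    rw [Measure.real, ENNReal.toReal_ne_zero]
    exact ⟨hk, measure_ne_top _ _⟩
  have hppos : 0 < P.real (Y ⁻¹' {k}) := lt_of_le_of_ne measureReal_nonneg hp0.symm
  have hpair := pair_real_eq (P := P) hY k
  have hr : P.real (Y ⁻¹' {k - 1, k}) = P.real (Y ⁻¹' {k}) * (1 + ratio P Y k) := by
    rw [hpair, ratio]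
    field_simp
  have e1 := integral_cond_mul hk (fun ω => h (W ω))
  -- Smoothing error and interpolation error on `{k - 1, k}`.
  have s1 := abs_sub_gaussInterp_le (A := A) (pair_ne_zero hk) hA.memLp_W hL
    (Real.sin_nonneg_of_nonneg_of_le_pi hθ₀ (by linarith [Real.pi_pos]))
    (Real.cos_nonneg_of_neg_pi_div_two_le_of_le (by linarith [Real.pi_pos]) hθ₀'.le)
  have s2 := abs_gaussInterp_sub_le hA hk hk1 hB hAB hSB hL hG hG1 hhG hn hp hθ₀ hθ₀' hψ0 hψ hψ'
  rw [gaussInterp_zero, measureReal_restrict_apply_univ, ← hm] at s2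
  rw [hAtr] at s1
  change _ ≤ P.real (Y ⁻¹' {k - 1, k}) * (Real.cos θ₀ * FHat P W Y S k) at s1
  -- The comparison of the two levels, for the centred test function.
  have hηL : LipschitzWith 1 (fun x => h x - m) := by
    refine LipschitzWith.of_dist_le_mul fun x y => ?_
    rw [dist_sub_right]
    exact hL.dist_le_mul x y
  have hηb : ∀ w, |h w - m| ≤ ‖w‖ + Real.sqrt S.trace := by
    intro w
    have e : h w - m = ∫ z, (h w - h (mulV A z)) ∂(stdGaussian (EuclideanSpace ℝ (Fin d))) := by
      rw [integral_sub (integrable_const _) ihA]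
      simp [hm]
    have hnA : Real.sqrt S.trace = hsNorm A := by rw [← hAtr, Real.sqrt_sq (hsNorm_nonneg A)]
    rw [e, ← Real.norm_eq_abs, hnA]
    have hi := (integrable_const ‖w‖).add (integrable_norm_mulV A)
    refine (norm_integral_le_of_norm_le hi (ae_of_all _ fun z => ?_)).trans ?_
    · have := hL.dist_le_mul w (mulV A z)
      rw [NNReal.coe_one, one_mul, dist_eq_norm, dist_eq_norm] at this
      exact this.trans (norm_sub_le _ _)
    · simp only [Pi.add_apply]
      rw [integral_add (integrable_const _) (integrable_norm_mulV A)]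
      simpa using integral_norm_mulV_le A
  have s3 := abs_level_sub_le hA hk hk1 hηL hηb
  have hlev : ∀ y, ∫ ω in Y ⁻¹' {y}, (h (W ω) - m) ∂P
      = ∫ ω in Y ⁻¹' {y}, h (W ω) ∂P - P.real (Y ⁻¹' {y}) * m := by
    intro y
    rw [integral_sub ihW.integrableOn (integrable_const _)]
    simp
  rw [hlev, hlev] at s3
  rw [setIntegral_pair hY k ihW] at s1
  have hX : P.real (Y ⁻¹' {k}) * (∫ ω, h (W ω) ∂P[|Y ⁻¹' {k}] - m)
      = ∫ ω in Y ⁻¹' {k}, h (W ω) ∂P - P.real (Y ⁻¹' {k}) * m := by rw [mul_sub, e1]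
  have hfin : |P.real (Y ⁻¹' {k}) * (∫ ω, h (W ω) ∂P[|Y ⁻¹' {k}] - m)|
      ≤ P.real (Y ⁻¹' {k}) * (AHat P Y Ψ R1p R1m k + 1 / 2 * opNorm B * BHat P Y Ψ C2p C2m k
        + (1 + ratio P Y k) / (2 * QVal P Y lam)
          * (CHat P W Y S R0p R0m k + DHat P W W' Y k)
        + (1 + ratio P Y k) * (1 / 2 * (Real.cos θ₀ * FHat P W Y S k
          + opNorm B ^ n * jumpMoment P W W' Y Ψ lam k n * ψ θ₀))) := by
    rw [hX]
    have hQ' : P.real (Y ⁻¹' {k - 1, k}) / QVal P Y lam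
          * (CHat P W Y S R0p R0m k + DHat P W W' Y k)
        = 2 * (P.real (Y ⁻¹' {k}) * ((1 + ratio P Y k) / (2 * QVal P Y lam)
          * (CHat P W Y S R0p R0m k + DHat P W W' Y k))) := by
      rw [hr]
      field_simp
    rw [hQ'] at s3
    rw [hr] at s1 s2
    have hr' := hr
    rw [hpair] at hr'
    have hrm : P.real (Y ⁻¹' {k}) * (1 + ratio P Y k) * m
        = P.real (Y ⁻¹' {k}) * m + P.real (Y ⁻¹' {k - 1}) * m := by rw [← hr']; ring
    rw [hrm] at s2
    rw [abs_le] at s1 s2 s3 ⊢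
    constructor <;> linarith [s1.1, s1.2, s2.1, s2.2, s3.1, s3.2]
  rw [abs_mul, abs_of_pos hppos] at hfin
  exact le_of_mul_le_mul_left hfin hppos

end SmoothTestFunctions

/-! ### From differentiable to Lipschitz test functions -/

section LipschitzTestFunctions

/-- A `1`-Lipschitz function is a uniform limit of continuously differentiable `1`-Lipschitz
functions, namely of its convolutions with smooth bump functions. -/
lemma exists_smooth_lipschitz_approx {d : ℕ} {h : EuclideanSpace ℝ (Fin d) → ℝ}
    (hL : LipschitzWith 1 h) {ε : ℝ} (hε : 0 < ε) :
    ∃ g : EuclideanSpace ℝ (Fin d) → ℝ, LipschitzWith 1 g ∧ ContDiff ℝ 1 g ∧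
      ∀ x, |g x - h x| ≤ ε := by
  let φ : ContDiffBump (0 : EuclideanSpace ℝ (Fin d)) := ⟨ε / 2, ε, by positivity, by linarith⟩
  set f := φ.normed (volume : Measure (EuclideanSpace ℝ (Fin d))) with hf
  have hfc : Continuous f := φ.continuous_normed
  have hfs : HasCompactSupport f := φ.hasCompactSupport_normed
  have hint : ∀ x, Integrable (fun t => f t * h (x - t)) := fun x =>
    (hfc.mul (hL.continuous.comp (continuous_const.sub continuous_id))).integrable_of_hasCompactSupport
      hfs.mul_right
  refine ⟨convolution f h (ContinuousLinearMap.lsmul ℝ ℝ) volume, ?_, ?_, fun x => ?_⟩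
  · refine LipschitzWith.of_dist_le_mul fun x y => ?_
    have h1 : ∫ t, f t = 1 := φ.integral_normed
    simp only [convolution, ContinuousLinearMap.lsmul_apply, smul_eq_mul, NNReal.coe_one, one_mul]
    rw [dist_eq_norm, ← integral_sub (hint x) (hint y)]
    calc ‖∫ t, (f t * h (x - t) - f t * h (y - t))‖ ≤ ∫ t, f t * dist x y := by
          refine norm_integral_le_of_norm_le
            ((hfc.integrable_of_hasCompactSupport hfs).mul_const _)
            (Filter.Eventually.of_forall fun t => ?_)
          have h2 := hL.dist_le_mul (x - t) (y - t)
          rw [← mul_sub, norm_mul, Real.norm_of_nonneg (φ.nonneg_normed t), ← dist_eq_norm]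
          refine mul_le_mul_of_nonneg_left ?_ (φ.nonneg_normed t)
          simpa using h2
      _ = dist x y := by rw [integral_mul_const, h1, one_mul]
  · exact_mod_cast hfs.contDiff_convolution_left (n := 1) (ContinuousLinearMap.lsmul ℝ ℝ)
      φ.contDiff_normed hL.continuous.locallyIntegrable
  · rw [← Real.dist_eq]
    refine φ.dist_normed_convolution_le hL.continuous.aestronglyMeasurable fun y hy => ?_
    have h2 := hL.dist_le_mul y x
    rw [NNReal.coe_one, one_mul] at h2
    exact h2.trans (Metric.mem_ball.1 hy).le

variable {Ω : Type*} [MeasurableSpace Ω] {P : Measure Ω} [IsProbabilityMeasure P] {d : ℕ}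
  {W W' : Ω → EuclideanSpace ℝ (Fin d)} {Y Y' : Ω → ℝ} {S Ψ A B : Matrix (Fin d) (Fin d) ℝ}
  {lam ζ : ℝ} {R0p R0m : Ω → ℝ} {R1p R1m : Ω → EuclideanSpace ℝ (Fin d)}
  {C2p C2m : Ω → Matrix (Fin d) (Fin d) ℝ}
  {h : EuclideanSpace ℝ (Fin d) → ℝ}

lemma abs_integral_sub_integral_le {μ : Measure (EuclideanSpace ℝ (Fin d))}
    [IsProbabilityMeasure μ] (hμ : Integrable (fun x => x) μ)
    {g : EuclideanSpace ℝ (Fin d) → ℝ} (hL : LipschitzWith 1 h) (hg : LipschitzWith 1 g) {ε : ℝ}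
    (hgh : ∀ x, |g x - h x| ≤ ε) : |∫ x, g x ∂μ - ∫ x, h x ∂μ| ≤ ε := by
  rw [← integral_sub (integrable_lipschitz hg hμ) (integrable_lipschitz hL hμ)]
  have := norm_integral_le_of_norm_le (f := fun x => g x - h x) (μ := μ) (integrable_const ε)
    (Filter.Eventually.of_forall fun x => hgh x)
  simpa using this

/-- A bound for differentiable `1`-Lipschitz test functions holds for all of them. -/
lemma abs_integral_sub_le_of_smooth {μ ν : Measure (EuclideanSpace ℝ (Fin d))}
    [IsProbabilityMeasure μ] [IsProbabilityMeasure ν] (hμ : Integrable (fun x => x) μ)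
    (hν : Integrable (fun x => x) ν) {c : ℝ}
    (hc : ∀ (g : EuclideanSpace ℝ (Fin d) → ℝ)
      (G : EuclideanSpace ℝ (Fin d) → EuclideanSpace ℝ (Fin d)), LipschitzWith 1 g → Continuous G →
      (∀ x, ‖G x‖ ≤ 1) → (∀ x, HasGradientAt g (G x) x) → |∫ x, g x ∂μ - ∫ x, g x ∂ν| ≤ c)
    (hL : LipschitzWith 1 h) : |∫ x, h x ∂μ - ∫ x, h x ∂ν| ≤ c := by
  refine le_of_forall_pos_le_add fun ε hε => ?_
  obtain ⟨g, hg, hgd, hgh⟩ := exists_smooth_lipschitz_approx hL (half_pos hε)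
  have h1 := hc g (gradient g) hg
    ((InnerProductSpace.toDual ℝ _).symm.continuous.comp (hgd.continuous_fderiv one_ne_zero))
    (fun x => by
      rw [gradient, LinearIsometryEquiv.norm_map]
      exact_mod_cast norm_fderiv_le_of_lipschitz ℝ hg)
    (fun x => ((hgd.differentiable one_ne_zero) x).hasGradientAt)
  have h2 := abs_le.1 (abs_integral_sub_integral_le hμ hL hg hgh)
  have h3 := abs_le.1 (abs_integral_sub_integral_le hν hL hg hgh)
  have h4 := abs_le.1 h1
  exact abs_le.2 ⟨by linarith, by linarith⟩

lemma isProbabilityMeasure_condLaw (hW : Measurable W) {k : ℝ} (hk : P (Y ⁻¹' {k}) ≠ 0) :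
    IsProbabilityMeasure (condLaw P W Y k) := by
  have := cond_isProbabilityMeasure hk
  exact Measure.isProbabilityMeasure_map hW.aemeasurable

lemma integrable_id_condLaw (hW : Measurable W) (hWi : Integrable W P) {k : ℝ}
    (hk : P (Y ⁻¹' {k}) ≠ 0) : Integrable (fun x => x) (condLaw P W Y k) := by
  rw [condLaw, integrable_map_measure (by fun_prop) hW.aemeasurable]
  exact (hWi.mono_measure Measure.restrict_le_self).smul_measure (ENNReal.inv_ne_top.2 hk)

end LipschitzTestFunctions

/-! ### The covariance matrix and its square root -/

section CovarianceMatrix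

variable {Ω : Type*} [MeasurableSpace Ω] {P : Measure Ω} [IsProbabilityMeasure P] {d : ℕ}
  {W : Ω → EuclideanSpace ℝ (Fin d)} {S : Matrix (Fin d) (Fin d) ℝ}

/-- The quadratic form of the covariance matrix is the variance of `∑ i, x i * W i`. -/
lemma posSemidef_of_cov (hW : MemLp W 2 P)
    (hS : ∀ i j, cov[fun ω => W ω i, fun ω => W ω j; P] = S i j) : S.PosSemidef := by
  refine Matrix.PosSemidef.of_dotProduct_mulVec_nonneg ?_ fun x => ?_
  · ext i j
    simp only [Matrix.conjTranspose_apply, star_trivial]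
    rw [← hS, ← hS, covariance_comm]
  · have h1 := variance_nonneg (∑ i, fun ω => x i * W ω i) P
    rw [variance_sum (fun i => (memLp_coord hW i).const_mul _)] at h1
    refine h1.trans (le_of_eq ?_)
    simp only [covariance_const_mul_left, covariance_const_mul_right, hS, dotProduct,
      Matrix.mulVec, star_trivial, Finset.mul_sum]
    refine Finset.sum_congr rfl fun i _ => Finset.sum_congr rfl fun j _ => by ring

lemma transpose_sqrt (S : Matrix (Fin d) (Fin d) ℝ) : (CFC.sqrt S).transpose = CFC.sqrt S := by
  have h1 := (Matrix.nonneg_iff_posSemidef.1 (CFC.sqrt_nonneg S)).isHermitian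
  rwa [Matrix.IsHermitian, Matrix.conjTranspose_eq_transpose_of_trivial] at h1

lemma transpose_invSqrt (S : Matrix (Fin d) (Fin d) ℝ) : (invSqrt S).transpose = invSqrt S := by
  rw [invSqrt, Matrix.transpose_nonsing_inv, transpose_sqrt]

lemma sqrt_mul_sqrt (hS : S.PosSemidef) : CFC.sqrt S * CFC.sqrt S = S :=
  CFC.sqrt_mul_sqrt_self S (Matrix.nonneg_iff_posSemidef.2 hS)

lemma sqrt_mul_invSqrt (hS : S.PosSemidef) (hu : IsUnit S) : CFC.sqrt S * invSqrt S = 1 := by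
  refine Matrix.mul_nonsing_inv _ ?_
  rw [Matrix.isUnit_iff_isUnit_det, ← sqrt_mul_sqrt hS, Matrix.det_mul] at hu
  exact isUnit_of_mul_isUnit_left hu

lemma mul_invSqrt (hS : S.PosSemidef) (hu : IsUnit S) : S * invSqrt S = CFC.sqrt S := by
  calc S * invSqrt S = CFC.sqrt S * CFC.sqrt S * invSqrt S := by rw [sqrt_mul_sqrt hS]
    _ = CFC.sqrt S := by rw [mul_assoc, sqrt_mul_invSqrt hS hu, mul_one]

lemma hsNorm_sqrt_sq (hS : S.PosSemidef) : hsNorm (CFC.sqrt S) ^ 2 = S.trace := by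
  rw [hsNorm, transpose_sqrt, sqrt_mul_sqrt hS, Real.sq_sqrt hS.trace_nonneg]

lemma invSqrt_one : invSqrt (1 : Matrix (Fin d) (Fin d) ℝ) = 1 := by
  rw [invSqrt, CFC.sqrt_one, inv_one]

lemma opNorm_one_le : opNorm (1 : Matrix (Fin d) (Fin d) ℝ) ≤ 1 := by
  rw [opNorm, map_one]
  exact ContinuousLinearMap.norm_id_le

end CovarianceMatrix

/-! ### Numerical constants -/

section Constants

lemma cTwo_lt_one : cTwo < 1 := by
  have hpi := Real.pi_gt_d2
  have he := Real.exp_one_gt_d9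
  rw [cTwo, div_lt_one (by positivity), Real.lt_sqrt (by norm_num)]
  nlinarith

lemma half_le_cTwo : 1 / 2 ≤ cTwo := by
  have hpi := Real.pi_lt_d2
  have he := Real.exp_one_lt_d9
  have h1 : Real.sqrt (2 * Real.pi * Real.exp 1) ≤ 8 := by
    rw [Real.sqrt_le_iff]
    refine ⟨by norm_num, ?_⟩
    nlinarith [Real.pi_pos, Real.exp_pos 1]
  rw [cTwo, le_div_iff₀ (by positivity)]
  linarith

lemma cThree_lt_two : cThree < 2 := by
  have hpi := Real.pi_gt_d2
  have he := Real.exp_one_gt_d9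
  have h1 : 5 / 2 < Real.sqrt (2 * Real.pi) := by
    rw [Real.lt_sqrt (by norm_num)]
    linarith
  have h2 : Real.exp (-(3 / 2)) ≤ (Real.exp 1)⁻¹ := by
    rw [← Real.exp_neg]
    exact Real.exp_le_exp.2 (by norm_num)
  have h3 : (Real.exp 1)⁻¹ < 3 / 8 := by
    rw [inv_lt_comm₀ (Real.exp_pos 1) (by norm_num)]
    linarith
  rw [cThree, div_lt_iff₀ (by positivity)]
  linarith

lemma one_le_cThree : 1 ≤ cThree := by
  have hpi := Real.pi_lt_d2
  have he := Real.exp_one_lt_d9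
  have h1 : Real.sqrt (2 * Real.pi) ≤ 3 := by
    rw [Real.sqrt_le_iff]
    exact ⟨by norm_num, by linarith⟩
  have h2 : (Real.exp 1 * Real.exp 1)⁻¹ ≤ Real.exp (-(3 / 2)) := by
    rw [← Real.exp_add, ← Real.exp_neg]
    exact Real.exp_le_exp.2 (by norm_num)
  have h3 : 1 / 8 ≤ (Real.exp 1 * Real.exp 1)⁻¹ := by
    rw [one_div]
    refine inv_anti₀ (by positivity) ?_
    nlinarith [Real.exp_pos 1]
  rw [cThree, le_div_iff₀ (by positivity)]
  linarith

end Constants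

/-! ### Choice of the regularisation angle -/

section Optimisation

variable {T F G : ℝ}

/-- The limit `x → 0`, which covers the case of no trapezoidal error. -/
lemma nonpos_of_forall_le_mul (hF : 0 < F)
    (h : ∀ x, 0 < x → x ≤ 1 → T ≤ 1 / 2 * (x * F)) : T ≤ 0 := by
  by_contra! hT
  have h1 := h (min 1 (T / F)) (lt_min one_pos (div_pos hT hF)) (min_le_left _ _)
  have h2 : min 1 (T / F) * F ≤ T := by
    calc min 1 (T / F) * F ≤ T / F * F := by gcongr; exact min_le_right _ _
      _ = T := by field_simp
  linarith

/-- Minimisation over `x` of the smoothing error `x F` against the trapezoidal error `G (1 / x - 1)`,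
which is what `sin / cos ^ 2` integrates to up to the angle `arccos x`. -/
lemma le_sqrt_of_forall_inv (hF : 0 ≤ F) (hG : 0 ≤ G) (hFG : F = 0 → G = 0)
    (h : ∀ x, 0 < x → x ≤ 1 → T ≤ 1 / 2 * (x * F + G * (x⁻¹ - 1))) : T ≤ Real.sqrt (G * F) := by
  rcases hF.eq_or_lt with h0 | hF
  · have h1 := h 1 one_pos le_rfl
    rw [hFG h0.symm, ← h0] at h1
    simpa [← h0] using h1
  rcases hG.eq_or_lt with h0 | hG
  · subst h0
    simpa using nonpos_of_forall_le_mul hF (by simpa using h)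
  -- The two terms `x F` and `G / x` balance at `x = √(G / F)`, which is admissible if `G ≤ F`.
  have hGF : Real.sqrt (G * F) = Real.sqrt G * Real.sqrt F := Real.sqrt_mul hG.le F
  have hg := Real.sqrt_pos.2 hG
  have hf := Real.sqrt_pos.2 hF
  have hg2 := Real.mul_self_sqrt hG.le
  have hf2 := Real.mul_self_sqrt hF.le
  rcases le_total G F with hle | hle
  · have h1 := h (Real.sqrt G / Real.sqrt F) (div_pos hg hf)
      ((div_le_one hf).2 (Real.sqrt_le_sqrt hle))
    have e1 : Real.sqrt G / Real.sqrt F * F = Real.sqrt G * Real.sqrt F := by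
      nth_rewrite 2 [← hf2]
      field_simp
    have e2 : G * ((Real.sqrt G / Real.sqrt F)⁻¹ - 1) = Real.sqrt G * Real.sqrt F - G := by
      rw [mul_sub, mul_one, inv_div]
      nth_rewrite 1 [← hg2]
      field_simp
    rw [e1, e2] at h1
    rw [hGF]
    linarith
  · have h1 := h 1 one_pos le_rfl
    have h2 : F ≤ Real.sqrt (G * F) := Real.le_sqrt_of_sq_le (by nlinarith)
    norm_num at h1
    linarith

/-- The counterpart of `le_sqrt_of_forall_inv` for the trapezoidal error `G * -log x`, which is what
`sin / cos` integrates to. -/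
lemma le_log_of_forall {c : ℝ} (hc : 1 / 2 ≤ c) (hF : 0 ≤ F) (hG : 0 ≤ G) (hFG : F = 0 → G = 0)
    (h : ∀ x, 0 < x → x ≤ 1 → T ≤ 1 / 2 * (x * F + G * -Real.log x)) :
    T ≤ c * G * (1 + |Real.log (c * (G / F))|) := by
  rcases hF.eq_or_lt with h0 | hF
  · have h1 := h 1 one_pos le_rfl
    rw [hFG h0.symm, ← h0] at h1
    rw [hFG h0.symm]
    simpa using h1
  rcases hG.eq_or_lt with h0 | hG
  · subst h0
    simpa using nonpos_of_forall_le_mul hF (by simpa using h)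
  -- `x = c * (G / F)` is used when it is at most `1`; otherwise `x = 1` is good enough.
  have hu : 0 < c * (G / F) := mul_pos (by linarith) (div_pos hG hF)
  have huF : c * (G / F) * F = c * G := by field_simp
  rcases le_total (c * (G / F)) 1 with hle | hle
  · have h1 := h _ hu hle
    rw [huF, ← abs_of_nonpos (Real.log_nonpos hu.le hle)] at h1
    have h2 : 0 ≤ G * |Real.log (c * (G / F))| := mul_nonneg hG.le (abs_nonneg _)
    nlinarith
  · have h1 := h 1 one_pos le_rfl
    have h2 : F ≤ c * G := by nlinarith
    have h3 : 0 ≤ c * G * |Real.log (c * (G / F))| :=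
      mul_nonneg (by nlinarith) (abs_nonneg _)
    norm_num at h1
    linarith

end Optimisation

/-! ### The Wasserstein bounds -/

section WassersteinBounds

variable {Ω : Type*} [MeasurableSpace Ω] {P : Measure Ω} [IsProbabilityMeasure P] {d : ℕ}
  {W W' : Ω → EuclideanSpace ℝ (Fin d)} {Y Y' : Ω → ℝ} {S Ψ : Matrix (Fin d) (Fin d) ℝ}
  {lam ζ : ℝ} {R0p R0m : Ω → ℝ} {R1p R1m : Ω → EuclideanSpace ℝ (Fin d)}
  {C2p C2m : Ω → Matrix (Fin d) (Fin d) ℝ}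
  {h : EuclideanSpace ℝ (Fin d) → ℝ}

lemma hasDerivAt_inv_cos_sub_one {θ : ℝ} (h0 : 0 ≤ θ) (h1 : θ < Real.pi / 2) :
    HasDerivAt (fun θ => (Real.cos θ)⁻¹ - 1) (Real.sin θ / Real.cos θ ^ 2) θ := by
  have hc : 0 < Real.cos θ := Real.cos_pos_of_mem_Ioo ⟨by linarith [Real.pi_pos], h1⟩
  have := ((Real.hasDerivAt_cos θ).inv hc.ne').sub_const 1
  simpa using this

lemma hasDerivAt_neg_log_cos {θ : ℝ} (h0 : 0 ≤ θ) (h1 : θ < Real.pi / 2) :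
    HasDerivAt (fun θ => -Real.log (Real.cos θ)) (Real.sin θ / Real.cos θ) θ := by
  have hc : 0 < Real.cos θ := Real.cos_pos_of_mem_Ioo ⟨by linarith [Real.pi_pos], h1⟩
  have := ((Real.hasDerivAt_cos θ).log hc.ne').fun_neg
  simpa [neg_div] using this

lemma cos_mul_tan_cube_le {θ : ℝ} (h0 : 0 ≤ θ) (h1 : θ < Real.pi / 2) :
    Real.cos θ * Real.tan θ ^ 3 ≤ Real.sin θ / Real.cos θ ^ 2 := by
  have hc : 0 < Real.cos θ := Real.cos_pos_of_mem_Ioo ⟨by linarith [Real.pi_pos], h1⟩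
  have hs : 0 ≤ Real.sin θ := Real.sin_nonneg_of_nonneg_of_le_pi h0 (by linarith [Real.pi_pos])
  have e : Real.cos θ * Real.tan θ ^ 3 = Real.sin θ / Real.cos θ ^ 2 * Real.sin θ ^ 2 := by
    rw [Real.tan_eq_sin_div_cos]
    field_simp
  rw [e]
  exact mul_le_of_le_one_right (by positivity) (Real.sin_sq_le_one θ)

lemma cos_mul_tan_sq_le {θ : ℝ} (h0 : 0 ≤ θ) (h1 : θ < Real.pi / 2) :
    Real.cos θ * Real.tan θ ^ 2 ≤ Real.sin θ / Real.cos θ := by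
  have hc : 0 < Real.cos θ := Real.cos_pos_of_mem_Ioo ⟨by linarith [Real.pi_pos], h1⟩
  have hs : 0 ≤ Real.sin θ := Real.sin_nonneg_of_nonneg_of_le_pi h0 (by linarith [Real.pi_pos])
  have e : Real.cos θ * Real.tan θ ^ 2 = Real.sin θ / Real.cos θ * Real.sin θ := by
    rw [Real.tan_eq_sin_div_cos]
    field_simp
  rw [e]
  exact mul_le_of_le_one_right (by positivity) (Real.sin_le_one θ)

/-- The bound for all Lipschitz test functions, with the regularisation angle `arccos x`. -/
lemma abs_integral_sub_le
    (hA : CondSteinAssumptions P W W' Y Y' S Ψ lam ζ R0p R0m R1p R1m C2p C2m) {k : ℝ}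
    (hk : P (Y ⁻¹' {k}) ≠ 0) (hk1 : P (Y ⁻¹' {k - 1}) ≠ 0) (hL : LipschitzWith 1 h)
    {n : ℕ} (hn : n = 2 ∨ n = 3) (hp : MemLp W (n + 1 : ℕ) P)
    {ψ ψ' : ℝ → ℝ} (hψ0 : ψ 0 = 0)
    (hψ : ∀ θ, 0 ≤ θ → θ < Real.pi / 2 → HasDerivAt ψ (ψ' θ) θ)
    (hψ' : ∀ θ, 0 ≤ θ → θ < Real.pi / 2 → Real.cos θ * Real.tan θ ^ n ≤ ψ' θ)
    {x : ℝ} (hx : 0 < x) (hx1 : x ≤ 1) :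
    |∫ x, h x ∂(condLaw P W Y k) - ∫ x, h x ∂(multivariateGaussian 0 S)|
      ≤ AHat P Y Ψ R1p R1m k + 1 / 2 * opNorm (invSqrt S) * BHat P Y Ψ C2p C2m k
        + (1 + ratio P Y k) / (2 * QVal P Y lam)
          * (CHat P W Y S R0p R0m k + DHat P W W' Y k)
        + (1 + ratio P Y k) * (1 / 2 * (x * FHat P W Y S k
          + opNorm (invSqrt S) ^ n * jumpMoment P W W' Y Ψ lam k n * ψ (Real.arccos x))) := by
  have hS := posSemidef_of_cov hA.memLp_W hA.cov_W
  have hp1 := isProbabilityMeasure_condLaw hA.measurable_W hk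
  refine abs_integral_sub_le_of_smooth
    (integrable_id_condLaw hA.measurable_W (integrable_W hA) hk)
    IsGaussian.integrable_id (fun g G hg hG hG1 hgG => ?_) hL
  have := abs_integral_sub_le_of_gradient hA hk hk1 rfl (transpose_invSqrt S)
    (sqrt_mul_invSqrt hS hA.isUnit_S) (mul_invSqrt hS hA.isUnit_S) (hsNorm_sqrt_sq hS)
    hg hG hG1 hgG hn hp (Real.arccos_nonneg x) (Real.arccos_lt_pi_div_two.2 hx) hψ0 hψ hψ'
  rwa [Real.cos_arccos (by linarith) hx1] at this

/-- `F̂ = 0` forces `d = 0`, since the covariance matrix is invertible; then all jumps vanish. -/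
lemma jumpMoment_eq_zero_of_FHat
    (hA : CondSteinAssumptions P W W' Y Y' S Ψ lam ζ R0p R0m R1p R1m C2p C2m) {k : ℝ}
    (hF : FHat P W Y S k = 0) (n : ℕ) : jumpMoment P W W' Y Ψ lam k n = 0 := by
  have hS := posSemidef_of_cov hA.memLp_W hA.cov_W
  have h1 : 0 ≤ condPair P Y k (fun ω => ‖W ω‖ ^ 2) := condPair_nonneg (fun _ => by positivity) k
  have h2 := hS.trace_nonneg
  rw [FHat, Real.sqrt_eq_zero (by positivity)] at hF
  have h3 : S = 0 := hS.trace_eq_zero_iff.1 (by linarith)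
  have hu := hA.isUnit_S
  rw [h3, isUnit_zero_iff] at hu
  have := subsingleton_of_zero_eq_one hu
  have h4 : ∀ v : EuclideanSpace ℝ (Fin d), mulV (lam • Ψ)⁻¹ v = 0 := fun v => by
    rw [Subsingleton.elim (lam • Ψ)⁻¹ 0]
    simp [mulV]
  simp [jumpMoment, condPair, h4]

lemma FHat_nonneg (k : ℝ) : 0 ≤ FHat P W Y S k := Real.sqrt_nonneg _

/-- The bound under a fourth moment, before the constant `c_3` is put in. -/
lemma abs_integral_sub_le_sqrt
    (hA : CondSteinAssumptions P W W' Y Y' S Ψ lam ζ R0p R0m R1p R1m C2p C2m) {k : ℝ}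
    (hk : P (Y ⁻¹' {k}) ≠ 0) (hk1 : P (Y ⁻¹' {k - 1}) ≠ 0) (hp : MemLp W 4 P)
    (hL : LipschitzWith 1 h) :
    |∫ x, h x ∂(condLaw P W Y k) - ∫ x, h x ∂(multivariateGaussian 0 S)|
      ≤ AHat P Y Ψ R1p R1m k + 1 / 2 * opNorm (invSqrt S) * BHat P Y Ψ C2p C2m k
        + (1 + ratio P Y k) / (2 * QVal P Y lam)
          * (CHat P W Y S R0p R0m k + DHat P W W' Y k)
        + (1 + ratio P Y k) * Real.sqrt (opNorm (invSqrt S) ^ 3 * EHat P W W' Y Ψ lam k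
            * FHat P W Y S k) := by
  have hr : 0 < 1 + ratio P Y k := by linarith [ratio_nonneg (P := P) (Y := Y) k]
  have hE : 0 ≤ EHat P W W' Y Ψ lam k := jumpMoment_nonneg (P := P) (Y := Y) k 3
  rw [← sub_le_iff_le_add', ← div_le_iff₀' hr]
  refine le_sqrt_of_forall_inv (FHat_nonneg k)
    (mul_nonneg (pow_nonneg (opNorm_nonneg _) 3) hE)
    (fun hF => ?_) (fun x hx hx1 => ?_)
  · exact mul_eq_zero_of_right _ (jumpMoment_eq_zero_of_FHat hA hF 3)
  · rw [div_le_iff₀' hr, sub_le_iff_le_add']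
    have := abs_integral_sub_le hA hk hk1 hL (n := 3) (Or.inr rfl) (by norm_num; exact hp)
      (ψ := fun θ => (Real.cos θ)⁻¹ - 1) (by simp) (fun θ h0 h1 => hasDerivAt_inv_cos_sub_one h0 h1)
      (fun θ h0 h1 => cos_mul_tan_cube_le h0 h1) hx hx1
    rw [Real.cos_arccos (by linarith) hx1] at this
    exact this

/-- The bound under a third moment. -/
lemma abs_integral_sub_le_log
    (hA : CondSteinAssumptions P W W' Y Y' S Ψ lam ζ R0p R0m R1p R1m C2p C2m) {k : ℝ}
    (hk : P (Y ⁻¹' {k}) ≠ 0) (hk1 : P (Y ⁻¹' {k - 1}) ≠ 0) (hp : MemLp W 3 P)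
    (hL : LipschitzWith 1 h) :
    |∫ x, h x ∂(condLaw P W Y k) - ∫ x, h x ∂(multivariateGaussian 0 S)|
      ≤ AHat P Y Ψ R1p R1m k + 1 / 2 * opNorm (invSqrt S) * BHat P Y Ψ C2p C2m k
        + (1 + ratio P Y k) / (2 * QVal P Y lam)
          * (CHat P W Y S R0p R0m k + DHat P W W' Y k)
        + cTwo * (1 + ratio P Y k) * opNorm (invSqrt S) ^ 2
          * EHat' P W W' Y Ψ lam k * FHat' P W W' Y S Ψ lam k := by
  have hr : 0 < 1 + ratio P Y k := by linarith [ratio_nonneg (P := P) (Y := Y) k]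
  have hE : 0 ≤ EHat' P W W' Y Ψ lam k := jumpMoment_nonneg (P := P) (Y := Y) k 2
  have e : cTwo * (1 + ratio P Y k) * opNorm (invSqrt S) ^ 2
          * EHat' P W W' Y Ψ lam k * FHat' P W W' Y S Ψ lam k
      = (1 + ratio P Y k) * (cTwo * (opNorm (invSqrt S) ^ 2 * EHat' P W W' Y Ψ lam k)
        * (1 + |Real.log (cTwo * (opNorm (invSqrt S) ^ 2 * EHat' P W W' Y Ψ lam k
          / FHat P W Y S k))|)) := by
    rw [FHat', mul_assoc cTwo (opNorm (invSqrt S) ^ 2), mul_div_assoc]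
    ring
  rw [e, ← sub_le_iff_le_add', ← div_le_iff₀' hr]
  refine le_log_of_forall half_le_cTwo (FHat_nonneg k)
    (mul_nonneg (pow_nonneg (opNorm_nonneg _) 2) hE)
    (fun hF => ?_) (fun x hx hx1 => ?_)
  · exact mul_eq_zero_of_right _ (jumpMoment_eq_zero_of_FHat hA hF 2)
  · rw [div_le_iff₀' hr, sub_le_iff_le_add']
    have := abs_integral_sub_le hA hk hk1 hL (n := 2) (Or.inl rfl) (by norm_num; exact hp)
      (ψ := fun θ => -Real.log (Real.cos θ)) (by simp) (fun θ h0 h1 => hasDerivAt_neg_log_cos h0 h1)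
      (fun θ h0 h1 => cos_mul_tan_sq_le h0 h1) hx hx1
    rw [Real.cos_arccos (by linarith) hx1] at this
    exact this

/-- The rearrangement in which the constant `c_3` enters, as a number that is at least `1`. -/
lemma sqrt_cube_mul_le {s E F : ℝ} (hs : 0 ≤ s) (hE : 0 ≤ E) (hF : 0 ≤ F) :
    Real.sqrt (s ^ 3 * E * F) ≤ s ^ ((3 : ℝ) / 2) * Real.sqrt (cThree * E * F) := by
  rw [mul_assoc, Real.sqrt_mul (pow_nonneg hs 3)]
  have h1 : Real.sqrt (s ^ 3) = s ^ ((3 : ℝ) / 2) := by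
    rw [Real.sqrt_eq_rpow, ← Real.rpow_natCast, ← Real.rpow_mul hs]
    norm_num
  rw [h1]
  refine mul_le_mul_of_nonneg_left (Real.sqrt_le_sqrt ?_) (Real.rpow_nonneg hs _)
  rw [mul_assoc]
  exact le_mul_of_one_le_left (mul_nonneg hE hF) one_le_cThree

end WassersteinBounds

lemma dWass_le {E : Type*} [NormedAddCommGroup E] [MeasurableSpace E] {μ ν : Measure E} {c : ℝ}
    (hc : ∀ h : E → ℝ, LipschitzWith 1 h → |∫ x, h x ∂μ - ∫ x, h x ∂ν| ≤ c) :
    dWass μ ν ≤ ENNReal.ofReal c :=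
  iSup₂_le fun h hL => ENNReal.ofReal_le_ofReal (hc h hL)

theorem mainTheorem2 {Ω : Type*} [MeasurableSpace Ω] (P : Measure Ω) [IsProbabilityMeasure P]
    {d : ℕ} (W W' : Ω → EuclideanSpace ℝ (Fin d)) (Y Y' : Ω → ℝ)
    (S Ψ : Matrix (Fin d) (Fin d) ℝ) (lam ζ : ℝ)
    (R0p R0m : Ω → ℝ) (R1p R1m : Ω → EuclideanSpace ℝ (Fin d))
    (C2p C2m : Ω → Matrix (Fin d) (Fin d) ℝ)
    (hA : CondSteinAssumptions P W W' Y Y' S Ψ lam ζ R0p R0m R1p R1m C2p C2m)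
    (k : ℝ) (hk : 0 < P (Y ⁻¹' {k})) (hk1 : 0 < P (Y ⁻¹' {k - 1})) :
    cTwo < 1 ∧ cThree < 2 ∧
    (MemLp W 4 P →
      dWass (condLaw P W Y k) (multivariateGaussian 0 S) ≤ ENNReal.ofReal
        (AHat P Y Ψ R1p R1m k + 1 / 2 * opNorm (invSqrt S) * BHat P Y Ψ C2p C2m k
          + (1 + ratio P Y k) / (2 * QVal P Y lam)
            * (CHat P W Y S R0p R0m k + DHat P W W' Y k)
          + (1 + ratio P Y k) * opNorm (invSqrt S) ^ ((3 : ℝ) / 2)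
            * Real.sqrt (cThree * EHat P W W' Y Ψ lam k * FHat P W Y S k)) ∧
      (S = 1 →
        dWass (condLaw P W Y k) (stdGaussian (EuclideanSpace ℝ (Fin d))) ≤ ENNReal.ofReal
          (AHat P Y Ψ R1p R1m k + 1 / 2 * BHat P Y Ψ C2p C2m k
            + (1 + ratio P Y k) / (2 * QVal P Y lam)
              * (CHat P W Y S R0p R0m k + DHat P W W' Y k)
            + (1 + ratio P Y k)
              * ((d : ℝ) + condPair P Y k (fun ω => ‖W ω‖ ^ 2)) ^ ((1 : ℝ) / 4)
              * Real.sqrt (EHat P W W' Y Ψ lam k)))) ∧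
    (MemLp W 3 P →
      dWass (condLaw P W Y k) (multivariateGaussian 0 S) ≤ ENNReal.ofReal
        (AHat P Y Ψ R1p R1m k + 1 / 2 * opNorm (invSqrt S) * BHat P Y Ψ C2p C2m k
          + (1 + ratio P Y k) / (2 * QVal P Y lam)
            * (CHat P W Y S R0p R0m k + DHat P W W' Y k)
          + cTwo * (1 + ratio P Y k) * opNorm (invSqrt S) ^ 2
            * EHat' P W W' Y Ψ lam k * FHat' P W W' Y S Ψ lam k)) := by
  have hr : 0 ≤ 1 + ratio P Y k := by linarith [ratio_nonneg (P := P) (Y := Y) k]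
  have hE : 0 ≤ EHat P W W' Y Ψ lam k := jumpMoment_nonneg (P := P) (Y := Y) k 3
  refine ⟨cTwo_lt_one, cThree_lt_two, fun hp => ⟨?_, fun hS1 => ?_⟩, fun hp => ?_⟩
  · refine dWass_le fun h hL =>
      (abs_integral_sub_le_sqrt hA hk.ne' hk1.ne' hp hL).trans ?_
    rw [mul_assoc (1 + ratio P Y k)]
    gcongr
    exact sqrt_cube_mul_le (opNorm_nonneg _) hE (FHat_nonneg k)
  · have hs1 : opNorm (invSqrt S) ≤ 1 := by rw [hS1, invSqrt_one]; exact opNorm_one_le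
    rw [← multivariateGaussian_zero_one, ← hS1]
    refine dWass_le fun h hL =>
      (abs_integral_sub_le_sqrt hA hk.ne' hk1.ne' hp hL).trans ?_
    have hM : 0 ≤ (d : ℝ) + condPair P Y k (fun ω => ‖W ω‖ ^ 2) :=
      add_nonneg d.cast_nonneg (condPair_nonneg (fun _ => by positivity) k)
    have hF : FHat P W Y S k
        = Real.sqrt ((d : ℝ) + condPair P Y k (fun ω => ‖W ω‖ ^ 2)) := by
      rw [FHat, hS1, Matrix.trace_one, Fintype.card_fin]
    have hF4 : Real.sqrt (FHat P W Y S k)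
        = ((d : ℝ) + condPair P Y k (fun ω => ‖W ω‖ ^ 2)) ^ ((1 : ℝ) / 4) := by
      rw [hF, Real.sqrt_eq_rpow, Real.sqrt_eq_rpow, ← Real.rpow_mul hM]
      norm_num
    have hB := BHat_nonneg (P := P) (Y := Y) (Ψ := Ψ) (C2p := C2p) (C2m := C2m) k
    have h3 : opNorm (invSqrt S) ^ 3 ≤ 1 := pow_le_one₀ (opNorm_nonneg _) hs1
    have h4 : Real.sqrt (opNorm (invSqrt S) ^ 3 * EHat P W W' Y Ψ lam k * FHat P W Y S k)
        ≤ ((d : ℝ) + condPair P Y k (fun ω => ‖W ω‖ ^ 2)) ^ ((1 : ℝ) / 4)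
          * Real.sqrt (EHat P W W' Y Ψ lam k) := by
      rw [← hF4, ← Real.sqrt_mul (FHat_nonneg k), mul_comm (FHat P W Y S k)]
      refine Real.sqrt_le_sqrt (mul_le_mul_of_nonneg_right ?_ (FHat_nonneg k))
      exact mul_le_of_le_one_left hE h3
    rw [mul_assoc (1 + ratio P Y k)]
    gcongr
    linarith
  · exact dWass_le fun h hL => abs_integral_sub_le_log hA hk.ne' hk1.ne' hp hL

end
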